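/- Let $X$ be a complex Banach space. For $0<\varphi<\pi$ put $S_\varphi=\{z\in\mathbb C: z\ne 0,\ |\arg z|<\varphi\}$. Let $A$ be a linear operator on $X$ with domain $D(A)$ (neither dense domain nor injectivity is required) which is sectorial: for some $\varphi\in(0,\pi)$ the spectrum of $A$ is contained in $\overline{S_\varphi}$ and $\sup_{z\ne0,\,z\notin S_{\varphi'}}\|zR(z,A)\|<\infty$ for every $\varphi'\in(\varphi,\pi)$, where $R(z,A)=(z-A)^{-1}$; let $\varphi_A$ be the infimum of all such $\varphi$, and fix $\varphi\in(\varphi_A,\pi)$. Let $H^\infty_0(S_\varphi)$ be the set of bounded holomorphic functions $f$ on $S_\varphi$ with $|f(z)|\le C\min(|z|^s,|z|^{-s})$ for some $C$ and some $s>0$, and let $\mathcal E(S_\varphi)=H^\infty_0(S_\varphi)\oplus\langle (1+z)^{-1}\rangle\oplus\langle 1\rangle$. For $f=f_0+\lambda(1+z)^{-1}+\mu\in\mathcal E(S_\varphi)$ with $f_0\in H_0^\infty(S_\varphi)$ and $\lambda,\mu\in\mathbb C$, put $$f(A)=\frac1{2\pi i}\int_{\partial S_\omega}f_0(z)R(z,A)\,dz+\lambda(I+A)^{-1}+\mu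 I ,$$ with any $\omega\in(\varphi_A,\varphi)$ (the value does not depend on $\omega$) and with $\partial S_\omega$ oriented so that $S_\omega$ lies on its left; the operators $tA$, $t>0$, are sectorial with the same angle, so $f(tA)$ is defined in the same way. A Banach function space $\Phi$ is a Banach space that is a linear subspace of the space of (classes of) complex measurable functions on $(0,\infty)$ such that $|f|\le|g|$ a.e., $g\in\Phi$ and $f$ measurable imply $f\in\Phi$ and $\|f\|_\Phi\le\|g\|_\Phi$. Put $$Pf(t)=\frac1t\int_0^tf(s)\,ds,\qquad Qf(t)=\int_t^\infty f(s)\,\frac{ds}{s}.$$ With $K(t,x)=\inf\{|a|_X+t(|b|_X+|Ab|_X): a\in X,\ b\in D(A),\ a+b=x\}$, let $$(X,D(A))_\Phi=\{x\in X:\ t^{-1}K(t,x)\in\Phi\},\qquad |x|_{(X,D(A))_\Phi}=\|t^{-1}K(t,x)\|_\Phi .$$ Let $\psi\ne0$ be a holomorphic function on $S_\varphi$ such that $\psi$ and $z^{-1}\psi$ belong to $\mathcal E(S_\varphi)$. Then for every Banach function space $\Phi$ which contains the function $\min(1,1/t)$ and on which the Calderón operator $P+Q$ is (everywhere defined and)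 bounded, $$(X,D(A))_\Phi=\{x\in X:\ [t\mapsto|t^{-1}\psi(tA)x|_X]\in\Phi\},$$ and there are constants $c,C>0$ such that for all $x\in(X,D(A))_\Phi$ $$c\bigl(|x|_X+\|t^{-1}|\psi(tA)x|_X\|_\Phi\bigr)\le|x|_{(X,D(A))_\Phi}\le C\bigl(|x|_X+\|t^{-1}|\psi(tA)x|_X\|_\Phi\bigr).$$ If, in addition, $A$ is invertible (i.e. $A$ has a bounded inverse defined on all of $X$), then there are constants $c,C>0$ such that for all $x\in(X,D(A))_\Phi$ $$c\,\|t^{-1}|\psi(tA)x|_X\|_\Phi\le|x|_{(X,D(A))_\Phi}\le C\,\|t^{-1}|\psi(tA)x|_X\|_\Phi .$$ -/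

import Mathlib

open MeasureTheory Set

noncomputable section

/-! ### Sectorial operators -/

section Operators

variable {X : Type*} [NormedAddCommGroup X] [NormedSpace ℂ X]

/-- The open sector `{z ≠ 0 : |arg z| < φ}`. -/
def sector (φ : ℝ) : Set ℂ := {z | z ≠ 0 ∧ |Complex.arg z| < φ}

/-- The bounded operator `R` is the inverse of `z - A : D(A) → X`. -/
def IsResolventAt (A : X →ₗ.[ℂ] X) (z : ℂ) (R : X →L[ℂ] X) : Prop :=
  (∀ x : X, ∃ h : R x ∈ A.domain, z • R x - A ⟨R x, h⟩ = x) ∧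
    ∀ y : A.domain, R (z • (y : X) - A y) = y

/-- The resolvent set of an unbounded operator. -/
def opResolventSet (A : X →ₗ.[ℂ] X) : Set ℂ := {z | ∃ R : X →L[ℂ] X, IsResolventAt A z R}

/-- The spectrum of an unbounded operator. -/
def opSpectrum (A : X →ₗ.[ℂ] X) : Set ℂ := (opResolventSet A)ᶜ

open Classical in
/-- The resolvent `R(z, A) = (z - A)⁻¹`, for `z` in the resolvent set (and `0` elsewhere). -/
def opResolvent (A : X →ₗ.[ℂ] X) (z : ℂ) : X →L[ℂ] X :=
  if h : ∃ R : X →L[ℂ] X, IsResolventAt A z R then h.choose else 0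

/-- `A` is sectorial of angle `φ ∈ (0, π)`. The domain need not be dense and `A` need not be
injective. -/
def IsSectorialOfAngle (A : X →ₗ.[ℂ] X) (φ : ℝ) : Prop :=
  φ ∈ Ioo 0 Real.pi ∧ opSpectrum A ⊆ closure (sector φ) ∧
    ∀ φ' ∈ Ioo φ Real.pi, ∃ M : ℝ, ∀ z : ℂ, z ≠ 0 → z ∉ sector φ' → ‖z • opResolvent A z‖ ≤ M

/-- `A` is sectorial of some angle. -/
def IsSectorial (A : X →ₗ.[ℂ] X) : Prop := ∃ φ : ℝ, IsSectorialOfAngle A φ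

/-- The angle of sectoriality of a sectorial operator. -/
def sectorialityAngle (A : X →ₗ.[ℂ] X) : ℝ := sInf {φ : ℝ | IsSectorialOfAngle A φ}

/-- `A : D(A) → X` has a bounded inverse. -/
def OpInvertible (A : X →ₗ.[ℂ] X) : Prop := (0 : ℂ) ∈ opResolventSet A

/-! ### The primary holomorphic functional calculus

A function on the sector is a function on `ℂ` of which only the values on the sector matter. -/

/-- Bounded holomorphic functions on the sector. -/
def MemHInf (φ : ℝ) (f : ℂ → ℂ) : Prop :=
  DifferentiableOn ℂ f (sector φ) ∧ ∃ C : ℝ, ∀ z ∈ sector φ, ‖f z‖ ≤ C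

/-- Functions in `H^∞` that decay polynomially at `0` and at infinity. -/
def MemHInfZero (φ : ℝ) (f : ℂ → ℂ) : Prop :=
  MemHInf φ f ∧ ∃ C s : ℝ, 0 < s ∧ ∀ z ∈ sector φ, ‖f z‖ ≤ C * min (‖z‖ ^ s) (‖z‖ ^ (-s))

/-- `f = f₀ + l (1 + z)⁻¹ + m` on the sector, with `f₀ ∈ H^∞_0` and constants `l`, `m`.
On the sector the three terms are unique. -/
def IsEDecomposition (φ : ℝ) (f f₀ : ℂ → ℂ) (l m : ℂ) : Prop :=
  MemHInfZero φ f₀ ∧ ∀ z ∈ sector φ, f z = f₀ z + l * (1 + z)⁻¹ + m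

/-- The class `𝓔(S_φ) = H^∞_0(S_φ) ⊕ ⟨(1 + z)⁻¹⟩ ⊕ ⟨1⟩`. -/
def MemE (φ : ℝ) (f : ℂ → ℂ) : Prop :=
  ∃ (f₀ : ℂ → ℂ) (l m : ℂ), IsEDecomposition φ f f₀ l m

/-- `(2πi)⁻¹ ∫ f(z) R(z, A) dz` over the boundary of the sector of angle `ω`, which runs from
`∞ e^{iω}` to `0` and then from `0` to `∞ e^{-iω}` (the sector lies on its left). -/
def sectorContourIntegral (A : X →ₗ.[ℂ] X) (ω : ℝ) (f : ℂ → ℂ) : X →L[ℂ] X :=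
  (2 * Real.pi * Complex.I : ℂ)⁻¹ •
    ((∫ r in Ioi (0 : ℝ), (f (r * Complex.exp (-(ω * Complex.I))) *
          Complex.exp (-(ω * Complex.I))) •
        opResolvent A (r * Complex.exp (-(ω * Complex.I)))) -
      ∫ r in Ioi (0 : ℝ), (f (r * Complex.exp (ω * Complex.I)) *
          Complex.exp (ω * Complex.I)) •
        opResolvent A (r * Complex.exp (ω * Complex.I)))

/-- `f(A)` for `f ∈ H^∞_0(S_φ)`, where `φ` exceeds the angle of sectoriality of `A`. Any contour
strictly between the two angles gives the same operator, by Cauchy's theorem; the one half-way is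
used. -/
def hInfZeroCalculus (A : X →ₗ.[ℂ] X) (φ : ℝ) (f : ℂ → ℂ) : X →L[ℂ] X :=
  sectorContourIntegral A ((sectorialityAngle A + φ) / 2) f

open Classical in
/-- `f(A) = f₀(A) + l (1 + A)⁻¹ + m` for `f = f₀ + l (1 + z)⁻¹ + m ∈ 𝓔(S_φ)`
(and `0` if `f` is not in `𝓔(S_φ)`); note that `(1 + A)⁻¹ = -R(-1, A)`. -/
def primaryCalculus (A : X →ₗ.[ℂ] X) (φ : ℝ) (f : ℂ → ℂ) : X →L[ℂ] X :=
  if h : ∃ p : (ℂ → ℂ) × ℂ × ℂ, IsEDecomposition φ f p.1 p.2.1 p.2.2 then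
    hInfZeroCalculus A φ h.choose.1 + h.choose.2.1 • (-opResolvent A (-1)) +
      h.choose.2.2 • ContinuousLinearMap.id ℂ X
  else 0

end Operators

/-! ### Banach function spaces over the half-line -/

/-- A Banach function space over the half-line: a Banach space that is an order ideal, with
monotone norm, of the space of all (classes modulo null sets of) complex measurable functions on
the half-line. -/
structure BanachFunctionSpace where
  /-- the underlying space of classes of measurable functions -/
  carrier : Submodule ℂ (ℝ →ₘ[volume.restrict (Ioi (0 : ℝ))] ℂ)
  /-- the norm -/
  nrm : Seminorm ℂ carrier
  eq_zero_of_nrm : ∀ f : carrier, nrm f = 0 → f = 0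
  complete : ∀ u : ℕ → carrier,
    (∀ ε : ℝ, 0 < ε → ∃ N : ℕ, ∀ m ≥ N, ∀ n ≥ N, nrm (u m - u n) < ε) →
      ∃ f : carrier, Filter.Tendsto (fun n => nrm (u n - f)) Filter.atTop (nhds 0)
  ideal : ∀ (f : ℝ →ₘ[volume.restrict (Ioi (0 : ℝ))] ℂ) (g : carrier),
    (∀ᵐ t ∂(volume.restrict (Ioi (0 : ℝ))),
        ‖f t‖ ≤ ‖(g : ℝ →ₘ[volume.restrict (Ioi (0 : ℝ))] ℂ) t‖) →
      ∃ hf : f ∈ carrier, nrm ⟨f, hf⟩ ≤ nrm g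

namespace BanachFunctionSpace

/-- The function `f` on the half-line belongs to `Φ`, i.e. its class does; in particular `f` is
almost everywhere equal to a measurable function. Values of `f` outside `(0, ∞)` are irrelevant. -/
def Mem (Φ : BanachFunctionSpace) (f : ℝ → ℂ) : Prop :=
  ∃ g : Φ.carrier,
    ((g : ℝ →ₘ[volume.restrict (Ioi (0 : ℝ))] ℂ) : ℝ → ℂ) =ᵐ[volume.restrict (Ioi (0 : ℝ))] f

open Classical in
/-- The norm in `Φ` of a function that belongs to `Φ` (and `0` for other functions). -/
def norm (Φ : BanachFunctionSpace) (f : ℝ → ℂ) : ℝ :=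
  if h : Φ.Mem f then Φ.nrm h.choose else 0

end BanachFunctionSpace

/-- The Hardy operator. -/
def hardyP (f : ℝ → ℂ) (t : ℝ) : ℂ := ((t⁻¹ : ℝ) : ℂ) * ∫ s in Ioc 0 t, f s

/-- The formal adjoint of the Hardy operator. -/
def hardyQ (f : ℝ → ℂ) (t : ℝ) : ℂ := ∫ s in Ioi t, ((s⁻¹ : ℝ) : ℂ) * f s

/-- The Calderón operator `P + Q` is (everywhere defined and) bounded on `Φ`. -/
def CalderonBounded (Φ : BanachFunctionSpace) : Prop :=
  ∃ C : ℝ, ∀ f : ℝ → ℂ, Φ.Mem f →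
    (∀ t : ℝ, 0 < t → IntegrableOn f (Ioc 0 t)) ∧
    (∀ t : ℝ, 0 < t → IntegrableOn (fun s => ((s⁻¹ : ℝ) : ℂ) * f s) (Ioi t)) ∧
    Φ.Mem (fun t => hardyP f t + hardyQ f t) ∧
    Φ.norm (fun t => hardyP f t + hardyQ f t) ≤ C * Φ.norm f

/-- The class of Banach function spaces that contain `min(1, 1/t)` and on which the Calderón
operator `P + Q` is bounded. -/
def MemLPQ (Φ : BanachFunctionSpace) : Prop :=
  Φ.Mem (fun t => ((min 1 t⁻¹ : ℝ) : ℂ)) ∧ CalderonBounded Φ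

/-! ### The K-method for the couple `(X, D(A))` -/

section Interpolation

variable {X : Type*} [NormedAddCommGroup X] [NormedSpace ℂ X]

/-- The K-functional `K(t, x)` of the couple `(X, D(A))`, where `D(A)` carries the graph norm. -/
def kFunctional (A : X →ₗ.[ℂ] X) (t : ℝ) (x : X) : ℝ :=
  sInf {r : ℝ | ∃ (a : X) (b : A.domain), a + (b : X) = x ∧
    r = ‖a‖ + t * (‖(b : X)‖ + ‖A b‖)}

/-- The real interpolation space `(X, D(A))_Φ` (note that `X + D(A) = X`). -/
def interpSpace (A : X →ₗ.[ℂ] X) (Φ : BanachFunctionSpace) : Set X :=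
  {x | Φ.Mem (fun t => ((t⁻¹ * kFunctional A t x : ℝ) : ℂ))}

/-- The norm of the real interpolation space `(X, D(A))_Φ`. -/
def interpNorm (A : X →ₗ.[ℂ] X) (Φ : BanachFunctionSpace) (x : X) : ℝ :=
  Φ.norm (fun t => ((t⁻¹ * kFunctional A t x : ℝ) : ℂ))

/-- The function `t ↦ |t⁻¹ ψ(tA) x|` on the half-line. -/
def orbitFun (A : X →ₗ.[ℂ] X) (φ : ℝ) (ψ : ℂ → ℂ) (x : X) (t : ℝ) : ℂ :=
  ((‖((t⁻¹ : ℝ) : ℂ) • primaryCalculus ((t : ℂ) • A) φ ψ x‖ : ℝ) : ℂ)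

/-- Two functionals are equivalent on the set `S`. -/
def EquivalentOn (S : Set X) (N₁ N₂ : X → ℝ) : Prop :=
  ∃ c C : ℝ, 0 < c ∧ 0 < C ∧ ∀ x ∈ S, c * N₂ x ≤ N₁ x ∧ N₁ x ≤ C * N₂ x

end Interpolation

end

/-! Two pointwise comparisons carry the theorem: the orbit `‖ψ(tA)x‖` is bounded by the
K-functional, and the K-functional is bounded by the Calderón operator of the orbit plus a multiple
of `min(1, 1/t)‖x‖`.

Normal form. Limits along the positive axis show that `ψ` vanishes at `0` and `z⁻¹ψ` at infinity, so
`ψ = f₀ + l(1+z)⁻¹ - l` and `z⁻¹ψ = χ₀ + m(1+z)⁻¹ =: χ` (`exists_eCalc_representation`).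

From K to orbits. The operators `ψ(tA)` and `χ(tA)` are bounded uniformly in `t`, and `ψ(tA)b =
χ(tA)(tAb)` for `b ∈ D(A)`. Splitting `x = a + b` gives `‖ψ(tA)x‖ ≤ C K(t,x)`
(`exists_norm_eCalc_smul_le`). The Calderón operator plays no role here.

From orbits to K. The splitting `x = (x - (1+tA)⁻¹x) + (1+tA)⁻¹x` reduces `K(t,x)` to `‖x -
(1+tA)⁻¹x‖`, up to the `min(1, 1/t)` term (`inv_mul_kFunctional_le`). Formally, `∫₀^∞
sA(1+sA)^{-k-2} ψ(sA) ds/s` is the scalar `c_k = ∫₀^∞ (1+s)^{-k-2} ψ(s) ds`. Some `c_k` is nonzero: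
otherwise the Weierstrass theorem makes `ψ` vanish on the half-line, hence on the sector
(`exists_rayIntegral_weighted_ne_zero`). Now apply `1 - (1+tA)⁻¹`. Its product with
`sA(1+sA)^{-k-2}` has norm at most a constant times `min(1, t/s)`, and integrating this kernel
against `‖ψ(sA)x‖ ds/s` produces exactly `t(P+Q)` of the orbit function (`norm_sub_onePlusInv_le`).

Since `A` may have a kernel and a non-dense domain, the formula is proved only after multiplication
by `(1+A)⁻¹ - (1+2A)⁻¹ = A(1+A)⁻¹(1+2A)⁻¹`. The injective factor `(1+2A)⁻¹` is then cancelled, which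
leaves an identity for `x - (1+A)⁻¹x` (`smul_sub_onePlusInv_eq`). Of the functional calculus only
products with resolvents and the value at `(1+z)⁻¹ - (1+2z)⁻¹` are needed; there is no general
product rule.

If `A` is invertible, `‖x‖` is bounded by `‖x - (1+A)⁻¹x‖`, hence by the Calderón operator of the
orbit at `t = 1`, and so by the norm of the orbit in `Φ` (`exists_norm_le_orbit`). -/

noncomputable section

/-! ### Integrals along rays -/

section Rays

open Filter Topology

variable {E : Type*} [NormedAddCommGroup E] [NormedSpace ℂ E]

/-- The point `r e^{iθ}`. -/
def rayPoint (θ r : ℝ) : ℂ := r * Complex.exp (θ * Complex.I)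

/-- The integral of `g` along the ray of angle `θ` issuing from the origin. -/
def rayIntegral (θ : ℝ) (g : ℂ → E) : E :=
  ∫ r in Ioi (0 : ℝ), Complex.exp (θ * Complex.I) • g (rayPoint θ r)

lemma norm_rayPoint (θ : ℝ) {r : ℝ} (hr : 0 < r) : ‖rayPoint θ r‖ = r := by
  simp [rayPoint, Complex.norm_exp_ofReal_mul_I, abs_of_pos hr]

lemma rayPoint_ne_zero (θ : ℝ) {r : ℝ} (hr : 0 < r) : rayPoint θ r ≠ 0 := by
  rw [← norm_pos_iff, norm_rayPoint θ hr]; exact hr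

lemma continuous_rayPoint (θ : ℝ) : Continuous (rayPoint θ) := by
  unfold rayPoint; fun_prop

lemma rayPoint_mul (θ a r : ℝ) : rayPoint θ (a * r) = a * rayPoint θ r := by
  simp [rayPoint, mul_assoc]

lemma rayPoint_zero_left (r : ℝ) : rayPoint 0 r = r := by simp [rayPoint]

lemma rayPoint_exp (θ x : ℝ) : Complex.exp (x + θ * Complex.I) = rayPoint θ (Real.exp x) := by
  simp [rayPoint, Complex.exp_add]

/-- The weight `r⁻¹ min(r^s, r^{-s})`. -/
def rayWeight (s r : ℝ) : ℝ := r⁻¹ * min (r ^ s) (r ^ (-s))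

lemma rayWeight_nonneg (s : ℝ) {r : ℝ} (hr : 0 < r) : 0 ≤ rayWeight s r := by
  unfold rayWeight; positivity

lemma integrableOn_rayWeight {s : ℝ} (hs : 0 < s) : IntegrableOn (rayWeight s) (Ioi 0) := by
  have hmeas : Measurable (rayWeight s) := by unfold rayWeight; fun_prop
  rw [← Ioc_union_Ioi_eq_Ioi (zero_le_one : (0 : ℝ) ≤ 1)]
  refine IntegrableOn.union ?_ ?_
  · have h1 : IntegrableOn (fun r : ℝ => r ^ (s - 1)) (Ioc 0 1) :=
      (intervalIntegrable_iff_integrableOn_Ioc_of_le zero_le_one).1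
        (intervalIntegral.intervalIntegrable_rpow' (by linarith))
    refine h1.mono' hmeas.aestronglyMeasurable ?_
    filter_upwards [ae_restrict_mem measurableSet_Ioc] with r hr
    rw [Real.norm_of_nonneg (rayWeight_nonneg s hr.1), Real.rpow_sub_one hr.1.ne', div_eq_inv_mul]
    exact mul_le_mul_of_nonneg_left (min_le_left _ _) (inv_nonneg.2 hr.1.le)
  · have h1 : IntegrableOn (fun r : ℝ => r ^ (-s - 1)) (Ioi 1) :=
      integrableOn_Ioi_rpow_of_lt (by linarith) one_pos
    refine h1.mono' hmeas.aestronglyMeasurable ?_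
    filter_upwards [ae_restrict_mem measurableSet_Ioi] with r hr
    have hr0 : 0 < r := one_pos.trans hr
    rw [Real.norm_of_nonneg (rayWeight_nonneg s hr0), Real.rpow_sub_one hr0.ne', div_eq_inv_mul]
    exact mul_le_mul_of_nonneg_left (min_le_right _ _) (inv_nonneg.2 hr0.le)

/-- `g` is bounded by a multiple of `r⁻¹ min(r^s, r^{-s})` on the rays with angle in `[α, β]`. -/
def RayDecay (α β : ℝ) (g : ℂ → E) : Prop :=
  ∃ C s : ℝ, 0 < s ∧ ∀ θ ∈ Icc α β, ∀ r : ℝ, 0 < r → ‖g (rayPoint θ r)‖ ≤ C * rayWeight s r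

lemma RayDecay.integrableOn {α β θ : ℝ} {g : ℂ → E} (h : RayDecay α β g) (hθ : θ ∈ Icc α β)
    (hg : ∀ r : ℝ, 0 < r → ContinuousAt g (rayPoint θ r)) :
    IntegrableOn (fun r => Complex.exp (θ * Complex.I) • g (rayPoint θ r)) (Ioi 0) := by
  obtain ⟨C, s, hs, hC⟩ := h
  refine ((integrableOn_rayWeight hs).const_mul C).mono' ?_ ?_
  · refine ContinuousOn.aestronglyMeasurable (fun r hr => ?_) measurableSet_Ioi
    exact (((hg r hr).comp (continuous_rayPoint θ).continuousAt).const_smul _).continuousWithinAt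
  · filter_upwards [ae_restrict_mem measurableSet_Ioi] with r hr
    rw [norm_smul, Complex.norm_exp_ofReal_mul_I, one_mul]
    exact hC θ hθ r hr

lemma integral_Ioi_eq_integral_exp (h : ℝ → E) :
    ∫ r in Ioi (0 : ℝ), h r = ∫ x : ℝ, Real.exp x • h (Real.exp x) := by
  have := integral_image_eq_integral_abs_deriv_smul (f := Real.exp) (f' := Real.exp) (s := univ)
    MeasurableSet.univ (fun x _ => (Real.hasDerivAt_exp x).hasDerivWithinAt)
    Real.exp_injective.injOn h
  rw [image_univ, Real.range_exp] at this
  simpa [abs_of_pos (Real.exp_pos _)] using this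

lemma integrable_exp_of_integrableOn_Ioi {h : ℝ → E} (hh : IntegrableOn h (Ioi 0)) :
    Integrable (fun x : ℝ => Real.exp x • h (Real.exp x)) := by
  have := integrableOn_image_iff_integrableOn_abs_deriv_smul (f := Real.exp) (f' := Real.exp)
    (s := univ) MeasurableSet.univ (fun x _ => (Real.hasDerivAt_exp x).hasDerivWithinAt)
    Real.exp_injective.injOn h
  rw [image_univ, Real.range_exp] at this
  simpa [abs_of_pos (Real.exp_pos _)] using this.1 hh

/-- Cauchy's theorem: rays may be rotated through a region where the integrand is holomorphic. -/
theorem rayIntegral_eq_of_differentiableAt {α β : ℝ} (hαβ : α ≤ β) {g : ℂ → E}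
    (hd : RayDecay α β g)
    (hg : ∀ θ ∈ Icc α β, ∀ r : ℝ, 0 < r → DifferentiableAt ℂ g (rayPoint θ r)) :
    rayIntegral α g = rayIntegral β g := by
  -- The substitution `z = e^w` turns the ray of angle `θ` into the line `Im w = θ` and the region
  -- between the rays into a strip.
  set G : ℂ → E := fun w => Complex.exp w • g (Complex.exp w) with hG
  have hGx : ∀ θ x : ℝ, G (x + θ * Complex.I) =
      Real.exp x • (Complex.exp (θ * Complex.I) • g (rayPoint θ (Real.exp x))) := by
    intro θ x
    simp only [hG, rayPoint_exp]
    rw [← Complex.coe_smul, smul_smul, rayPoint]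
  have hray : ∀ θ, rayIntegral θ g = ∫ x : ℝ, G (x + θ * Complex.I) := by
    intro θ
    rw [rayIntegral, integral_Ioi_eq_integral_exp]
    exact integral_congr_ae (Eventually.of_forall fun x => (hGx θ x).symm)
  have hint : ∀ θ ∈ Icc α β, Integrable (fun x : ℝ => G (x + θ * Complex.I)) := by
    intro θ hθ
    refine (integrable_exp_of_integrableOn_Ioi
      (hd.integrableOn hθ fun r hr => (hg θ hθ r hr).continuousAt)).congr ?_
    exact Eventually.of_forall fun x => (hGx θ x).symm
  obtain ⟨C, s, hs, hC⟩ := hd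
  -- The Jacobian `e^x` cancels the `r⁻¹` of the weight and leaves exponential decay at both ends of
  -- the strip.
  have hbd : ∀ θ ∈ Icc α β, ∀ x : ℝ, ‖G (x + θ * Complex.I)‖ ≤ |C| * Real.exp (-s * |x|) := by
    intro θ hθ x
    rw [hGx, norm_smul, norm_smul, Complex.norm_exp_ofReal_mul_I, one_mul,
      Real.norm_of_nonneg (Real.exp_pos x).le]
    have h1 := hC θ hθ _ (Real.exp_pos x)
    have h2 : rayWeight s (Real.exp x) ≤ (Real.exp x)⁻¹ * Real.exp (-s * |x|) := by
      rw [rayWeight]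
      refine mul_le_mul_of_nonneg_left ?_ (by positivity)
      rw [← Real.exp_mul, ← Real.exp_mul]
      rcases le_total 0 x with h | h
      · rw [abs_of_nonneg h]; exact (min_le_right _ _).trans (by rw [mul_comm])
      · rw [abs_of_nonpos h]
        exact (min_le_left _ _).trans (Real.exp_le_exp.2 (by linarith))
    have h3 : C * rayWeight s (Real.exp x) ≤ |C| * ((Real.exp x)⁻¹ * Real.exp (-s * |x|)) :=
      (mul_le_mul_of_nonneg_right (le_abs_self C) (rayWeight_nonneg s (Real.exp_pos x))).trans
        (mul_le_mul_of_nonneg_left h2 (abs_nonneg C))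
    calc Real.exp x * ‖g (rayPoint θ (Real.exp x))‖
        ≤ Real.exp x * (|C| * ((Real.exp x)⁻¹ * Real.exp (-s * |x|))) :=
          mul_le_mul_of_nonneg_left (h1.trans h3) (Real.exp_pos x).le
      _ = |C| * Real.exp (-s * |x|) := by
          field_simp
  have hrect : ∀ n : ℕ, (∫ x : ℝ in (-(n : ℝ))..n, G (x + α * Complex.I)) -
      (∫ x : ℝ in (-(n : ℝ))..n, G (x + β * Complex.I)) +
      Complex.I • (∫ y : ℝ in α..β, G (((n : ℝ) : ℂ) + y * Complex.I)) -
      Complex.I • (∫ y : ℝ in α..β, G ((((-n : ℝ)) : ℂ) + y * Complex.I)) = 0 := by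
    intro n
    have := Complex.integral_boundary_rect_eq_zero_of_differentiableOn G
      ⟨-(n : ℝ), α⟩ ⟨(n : ℝ), β⟩ ?_
    · simpa using this
    · intro w hw
      rw [Complex.mem_reProdIm] at hw
      have hw2 : w.im ∈ Icc α β := by simpa [uIcc_of_le hαβ] using hw.2
      have hwe : Complex.exp w = rayPoint w.im (Real.exp w.re) := by
        rw [← rayPoint_exp, Complex.re_add_im]
      have h1 : DifferentiableAt ℂ g (Complex.exp w) := by
        rw [hwe]; exact hg _ hw2 _ (Real.exp_pos _)
      exact (Complex.differentiableAt_exp.smul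
        (h1.comp w Complex.differentiableAt_exp)).differentiableWithinAt
  have hexp : Tendsto (fun n : ℕ => |C| * Real.exp (-s * n) * |β - α|) atTop (𝓝 0) := by
    have h1 : Tendsto (fun n : ℕ => Real.exp (-s * n)) atTop (𝓝 0) := by
      refine Real.tendsto_exp_atBot.comp ?_
      exact (tendsto_natCast_atTop_atTop).const_mul_atTop_of_neg (by linarith)
    simpa using (h1.const_mul |C|).mul_const |β - α|
  -- The vertical sides have fixed length, so the decay of the integrand makes them disappear as the
  -- rectangle grows.
  have hvert : ∀ u : ℕ → ℝ, (∀ n, |u n| = n) →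
      Tendsto (fun n : ℕ => ∫ y : ℝ in α..β, G ((u n : ℂ) + y * Complex.I)) atTop (𝓝 0) := by
    intro u hu
    refine squeeze_zero_norm (fun n => ?_) hexp
    refine intervalIntegral.norm_integral_le_of_norm_le_const fun y hy => ?_
    rw [uIoc_of_le hαβ] at hy
    have := hbd y ⟨hy.1.le, hy.2⟩ (u n)
    rwa [hu n] at this
  have hlim : ∀ θ ∈ Icc α β, Tendsto (fun n : ℕ => ∫ x : ℝ in (-(n : ℝ))..n,
      G (x + θ * Complex.I)) atTop (𝓝 (∫ x : ℝ, G (x + θ * Complex.I))) := fun θ hθ =>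
    intervalIntegral_tendsto_integral (hint θ hθ)
      (tendsto_neg_atTop_atBot.comp tendsto_natCast_atTop_atTop) tendsto_natCast_atTop_atTop
  have h4 := (((hlim α ⟨le_rfl, hαβ⟩).sub (hlim β ⟨hαβ, le_rfl⟩)).add
    ((hvert (fun n => n) fun n => by simp).const_smul Complex.I)).sub
    ((hvert (fun n => -n) fun n => by simp).const_smul Complex.I)
  simp only [hrect, smul_zero, add_zero, sub_zero] at h4
  have h5 := tendsto_nhds_unique h4 tendsto_const_nhds
  rw [hray, hray]
  exact sub_eq_zero.1 h5

end Rays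

/-! ### Sectors -/

section SectorGeometry

/-- Cosine is strictly decreasing on `[0, π]`, so a bound on `|arg z|` is a lower bound on `re z /
|z|`. In this form openness and invariance under scaling are immediate. -/
lemma mem_sector_iff {φ : ℝ} (hφ : φ ∈ Ioo 0 Real.pi) {z : ℂ} :
    z ∈ sector φ ↔ z ≠ 0 ∧ ‖z‖ * Real.cos φ < z.re := by
  refine and_congr_right fun hz => ?_
  have hz' : 0 < ‖z‖ := norm_pos_iff.2 hz
  rw [← Complex.norm_mul_cos_arg z, mul_lt_mul_iff_right₀ hz', ← Real.cos_abs (Complex.arg z)]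
  exact (Real.strictAntiOn_cos.lt_iff_gt ⟨hφ.1.le, hφ.2.le⟩
    ⟨abs_nonneg _, Complex.abs_arg_le_pi z⟩).symm

lemma isOpen_sector {φ : ℝ} (hφ : φ ∈ Ioo 0 Real.pi) : IsOpen (sector φ) := by
  have : sector φ = {z : ℂ | z ≠ 0} ∩ {z : ℂ | ‖z‖ * Real.cos φ < z.re} := by
    ext z; exact mem_sector_iff hφ
  rw [this]
  exact isOpen_ne.inter (isOpen_lt (by fun_prop) Complex.continuous_re)

lemma closure_sector_subset {φ : ℝ} (hφ : φ ∈ Ioo 0 Real.pi) :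
    closure (sector φ) ⊆ {z : ℂ | ‖z‖ * Real.cos φ ≤ z.re} := by
  refine closure_minimal (fun z hz => ((mem_sector_iff hφ).1 hz).2.le) ?_
  exact isClosed_le (by fun_prop) Complex.continuous_re

lemma re_rayPoint (θ r : ℝ) : (rayPoint θ r).re = r * Real.cos θ := by
  simp [rayPoint, Complex.exp_ofReal_mul_I_re]

lemma rayPoint_mem_sector_iff {φ : ℝ} (hφ : φ ∈ Ioo 0 Real.pi) {θ r : ℝ} (hr : 0 < r) :
    rayPoint θ r ∈ sector φ ↔ Real.cos φ < Real.cos θ := by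
  rw [mem_sector_iff hφ, norm_rayPoint θ hr, re_rayPoint, mul_lt_mul_iff_right₀ hr,
    and_iff_right (rayPoint_ne_zero θ hr)]

lemma cos_le_cos_of_mem_Icc {ω θ : ℝ} (hω : ω ∈ Ioo 0 Real.pi) (hθ : θ ∈ Icc (-ω) ω) :
    Real.cos ω ≤ Real.cos θ := by
  rw [← Real.cos_abs θ]
  exact Real.strictAntiOn_cos.antitoneOn ⟨abs_nonneg _, (abs_le.2 hθ).trans hω.2.le⟩
    ⟨hω.1.le, hω.2.le⟩ (abs_le.2 hθ)

lemma rayPoint_mem_sector {φ ω θ r : ℝ} (hω : 0 < ω) (hωφ : ω < φ) (hφ : φ < Real.pi)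
    (hθ : θ ∈ Icc (-ω) ω) (hr : 0 < r) : rayPoint θ r ∈ sector φ := by
  rw [rayPoint_mem_sector_iff ⟨hω.trans hωφ, hφ⟩ hr]
  exact (Real.strictAntiOn_cos ⟨hω.le, (hωφ.trans hφ).le⟩ ⟨(hω.trans hωφ).le, hφ.le⟩ hωφ).trans_le
    (cos_le_cos_of_mem_Icc ⟨hω, hωφ.trans hφ⟩ hθ)

lemma real_mul_mem_sector {φ t : ℝ} (hφ : φ ∈ Ioo 0 Real.pi) (ht : 0 < t) {z : ℂ}
    (hz : z ∈ sector φ) : (t : ℂ) * z ∈ sector φ := by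
  rw [mem_sector_iff hφ] at hz ⊢
  refine ⟨mul_ne_zero (by exact_mod_cast ht.ne') hz.1, ?_⟩
  rw [norm_mul, Complex.norm_real, Real.norm_of_nonneg ht.le, Complex.re_ofReal_mul, mul_assoc]
  exact mul_lt_mul_of_pos_left hz.2 ht

lemma ofReal_mem_sector {φ t : ℝ} (hφ : φ ∈ Ioo 0 Real.pi) (ht : 0 < t) : (t : ℂ) ∈ sector φ := by
  refine ⟨by exact_mod_cast ht.ne', ?_⟩
  rw [Complex.arg_ofReal_of_nonneg ht.le, abs_zero]
  exact hφ.1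

/-- Points off a sector around the negative half-axis stay away from the points `-b`, `b ≥ 0`. -/
lemma exists_mul_le_norm_add {c : ℝ} (hc : -1 < c) (hc1 : c ≤ 1) :
    ∃ κ : ℝ, 0 < κ ∧ ∀ z : ℂ, ‖z‖ * c ≤ z.re → ∀ b : ℝ, 0 ≤ b → κ * (‖z‖ + b) ≤ ‖z + b‖ := by
  -- The constant comes from `a² + b² + 2cab - (1+c)/2 · (a+b)² = (1-c)/2 · (a-b)² ≥ 0` with `a =
  -- ‖z‖`.
  refine ⟨Real.sqrt ((1 + c) / 2), Real.sqrt_pos.2 (by linarith), fun z hz b hb => ?_⟩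
  rw [← Real.sqrt_sq (show 0 ≤ ‖z‖ + b by positivity), ← Real.sqrt_mul (by linarith)]
  rw [← Real.sqrt_sq (norm_nonneg (z + b))]
  refine Real.sqrt_le_sqrt ?_
  have h1 : ‖z + b‖ ^ 2 = ‖z‖ ^ 2 + b ^ 2 + 2 * (b * z.re) := by
    rw [← Complex.normSq_eq_norm_sq, ← Complex.normSq_eq_norm_sq, Complex.normSq_apply,
      Complex.normSq_apply]
    simp; ring
  rw [h1]
  nlinarith [mul_le_mul_of_nonneg_left hz hb, mul_nonneg (sub_nonneg.2 hc1) (sq_nonneg (‖z‖ - b))]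

lemma exists_mul_le_norm_add_of_mem_sector {φ : ℝ} (hφ : φ ∈ Ioo 0 Real.pi) :
    ∃ κ : ℝ, 0 < κ ∧ ∀ z ∈ sector φ, ∀ b : ℝ, 0 ≤ b → κ * (‖z‖ + b) ≤ ‖z + b‖ := by
  have hc : -1 < Real.cos φ := by
    rw [← Real.cos_pi]
    exact Real.strictAntiOn_cos ⟨hφ.1.le, hφ.2.le⟩ ⟨Real.pi_pos.le, le_rfl⟩ hφ.2
  obtain ⟨κ, h0, h⟩ := exists_mul_le_norm_add hc (Real.cos_le_one φ)
  exact ⟨κ, h0, fun z hz => h z ((mem_sector_iff hφ).1 hz).2.le⟩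

lemma one_add_mul_ne_zero {φ s : ℝ} (hφ : φ ∈ Ioo 0 Real.pi) (hs : 0 ≤ s) {z : ℂ}
    (hz : z ∈ sector φ) : 1 + (s : ℂ) * z ≠ 0 := by
  rcases hs.eq_or_lt with rfl | hs
  · simp
  obtain ⟨κ, h0, h⟩ := exists_mul_le_norm_add_of_mem_sector hφ
  have := h _ (real_mul_mem_sector hφ hs hz) 1 zero_le_one
  rw [← norm_pos_iff, add_comm]
  refine lt_of_lt_of_le (by positivity) (this.trans_eq (by simp))

end SectorGeometry

/-! ### Bounded holomorphic functions with decay -/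

section FunctionClasses

lemma MemHInf.mul {φ : ℝ} {f g : ℂ → ℂ} (hf : MemHInf φ f) (hg : MemHInf φ g) :
    MemHInf φ (fun z => f z * g z) := by
  obtain ⟨hfd, C, hC⟩ := hf
  obtain ⟨hgd, D, hD⟩ := hg
  refine ⟨hfd.mul hgd, C * D, fun z hz => ?_⟩
  rw [norm_mul]
  exact mul_le_mul (hC z hz) (hD z hz) (norm_nonneg _) ((norm_nonneg _).trans (hC z hz))

lemma MemHInf.add {φ : ℝ} {f g : ℂ → ℂ} (hf : MemHInf φ f) (hg : MemHInf φ g) :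
    MemHInf φ (fun z => f z + g z) := by
  obtain ⟨hfd, C, hC⟩ := hf
  obtain ⟨hgd, D, hD⟩ := hg
  exact ⟨hfd.add hgd, C + D, fun z hz => (norm_add_le _ _).trans (add_le_add (hC z hz) (hD z hz))⟩

lemma memHInf_const (φ : ℝ) (c : ℂ) : MemHInf φ (fun _ => c) :=
  ⟨differentiableOn_const c, ‖c‖, fun _ _ => le_rfl⟩

lemma MemHInf.comp_mul {φ t : ℝ} (hφ : φ ∈ Ioo 0 Real.pi) (ht : 0 < t) {f : ℂ → ℂ}
    (hf : MemHInf φ f) : MemHInf φ (fun z => f (t * z)) := by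
  obtain ⟨hfd, C, hC⟩ := hf
  exact ⟨hfd.comp (by fun_prop) fun z hz => real_mul_mem_sector hφ ht hz, C,
    fun z hz => hC _ (real_mul_mem_sector hφ ht hz)⟩

/-- Uniformity in `s` holds because `sz` stays in the sector, where the distance to `-1` is
comparable to `1 + s‖z‖`. -/
lemma exists_norm_inv_one_add_mul_le {φ : ℝ} (hφ : φ ∈ Ioo 0 Real.pi) :
    ∃ K : ℝ, 0 < K ∧ ∀ s : ℝ, 0 ≤ s → ∀ z ∈ sector φ,
      ‖(1 + (s : ℂ) * z)⁻¹‖ ≤ K * (1 + s * ‖z‖)⁻¹ := by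
  obtain ⟨κ, h0, h⟩ := exists_mul_le_norm_add_of_mem_sector hφ
  refine ⟨max 1 κ⁻¹, by positivity, fun s hs z hz => ?_⟩
  rcases hs.eq_or_lt with rfl | hs
  · simp
  have h1 := h _ (real_mul_mem_sector hφ hs hz) 1 zero_le_one
  rw [norm_mul, Complex.norm_real, Real.norm_of_nonneg hs.le, Complex.ofReal_one, add_comm,
    add_comm _ (1 : ℂ)] at h1
  rw [norm_inv]
  calc ‖1 + (s : ℂ) * z‖⁻¹ ≤ (κ * (1 + s * ‖z‖))⁻¹ :=
        inv_anti₀ (by positivity) (by rwa [add_comm 1 (s * _)] at *)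
    _ = κ⁻¹ * (1 + s * ‖z‖)⁻¹ := mul_inv _ _
    _ ≤ _ := mul_le_mul_of_nonneg_right (le_max_right _ _) (by positivity)

lemma memHInf_inv_one_add_mul {φ s : ℝ} (hφ : φ ∈ Ioo 0 Real.pi) (hs : 0 ≤ s) :
    MemHInf φ (fun z => (1 + (s : ℂ) * z)⁻¹) := by
  obtain ⟨K, hK0, hK⟩ := exists_norm_inv_one_add_mul_le hφ
  refine ⟨?_, K, fun z hz => (hK s hs z hz).trans ?_⟩
  · exact DifferentiableOn.inv (by fun_prop) fun z hz => one_add_mul_ne_zero hφ hs hz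
  · exact mul_le_of_le_one_right hK0.le (inv_le_one_of_one_le₀
      (le_add_of_nonneg_right (by positivity)))

lemma MemHInfZero.mul {φ : ℝ} {f g : ℂ → ℂ} (hf : MemHInfZero φ f) (hg : MemHInf φ g) :
    MemHInfZero φ (fun z => f z * g z) := by
  refine ⟨hf.1.mul hg, ?_⟩
  obtain ⟨-, C, s, hs, hC⟩ := hf
  obtain ⟨-, D, hD⟩ := hg
  refine ⟨C * D, s, hs, fun z hz => ?_⟩
  rw [norm_mul, mul_right_comm]
  exact mul_le_mul (hC z hz) (hD z hz) (norm_nonneg _) ((norm_nonneg _).trans (hC z hz))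

/-- The minimum is `exp(-s |log r|)`, which decreases in `s`; two decay rates can thus be replaced
by the smaller one. -/
lemma min_rpow_le_min_rpow {s u r : ℝ} (hs : 0 < s) (hsu : s ≤ u) (hr : 0 < r) :
    min (r ^ u) (r ^ (-u)) ≤ min (r ^ s) (r ^ (-s)) := by
  rcases le_total r 1 with h | h
  · have h1 : r ^ u ≤ r ^ s := Real.rpow_le_rpow_of_exponent_ge hr h hsu
    exact (min_le_left _ _).trans (le_min h1
      (h1.trans (Real.rpow_le_rpow_of_exponent_ge hr h (by linarith))))
  · have h1 : r ^ (-u) ≤ r ^ (-s) := Real.rpow_le_rpow_of_exponent_le h (by linarith)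
    exact (min_le_right _ _).trans (le_min
      (h1.trans (Real.rpow_le_rpow_of_exponent_le h (by linarith))) h1)

lemma MemHInfZero.exists_bound {φ : ℝ} {f : ℂ → ℂ} (hf : MemHInfZero φ f) :
    ∃ C s : ℝ, 0 ≤ C ∧ 0 < s ∧ ∀ z ∈ sector φ, ‖f z‖ ≤ C * min (‖z‖ ^ s) (‖z‖ ^ (-s)) := by
  obtain ⟨-, C, s, hs, hC⟩ := hf
  exact ⟨|C|, s, abs_nonneg C, hs, fun z hz => (hC z hz).trans
    (mul_le_mul_of_nonneg_right (le_abs_self C) (by positivity))⟩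

lemma MemHInfZero.add {φ : ℝ} {f g : ℂ → ℂ} (hf : MemHInfZero φ f) (hg : MemHInfZero φ g) :
    MemHInfZero φ (fun z => f z + g z) := by
  refine ⟨hf.1.add hg.1, ?_⟩
  obtain ⟨C, s, hC0, hs, hC⟩ := hf.exists_bound
  obtain ⟨D, u, hD0, hu, hD⟩ := hg.exists_bound
  refine ⟨C + D, min s u, lt_min hs hu, fun z hz => ?_⟩
  have hz0 : 0 < ‖z‖ := norm_pos_iff.2 hz.1
  rw [add_mul]
  refine (norm_add_le _ _).trans (add_le_add ((hC z hz).trans ?_) ((hD z hz).trans ?_))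
  · exact mul_le_mul_of_nonneg_left
      (min_rpow_le_min_rpow (lt_min hs hu) (min_le_left _ _) hz0) hC0
  · exact mul_le_mul_of_nonneg_left
      (min_rpow_le_min_rpow (lt_min hs hu) (min_le_right _ _) hz0) hD0

lemma MemHInfZero.const_mul {φ : ℝ} {f : ℂ → ℂ} (hf : MemHInfZero φ f) (c : ℂ) :
    MemHInfZero φ (fun z => c * f z) := by
  simpa [mul_comm] using hf.mul (memHInf_const φ c)

lemma MemHInfZero.comp_mul {φ t : ℝ} (hφ : φ ∈ Ioo 0 Real.pi) (ht : 0 < t) {f : ℂ → ℂ}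
    (hf : MemHInfZero φ f) : MemHInfZero φ (fun z => f (t * z)) := by
  refine ⟨hf.1.comp_mul hφ ht, ?_⟩
  obtain ⟨C, s, hC0, hs, hC⟩ := hf.exists_bound
  refine ⟨C * max (t ^ s) (t ^ (-s)), s, hs, fun z hz => ?_⟩
  have hz0 : 0 < ‖z‖ := norm_pos_iff.2 hz.1
  refine (hC _ (real_mul_mem_sector hφ ht hz)).trans ?_
  rw [mul_assoc]
  refine mul_le_mul_of_nonneg_left ?_ hC0
  rw [norm_mul, Complex.norm_real, Real.norm_of_nonneg ht.le, Real.mul_rpow ht.le hz0.le,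
    Real.mul_rpow ht.le hz0.le, mul_min_of_nonneg _ _ (by positivity)]
  exact min_le_min (mul_le_mul_of_nonneg_right (le_max_left _ _) (by positivity))
    (mul_le_mul_of_nonneg_right (le_max_right _ _) (by positivity))

/-- The function `(1 + z)⁻¹ - (1 + 2z)⁻¹ = z (1 + z)⁻¹ (1 + 2z)⁻¹`. -/
def resolventDiff (z : ℂ) : ℂ := (1 + z)⁻¹ - (1 + 2 * z)⁻¹

lemma resolventDiff_eq {φ : ℝ} (hφ : φ ∈ Ioo 0 Real.pi) {z : ℂ} (hz : z ∈ sector φ) :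
    resolventDiff z = z * (1 + z)⁻¹ * (1 + 2 * z)⁻¹ := by
  have h1 := one_add_mul_ne_zero hφ zero_le_one hz
  have h2 := one_add_mul_ne_zero hφ zero_le_two hz
  rw [Complex.ofReal_one, one_mul] at h1
  rw [Complex.ofReal_ofNat] at h2
  rw [resolventDiff, inv_sub_inv h1 h2, div_eq_mul_inv, mul_inv]
  ring

lemma memHInfZero_resolventDiff {φ : ℝ} (hφ : φ ∈ Ioo 0 Real.pi) :
    MemHInfZero φ resolventDiff := by
  have h1 := memHInf_inv_one_add_mul hφ zero_le_one
  have h2 := memHInf_inv_one_add_mul hφ zero_le_two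
  refine ⟨?_, ?_⟩
  · have := h1.add (h2.mul (memHInf_const φ (-1)))
    have e : resolventDiff = fun z => (1 + ((1 : ℝ) : ℂ) * z)⁻¹ + (1 + ((2 : ℝ) : ℂ) * z)⁻¹ * -1 := by
      funext z; simp [resolventDiff, sub_eq_add_neg]
    rwa [e]
  · obtain ⟨K, hK0, hK⟩ := exists_norm_inv_one_add_mul_le hφ
    refine ⟨K * K, 1, one_pos, fun z hz => ?_⟩
    have hz0 : 0 < ‖z‖ := norm_pos_iff.2 hz.1
    have e1 := hK 1 zero_le_one z hz
    have e2 := hK 2 zero_le_two z hz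
    rw [Complex.ofReal_one, one_mul, one_mul] at e1
    rw [Complex.ofReal_ofNat] at e2
    rw [resolventDiff_eq hφ hz, norm_mul, norm_mul, Real.rpow_one, Real.rpow_neg_one]
    calc ‖z‖ * ‖(1 + z)⁻¹‖ * ‖(1 + 2 * z)⁻¹‖
        ≤ ‖z‖ * (K * (1 + ‖z‖)⁻¹) * (K * (1 + 2 * ‖z‖)⁻¹) := by gcongr
      _ = (K * K) * (‖z‖ * ((1 + ‖z‖)⁻¹ * (1 + 2 * ‖z‖)⁻¹)) := by ring
      _ ≤ (K * K) * min ‖z‖ ‖z‖⁻¹ := by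
          refine mul_le_mul_of_nonneg_left (le_min ?_ ?_) (by positivity)
          · rw [← mul_inv, ← div_eq_mul_inv]
            exact div_le_self hz0.le (by nlinarith)
          · rw [← mul_inv, ← div_eq_mul_inv, div_le_iff₀ (by positivity), ← div_eq_inv_mul,
              le_div_iff₀ hz0]
            nlinarith

end FunctionClasses

/-! ### Contour integrals over the boundary of a sector -/

lemma RayDecay.mono {α β α' β' : ℝ} {G : Type*} [NormedAddCommGroup G]
    {g : ℂ → G} (h : RayDecay α β g) (hα : α ≤ α')
    (hβ : β' ≤ β) : RayDecay α' β' g := by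
  obtain ⟨C, s, hs, hC⟩ := h
  exact ⟨C, s, hs, fun θ hθ => hC θ ⟨hα.trans hθ.1, hθ.2.trans hβ⟩⟩

section Contour

variable {E : Type*} [NormedAddCommGroup E] [NormedSpace ℂ E]

/-- `(2πi)⁻¹ ∫ g(z) dz` over the boundary of the sector of angle `ω`. -/
def contourIntegral (ω : ℝ) (g : ℂ → E) : E :=
  (2 * Real.pi * Complex.I : ℂ)⁻¹ • (rayIntegral (-ω) g - rayIntegral ω g)

lemma contourIntegral_eq_zero_of_inside {ω : ℝ} (hω : 0 ≤ ω) {g : ℂ → E}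
    (hd : RayDecay (-ω) ω g)
    (hg : ∀ θ ∈ Icc (-ω) ω, ∀ r : ℝ, 0 < r → DifferentiableAt ℂ g (rayPoint θ r)) :
    contourIntegral ω g = 0 := by
  rw [contourIntegral, rayIntegral_eq_of_differentiableAt (by linarith) hd hg, sub_self, smul_zero]

/-- The ray of angle `-ω` is also the ray of angle `2π - ω`, so the two boundary rays can be rotated
into each other through the negative half-axis. -/
lemma contourIntegral_eq_zero_of_outside {ω : ℝ} (hω : ω ≤ Real.pi) {g : ℂ → E}
    (hd : RayDecay ω (2 * Real.pi - ω) g)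
    (hg : ∀ θ ∈ Icc ω (2 * Real.pi - ω), ∀ r : ℝ, 0 < r → DifferentiableAt ℂ g (rayPoint θ r)) :
    contourIntegral ω g = 0 := by
  have h1 : Complex.exp (((2 * Real.pi - ω : ℝ) : ℂ) * Complex.I) =
      Complex.exp (((-ω : ℝ) : ℂ) * Complex.I) := by
    rw [show ((2 * Real.pi - ω : ℝ) : ℂ) * Complex.I =
      ((-ω : ℝ) : ℂ) * Complex.I + 2 * Real.pi * Complex.I by push_cast; ring]
    exact Complex.exp_periodic _
  have h2 : rayIntegral (2 * Real.pi - ω) g = rayIntegral (-ω) g := by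
    simp only [rayIntegral, rayPoint, h1]
  rw [contourIntegral, ← h2,
    rayIntegral_eq_of_differentiableAt (by linarith) hd hg, sub_self, smul_zero]

lemma contourIntegral_congr {ω : ℝ} {g h : ℂ → E}
    (hgh : ∀ r : ℝ, 0 < r → g (rayPoint (-ω) r) = h (rayPoint (-ω) r) ∧
      g (rayPoint ω r) = h (rayPoint ω r)) :
    contourIntegral ω g = contourIntegral ω h := by
  have h1 : rayIntegral (-ω) g = rayIntegral (-ω) h :=
    setIntegral_congr_fun measurableSet_Ioi fun r hr => by simp only [(hgh r hr).1]
  have h2 : rayIntegral ω g = rayIntegral ω h :=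
    setIntegral_congr_fun measurableSet_Ioi fun r hr => by simp only [(hgh r hr).2]
  rw [contourIntegral, contourIntegral, h1, h2]

/-- `g` is integrable along the boundary of the sector of angle `ω`. -/
def ContourIntegrable (ω : ℝ) (g : ℂ → E) : Prop :=
  IntegrableOn (fun r => Complex.exp ((-ω : ℝ) * Complex.I) • g (rayPoint (-ω) r)) (Ioi 0) ∧
  IntegrableOn (fun r => Complex.exp (ω * Complex.I) • g (rayPoint ω r)) (Ioi 0)

lemma contourIntegral_add {ω : ℝ} {g h : ℂ → E} (hg : ContourIntegrable ω g)
    (hh : ContourIntegrable ω h) :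
    contourIntegral ω (fun z => g z + h z) = contourIntegral ω g + contourIntegral ω h := by
  simp only [contourIntegral, rayIntegral, smul_add]
  rw [integral_add hg.1 hh.1, integral_add hg.2 hh.2, ← smul_add]
  congr 1
  abel

lemma ContourIntegrable.add {ω : ℝ} {g h : ℂ → E} (hg : ContourIntegrable ω g)
    (hh : ContourIntegrable ω h) : ContourIntegrable ω (fun z => g z + h z) := by
  simp only [ContourIntegrable, smul_add]
  exact ⟨hg.1.add hh.1, hg.2.add hh.2⟩

variable {E' : Type*} [NormedAddCommGroup E'] [NormedSpace ℂ E']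

lemma ContinuousLinearMap.contourIntegral_comp [CompleteSpace E] [CompleteSpace E'] {ω : ℝ}
    {g : ℂ → E} (hg : ContourIntegrable ω g) (T : E →L[ℂ] E') :
    contourIntegral ω (fun z => T (g z)) = T (contourIntegral ω g) := by
  simp only [contourIntegral, rayIntegral, map_smul, map_sub]
  rw [← T.integral_comp_comm hg.1, ← T.integral_comp_comm hg.2]
  simp only [map_smul]

lemma ContourIntegrable.clm_comp {ω : ℝ} {g : ℂ → E} (hg : ContourIntegrable ω g)
    (T : E →L[ℂ] E') : ContourIntegrable ω (fun z => T (g z)) := by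
  refine ⟨(T.integrable_comp hg.1).congr ?_, (T.integrable_comp hg.2).congr ?_⟩ <;>
  exact Filter.Eventually.of_forall fun r => by simp

lemma contourIntegrable_of_rayDecay {ω : ℝ} {g : ℂ → E}
    (h1 : RayDecay (-ω) (-ω) g) (h2 : RayDecay ω ω g)
    (hc : ∀ r : ℝ, 0 < r → ContinuousAt g (rayPoint (-ω) r) ∧ ContinuousAt g (rayPoint ω r)) :
    ContourIntegrable ω g :=
  ⟨h1.integrableOn ⟨le_rfl, le_rfl⟩ fun r hr => (hc r hr).1,
    h2.integrableOn ⟨le_rfl, le_rfl⟩ fun r hr => (hc r hr).2⟩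

end Contour

/-! ### Resolvents -/

section Resolvents

open Filter Topology

variable {X : Type*} [NormedAddCommGroup X] [NormedSpace ℂ X]

lemma IsResolventAt.unique {A : X →ₗ.[ℂ] X} {z : ℂ} {R S : X →L[ℂ] X} (hR : IsResolventAt A z R)
    (hS : IsResolventAt A z S) : R = S := by
  ext x
  obtain ⟨h, hx⟩ := hS.1 x
  have := hR.2 ⟨S x, h⟩
  rwa [hx] at this

lemma IsResolventAt.opResolvent_eq {A : X →ₗ.[ℂ] X} {z : ℂ} {R : X →L[ℂ] X}
    (hR : IsResolventAt A z R) : opResolvent A z = R := by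
  have h : ∃ R : X →L[ℂ] X, IsResolventAt A z R := ⟨R, hR⟩
  rw [opResolvent, dif_pos h]
  exact h.choose_spec.unique hR

lemma isResolventAt_opResolvent {A : X →ₗ.[ℂ] X} {z : ℂ} (hz : z ∈ opResolventSet A) :
    IsResolventAt A z (opResolvent A z) := by
  obtain ⟨R, hR⟩ := hz
  rwa [hR.opResolvent_eq]

/-- The resolvent identity: write `x = (w - A)Sx` and replace `w - A` by `(z - A) + (w - z)`. -/
lemma IsResolventAt.sub_eq {A : X →ₗ.[ℂ] X} {z w : ℂ} {R S : X →L[ℂ] X}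
    (hR : IsResolventAt A z R) (hS : IsResolventAt A w S) : R - S = (w - z) • (R * S) := by
  ext x
  obtain ⟨h, hx⟩ := hS.1 x
  have h1 := hR.2 ⟨S x, h⟩
  have h2 : R x = R (z • S x - A ⟨S x, h⟩) + (w - z) • R (S x) := by
    rw [← map_smul R, ← map_add R]
    congr 1
    nth_rewrite 1 [← hx]
    module
  simp only at h1
  rw [h1] at h2
  simp [h2]

lemma IsResolventAt.smul {A : X →ₗ.[ℂ] X} {z : ℂ} {R : X →L[ℂ] X} (hR : IsResolventAt A z R)
    {t : ℂ} (ht : t ≠ 0) : IsResolventAt (t • A) (t * z) (t⁻¹ • R) := by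
  constructor
  · intro x
    obtain ⟨h, hx⟩ := hR.1 x
    have h' : (t⁻¹ • R) x ∈ A.domain := A.domain.smul_mem _ h
    refine ⟨h', ?_⟩
    have h3 : A ⟨(t⁻¹ • R) x, h'⟩ = t⁻¹ • A ⟨R x, h⟩ := by
      rw [← A.map_smul]; rfl
    rw [LinearPMap.smul_apply]
    erw [h3]
    rw [smul_smul, mul_inv_cancel₀ ht, one_smul, _root_.smul_apply, smul_smul,
      mul_right_comm, mul_inv_cancel₀ ht, one_mul, hx]
  · intro y
    have := hR.2 y
    rw [LinearPMap.smul_apply, mul_smul, ← smul_sub, _root_.smul_apply, map_smul,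
      smul_smul, inv_mul_cancel₀ ht, one_smul]
    exact this

lemma inv_smul_smul_linearPMap (A : X →ₗ.[ℂ] X) {t : ℂ} (ht : t ≠ 0) : t⁻¹ • t • A = A := by
  rw [smul_smul, inv_mul_cancel₀ ht, one_smul]

lemma mem_opResolventSet_smul {A : X →ₗ.[ℂ] X} {t : ℂ} (ht : t ≠ 0) {z : ℂ} :
    t * z ∈ opResolventSet (t • A) ↔ z ∈ opResolventSet A := by
  constructor
  · rintro ⟨R, hR⟩
    have := hR.smul (inv_ne_zero ht)
    rw [inv_smul_smul_linearPMap A ht, ← mul_assoc, inv_mul_cancel₀ ht, one_mul] at this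
    exact ⟨_, this⟩
  · rintro ⟨R, hR⟩
    exact ⟨_, hR.smul ht⟩

/-- Off the resolvent set both sides take the default value `0`, so no condition on `z` is needed.
-/
lemma opResolvent_smul (A : X →ₗ.[ℂ] X) {t : ℂ} (ht : t ≠ 0) (z : ℂ) :
    opResolvent (t • A) (t * z) = t⁻¹ • opResolvent A z := by
  by_cases h : z ∈ opResolventSet A
  · exact ((isResolventAt_opResolvent h).smul ht).opResolvent_eq
  · have h' : t * z ∉ opResolventSet (t • A) := by rwa [mem_opResolventSet_smul ht]
    rw [opResolvent, opResolvent, dif_neg (show ¬∃ R, IsResolventAt A z R from h),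
      dif_neg (show ¬∃ R, IsResolventAt (t • A) (t * z) R from h'), smul_zero]

lemma real_mul_mem_closure_sector {φ t : ℝ} (hφ : φ ∈ Ioo 0 Real.pi) (ht : 0 < t) {z : ℂ}
    (hz : z ∈ closure (sector φ)) : (t : ℂ) * z ∈ closure (sector φ) :=
  map_mem_closure (f := fun w : ℂ => (t : ℂ) * w) (by fun_prop) hz
    fun _ hw => real_mul_mem_sector hφ ht hw

lemma IsSectorialOfAngle.smul {A : X →ₗ.[ℂ] X} {φ : ℝ} (h : IsSectorialOfAngle A φ) {t : ℝ}
    (ht : 0 < t) : IsSectorialOfAngle ((t : ℂ) • A) φ := by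
  have ht' : (t : ℂ) ≠ 0 := by exact_mod_cast ht.ne'
  have hz : ∀ z : ℂ, z = (t : ℂ) * ((t⁻¹ : ℝ) * z) := fun z => by
    rw [Complex.ofReal_inv, mul_inv_cancel_left₀ ht']
  refine ⟨h.1, fun z hzs => ?_, fun φ' hφ' => ?_⟩
  · rw [hz z]
    refine real_mul_mem_closure_sector h.1 ht (h.2.1 fun hmem => hzs ?_)
    rw [hz z]
    exact (mem_opResolventSet_smul ht').2 hmem
  · obtain ⟨M, hM⟩ := h.2.2 φ' hφ'
    refine ⟨M, fun z hz0 hzs => ?_⟩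
    have h1 := hM (((t⁻¹ : ℝ) : ℂ) * z) (mul_ne_zero (by exact_mod_cast (inv_pos.2 ht).ne') hz0)
      fun hmem => hzs (by
        rw [hz z]; exact real_mul_mem_sector ⟨h.1.1.trans hφ'.1, hφ'.2⟩ ht hmem)
    have h2 := opResolvent_smul A ht' (((t⁻¹ : ℝ) : ℂ) * z)
    rw [← hz] at h2
    rwa [h2, smul_smul, mul_comm, ← Complex.ofReal_inv]

/-- Consequently the calculi of `A` and of `tA` use the same contour. -/
lemma sectorialityAngle_smul (A : X →ₗ.[ℂ] X) {t : ℝ} (ht : 0 < t) :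
    sectorialityAngle ((t : ℂ) • A) = sectorialityAngle A := by
  have ht' : (t : ℂ) ≠ 0 := by exact_mod_cast ht.ne'
  unfold sectorialityAngle
  congr 1
  ext φ
  refine ⟨fun h => ?_, fun h => h.smul ht⟩
  have := h.smul (inv_pos.2 ht)
  rwa [Complex.ofReal_inv, inv_smul_smul_linearPMap A ht'] at this

/-- The resolvent of `A` exists and is bounded by `M / |z|` off the sector of angle `φ'`, and
`φ' < ω < φ`. -/
structure SectorBound (A : X →ₗ.[ℂ] X) (φ' ω φ M : ℝ) : Prop where
  pos : 0 < φ'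
  lt_left : φ' < ω
  lt_right : ω < φ
  lt_pi : φ < Real.pi
  isResolventAt : ∀ z : ℂ, z ≠ 0 → z ∉ sector φ' → IsResolventAt A z (opResolvent A z)
  bound : ∀ z : ℂ, z ≠ 0 → z ∉ sector φ' → ‖z • opResolvent A z‖ ≤ M

/-- Take `φ'` strictly between an admissible angle `φ₁` and the contour angle. Nonzero points off
the sector of `φ'` avoid the closed sector of `φ₁`, hence the spectrum. -/
lemma IsSectorial.exists_sectorBound {A : X →ₗ.[ℂ] X} (hA : IsSectorial A) {φ : ℝ}
    (hφ : φ ∈ Ioo (sectorialityAngle A) Real.pi) :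
    ∃ φ' M : ℝ, SectorBound A φ' ((sectorialityAngle A + φ) / 2) φ M := by
  set ω := (sectorialityAngle A + φ) / 2 with hω
  have h1 : sectorialityAngle A < ω := by rw [hω]; linarith [hφ.1]
  have h2 : ω < φ := by rw [hω]; linarith [hφ.1]
  obtain ⟨φ₁, hφ₁, h3⟩ := exists_lt_of_csInf_lt hA h1
  have h4 : (φ₁ + ω) / 2 ∈ Ioo φ₁ Real.pi := ⟨by linarith, by linarith [hφ.2]⟩
  obtain ⟨M, hM⟩ := hφ₁.2.2 _ h4
  have hp : 0 < φ₁ := hφ₁.1.1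
  refine ⟨(φ₁ + ω) / 2, M, by linarith, by linarith, h2, hφ.2, fun z hz0 hz => ?_, hM⟩
  apply isResolventAt_opResolvent
  by_contra hns
  apply hz
  rw [mem_sector_iff ⟨by linarith, h4.2⟩]
  refine ⟨hz0, lt_of_lt_of_le ?_ (closure_sector_subset hφ₁.1 (hφ₁.2.1 hns))⟩
  exact mul_lt_mul_of_pos_left (Real.strictAntiOn_cos ⟨hp.le, hφ₁.1.2.le⟩
    ⟨by linarith, h4.2.le⟩ h4.1) (norm_pos_iff.2 hz0)

/-- The operator `(1 + sA)⁻¹`. -/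
def onePlusInv (A : X →ₗ.[ℂ] X) (s : ℝ) : X →L[ℂ] X := -opResolvent ((s : ℂ) • A) (-1)

namespace SectorBound

variable {A : X →ₗ.[ℂ] X} {φ' ω φ M : ℝ}

lemma angle_mem (h : SectorBound A φ' ω φ M) : φ' ∈ Ioo 0 Real.pi :=
  ⟨h.pos, (h.lt_left.trans h.lt_right).trans h.lt_pi⟩

lemma contour_mem (h : SectorBound A φ' ω φ M) : ω ∈ Ioo 0 Real.pi :=
  ⟨h.pos.trans h.lt_left, h.lt_right.trans h.lt_pi⟩

lemma outer_mem (h : SectorBound A φ' ω φ M) : φ ∈ Ioo 0 Real.pi :=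
  ⟨h.contour_mem.1.trans h.lt_right, h.lt_pi⟩

lemma smul (h : SectorBound A φ' ω φ M) {t : ℝ} (ht : 0 < t) :
    SectorBound ((t : ℂ) • A) φ' ω φ M := by
  have ht' : (t : ℂ) ≠ 0 := by exact_mod_cast ht.ne'
  have hz : ∀ z : ℂ, z = (t : ℂ) * ((t⁻¹ : ℝ) * z) := fun z => by
    rw [Complex.ofReal_inv, mul_inv_cancel_left₀ ht']
  have hns : ∀ z : ℂ, z ≠ 0 → z ∉ sector φ' →
      ((t⁻¹ : ℝ) : ℂ) * z ≠ 0 ∧ ((t⁻¹ : ℝ) : ℂ) * z ∉ sector φ' := fun z hz0 hzs =>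
    ⟨mul_ne_zero (by exact_mod_cast (inv_pos.2 ht).ne') hz0,
      fun hmem => hzs (by rw [hz z]; exact real_mul_mem_sector h.angle_mem ht hmem)⟩
  refine ⟨h.pos, h.lt_left, h.lt_right, h.lt_pi, fun z hz0 hzs => ?_, fun z hz0 hzs => ?_⟩
  · obtain ⟨h1, h2⟩ := hns z hz0 hzs
    have h3 := (h.isResolventAt _ h1 h2).smul ht'
    rw [← hz] at h3
    rwa [h3.opResolvent_eq]
  · obtain ⟨h1, h2⟩ := hns z hz0 hzs
    have h3 := opResolvent_smul A ht' (((t⁻¹ : ℝ) : ℂ) * z)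
    rw [← hz] at h3
    rw [h3, smul_smul, mul_comm, ← Complex.ofReal_inv]
    exact h.bound _ h1 h2

lemma notMem_sector_of_re_le (h : SectorBound A φ' ω φ M) {z : ℂ}
    (hz : z.re ≤ ‖z‖ * Real.cos φ') : z ∉ sector φ' := fun hmem =>
  absurd ((mem_sector_iff h.angle_mem).1 hmem).2 (not_lt.2 hz)

lemma neg_one_notMem (h : SectorBound A φ' ω φ M) : (-1 : ℂ) ∉ sector φ' := by
  refine h.notMem_sector_of_re_le ?_
  simpa using Real.neg_one_le_cos φ'

lemma bound_nonneg (h : SectorBound A φ' ω φ M) : 0 ≤ M :=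
  (norm_nonneg _).trans (h.bound (-1) (by simp) h.neg_one_notMem)

lemma norm_opResolvent_le (h : SectorBound A φ' ω φ M) {z : ℂ} (hz0 : z ≠ 0)
    (hz : z ∉ sector φ') : ‖opResolvent A z‖ ≤ M * ‖z‖⁻¹ := by
  have := h.bound z hz0 hz
  rw [norm_smul] at this
  rwa [← div_eq_mul_inv, le_div_iff₀ (norm_pos_iff.2 hz0), mul_comm]

lemma cos_lt (h : SectorBound A φ' ω φ M) {θ : ℝ} (hθ : θ ∈ Icc ω (2 * Real.pi - ω)) :
    Real.cos θ < Real.cos φ' := by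
  have h1 : Real.cos ω < Real.cos φ' :=
    Real.strictAntiOn_cos ⟨h.pos.le, h.angle_mem.2.le⟩ ⟨h.contour_mem.1.le, h.contour_mem.2.le⟩
      h.lt_left
  refine lt_of_le_of_lt ?_ h1
  rcases le_total θ Real.pi with h2 | h2
  · exact Real.strictAntiOn_cos.antitoneOn ⟨h.contour_mem.1.le, h.contour_mem.2.le⟩
      ⟨h.contour_mem.1.le.trans hθ.1, h2⟩ hθ.1
  · rw [← Real.cos_two_pi_sub θ]
    exact Real.strictAntiOn_cos.antitoneOn ⟨h.contour_mem.1.le, h.contour_mem.2.le⟩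
      ⟨by linarith [hθ.2, h.contour_mem.1], by linarith⟩ (by linarith [hθ.2])

lemma rayPoint_re_lt (h : SectorBound A φ' ω φ M) {θ : ℝ} (hθ : θ ∈ Icc ω (2 * Real.pi - ω))
    {r : ℝ} (hr : 0 < r) : (rayPoint θ r).re < ‖rayPoint θ r‖ * Real.cos φ' := by
  rw [norm_rayPoint θ hr, re_rayPoint]
  exact mul_lt_mul_of_pos_left (h.cos_lt hθ) hr

lemma rayPoint_re_lt' (h : SectorBound A φ' ω φ M) {r : ℝ} (hr : 0 < r) :
    (rayPoint (-ω) r).re < ‖rayPoint (-ω) r‖ * Real.cos φ' := by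
  rw [norm_rayPoint _ hr, re_rayPoint, Real.cos_neg]
  exact mul_lt_mul_of_pos_left (h.cos_lt ⟨le_rfl, by linarith [h.contour_mem.2]⟩) hr

/-- The resolvent identity is used twice: with the bound `M/|z|` it gives continuity, and then it
identifies the difference quotient as `-R(z,A)R(w,A)`. -/
lemma hasDerivAt_opResolvent (h : SectorBound A φ' ω φ M) {w : ℂ}
    (hw : w.re < ‖w‖ * Real.cos φ') :
    HasDerivAt (opResolvent A) (-(opResolvent A w * opResolvent A w)) w := by
  have hne : ∀ z : ℂ, z.re < ‖z‖ * Real.cos φ' → z ≠ 0 := by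
    rintro z hz rfl; simp at hz
  have hU : ∀ᶠ z in 𝓝 w, z.re < ‖z‖ * Real.cos φ' :=
    (isOpen_lt Complex.continuous_re (by fun_prop)).mem_nhds hw
  have hres : ∀ z : ℂ, z.re < ‖z‖ * Real.cos φ' → IsResolventAt A z (opResolvent A z) :=
    fun z hz => h.isResolventAt z (hne z hz) (h.notMem_sector_of_re_le hz.le)
  have hcont : Tendsto (opResolvent A) (𝓝 w) (𝓝 (opResolvent A w)) := by
    rw [tendsto_iff_norm_sub_tendsto_zero]
    have hlim : Tendsto (fun z : ℂ => ‖w - z‖ * (M * ‖z‖⁻¹ * ‖opResolvent A w‖)) (𝓝 w)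
        (𝓝 (‖w - w‖ * (M * ‖w‖⁻¹ * ‖opResolvent A w‖))) := by
      have h1 : ContinuousAt (fun z : ℂ => ‖z‖⁻¹) w :=
        continuous_norm.continuousAt.inv₀ (norm_ne_zero_iff.2 (hne w hw))
      have h2 : ContinuousAt (fun z : ℂ => ‖w - z‖) w := by fun_prop
      exact h2.mul ((continuousAt_const.mul h1).mul continuousAt_const)
    rw [sub_self, norm_zero, zero_mul] at hlim
    refine squeeze_zero' (Eventually.of_forall fun _ => norm_nonneg _) ?_ hlim
    filter_upwards [hU] with z hz
    rw [(hres z hz).sub_eq (hres w hw), norm_smul]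
    refine mul_le_mul_of_nonneg_left ((norm_mul_le _ _).trans ?_) (norm_nonneg _)
    exact mul_le_mul_of_nonneg_right
      (h.norm_opResolvent_le (hne z hz) (h.notMem_sector_of_re_le hz.le)) (norm_nonneg _)
  rw [hasDerivAt_iff_tendsto_slope]
  have h3 : Tendsto (fun z => -(opResolvent A z * opResolvent A w)) (𝓝[≠] w)
      (𝓝 (-(opResolvent A w * opResolvent A w))) :=
    ((hcont.mono_left nhdsWithin_le_nhds).mul_const _).neg
  refine h3.congr' ?_
  filter_upwards [nhdsWithin_le_nhds hU, self_mem_nhdsWithin] with z hz hzw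
  rw [slope_def_module, (hres z hz).sub_eq (hres w hw), smul_smul, ← neg_sub z w, mul_neg,
    inv_mul_cancel₀ (sub_ne_zero.2 hzw), neg_smul, one_smul]

lemma isResolventAt_neg_one (h : SectorBound A φ' ω φ M) {s : ℝ} (hs : 0 < s) :
    IsResolventAt ((s : ℂ) • A) (-1) (-onePlusInv A s) := by
  rw [onePlusInv, neg_neg]
  exact (h.smul hs).isResolventAt _ (by simp) h.neg_one_notMem

lemma norm_onePlusInv_le (h : SectorBound A φ' ω φ M) {s : ℝ} (hs : 0 < s) :
    ‖onePlusInv A s‖ ≤ M := by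
  have := (h.smul hs).bound (-1) (by simp) h.neg_one_notMem
  rwa [norm_smul, norm_neg, norm_one, one_mul, ← norm_neg] at this

lemma exists_onePlusInv_add (h : SectorBound A φ' ω φ M) {s : ℝ} (hs : 0 < s) (x : X) :
    ∃ hx : onePlusInv A s x ∈ A.domain,
      onePlusInv A s x + (s : ℂ) • A ⟨onePlusInv A s x, hx⟩ = x := by
  obtain ⟨h1, h2⟩ := (h.isResolventAt_neg_one hs).1 x
  have h3 : onePlusInv A s x ∈ A.domain := by
    have := A.domain.neg_mem h1
    simpa using this
  refine ⟨h3, ?_⟩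
  have h4 : A ⟨(-onePlusInv A s) x, h1⟩ = -A ⟨onePlusInv A s x, h3⟩ := by
    rw [← A.map_neg]; rfl
  rw [LinearPMap.smul_apply] at h2
  erw [h4] at h2
  refine Eq.trans ?_ h2
  rw [smul_neg, sub_neg_eq_add]
  simp

lemma onePlusInv_apply_add (h : SectorBound A φ' ω φ M) {s : ℝ} (hs : 0 < s) (y : A.domain) :
    onePlusInv A s ((y : X) + (s : ℂ) • A y) = y := by
  have := (h.isResolventAt_neg_one hs).2 y
  rw [LinearPMap.smul_apply] at this
  refine Eq.trans ?_ this
  rw [show (-1 : ℂ) • (y : X) - (s : ℂ) • A y = -((y : X) + (s : ℂ) • A y) by module, map_neg]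
  simp

/-- The vector `x` is recovered by applying `1 + sA`. This permits cancelling `(1+2A)⁻¹` even when
`A` itself is not injective. -/
lemma onePlusInv_injective (h : SectorBound A φ' ω φ M) {s : ℝ} (hs : 0 < s) :
    Function.Injective (onePlusInv A s) := by
  rw [injective_iff_map_eq_zero]
  intro x hx
  obtain ⟨h1, h2⟩ := h.exists_onePlusInv_add hs x
  have h3 : (⟨onePlusInv A s x, h1⟩ : A.domain) = 0 := Subtype.ext hx
  rw [h3, hx, A.map_zero, smul_zero, add_zero] at h2
  exact h2.symm

/-- With `y = (1+sA)⁻¹x` one has `x = (1+sz)y - s(z-A)y`; apply the resolvent. This is the resolvent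
identity between `z` and `-1/s`, cleared of denominators. -/
lemma opResolvent_mul_onePlusInv (h : SectorBound A φ' ω φ M) {s : ℝ} (hs : 0 < s) {z : ℂ}
    (hz0 : z ≠ 0) (hz : z ∉ sector φ') :
    (1 + s * z) • (opResolvent A z * onePlusInv A s) =
      opResolvent A z + (s : ℂ) • onePlusInv A s := by
  ext x
  obtain ⟨h1, h2⟩ := h.exists_onePlusInv_add hs x
  have h3 := (h.isResolventAt z hz0 hz).2 ⟨_, h1⟩
  have h4 : x = (1 + s * z) • onePlusInv A s x -
      (s : ℂ) • (z • onePlusInv A s x - A ⟨onePlusInv A s x, h1⟩) := by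
    nth_rewrite 1 [← h2]
    module
  have h5 : opResolvent A z x = (1 + s * z) • opResolvent A z (onePlusInv A s x) -
      (s : ℂ) • onePlusInv A s x := by
    nth_rewrite 1 [h4]
    rw [map_sub, map_smul, map_smul, h3]
  simp [h5]

lemma onePlusInv_mul_opResolvent (h : SectorBound A φ' ω φ M) {s : ℝ} (hs : 0 < s) {z : ℂ}
    (hz0 : z ≠ 0) (hz : z ∉ sector φ') :
    (1 + s * z) • (onePlusInv A s * opResolvent A z) =
      opResolvent A z + (s : ℂ) • onePlusInv A s := by
  ext x
  obtain ⟨h1, h2⟩ := (h.isResolventAt z hz0 hz).1 x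
  have h3 := h.onePlusInv_apply_add hs ⟨_, h1⟩
  have h4 : (s : ℂ) • x = (1 + s * z) • opResolvent A z x -
      (opResolvent A z x + (s : ℂ) • A ⟨opResolvent A z x, h1⟩) := by
    nth_rewrite 1 [← h2]
    module
  have h5 : (s : ℂ) • onePlusInv A s x =
      (1 + s * z) • onePlusInv A s (opResolvent A z x) - opResolvent A z x := by
    rw [← map_smul, h4, map_sub, map_smul, h3]
  change (1 + (s : ℂ) * z) • onePlusInv A s (opResolvent A z x) =
    opResolvent A z x + (s : ℂ) • onePlusInv A s x
  rw [h5]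
  abel

/-- Both sides are `stA(1+sA)⁻¹(1+tA)⁻¹`, written without `A`. -/
lemma onePlusInv_identity (h : SectorBound A φ' ω φ M) {s t : ℝ} (hs : 0 < s) (ht : 0 < t) :
    (s : ℂ) • onePlusInv A s - (s : ℂ) • (onePlusInv A s * onePlusInv A t) =
      (t : ℂ) • onePlusInv A t - (t : ℂ) • (onePlusInv A s * onePlusInv A t) := by
  ext x
  obtain ⟨h1, h2⟩ := h.exists_onePlusInv_add ht x
  have h3 := h.onePlusInv_apply_add hs ⟨_, h1⟩
  have h4 : (s : ℂ) • x - (s : ℂ) • onePlusInv A t x =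
      (t : ℂ) • (onePlusInv A t x + (s : ℂ) • A ⟨onePlusInv A t x, h1⟩) -
        (t : ℂ) • onePlusInv A t x := by
    nth_rewrite 1 [← h2]
    module
  have h5 := congrArg (onePlusInv A s) h4
  rw [map_sub, map_sub, map_smul, map_smul, map_smul, map_smul, h3] at h5
  simpa using h5

/-- For `s ≠ t` the preceding identity expresses `(t-s)(1+sA)⁻¹(1+tA)⁻¹` as `t(1+tA)⁻¹ - s(1+sA)⁻¹`,
and exchanging `s` and `t` turns this into the expression for the reversed product. -/
lemma onePlusInv_commute (h : SectorBound A φ' ω φ M) {s t : ℝ} (hs : 0 < s) (ht : 0 < t) :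
    onePlusInv A s * onePlusInv A t = onePlusInv A t * onePlusInv A s := by
  rcases eq_or_ne s t with rfl | hst
  · rfl
  have h1 := h.onePlusInv_identity hs ht
  have h2 := h.onePlusInv_identity ht hs
  have h3 : ((t : ℂ) - s) • (onePlusInv A s * onePlusInv A t) =
      ((t : ℂ) - s) • (onePlusInv A t * onePlusInv A s) := by
    have e1 : ((t : ℂ) - s) • (onePlusInv A s * onePlusInv A t) =
        (t : ℂ) • onePlusInv A t - (s : ℂ) • onePlusInv A s := by
      rw [sub_smul]
      linear_combination (norm := module) h1
    have e2 : ((t : ℂ) - s) • (onePlusInv A t * onePlusInv A s) =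
        (t : ℂ) • onePlusInv A t - (s : ℂ) • onePlusInv A s := by
      rw [sub_smul]
      linear_combination (norm := module) (-1 : ℂ) • h2
    rw [e1, e2]
  exact smul_right_injective _ (sub_ne_zero.2 (by exact_mod_cast hst.symm)) h3

/-- `(1 - P₁) P₂ = P₁ - P₂` for `P₁ = (1 + A)⁻¹`, `P₂ = (1 + 2A)⁻¹`. -/
lemma onePlusInv_one_mul_two (h : SectorBound A φ' ω φ M) :
    onePlusInv A 1 * onePlusInv A 2 = (2 : ℂ) • onePlusInv A 2 - onePlusInv A 1 := by
  have h1 := h.onePlusInv_identity one_pos two_pos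
  rw [Complex.ofReal_one, one_smul, one_smul, Complex.ofReal_ofNat] at h1
  linear_combination (norm := module) h1

end SectorBound

end Resolvents

/-! ### The holomorphic functional calculus on the contour -/

section Calculus

open Filter Topology

/-- For `s = 1` the weight is `min(1, r⁻²)`: one bound serves near `0`, the other near infinity. -/
lemma le_mul_rayWeight_one {a b r x : ℝ} (hr : 0 < r) (h1 : x ≤ a) (h2 : x ≤ b * (r⁻¹ * r⁻¹))
    (hx : 0 ≤ x) : x ≤ max a b * rayWeight 1 r := by
  have hab : 0 ≤ max a b := (hx.trans h1).trans (le_max_left _ _)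
  rw [rayWeight, Real.rpow_one, Real.rpow_neg_one, mul_min_of_nonneg _ _ (inv_nonneg.2 hr.le),
    inv_mul_cancel₀ hr.ne', mul_min_of_nonneg _ _ hab, mul_one]
  exact le_min (h1.trans (le_max_left _ _))
    (h2.trans (mul_le_mul_of_nonneg_right (le_max_right _ _) (by positivity)))

lemma inv_one_add_sq_le_rayWeight {r : ℝ} (hr : 0 < r) :
    (1 + r)⁻¹ * (1 + r)⁻¹ ≤ rayWeight 1 r := by
  have h := le_mul_rayWeight_one (a := 1) (b := 1) (x := (1 + r)⁻¹ * (1 + r)⁻¹) hr ?_ ?_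
    (by positivity)
  · simpa using h
  · have : (1 + r)⁻¹ ≤ 1 := inv_le_one_of_one_le₀ (by linarith)
    exact mul_le_one₀ this (by positivity) this
  · rw [one_mul]
    have : (1 + r)⁻¹ ≤ r⁻¹ := inv_anti₀ hr (by linarith)
    exact mul_le_mul this this (by positivity) (by positivity)

/-- The difference of the Cauchy kernels of the points `1` and `-1`. -/
def cauchyDiff (z : ℂ) : ℂ := (z - 1)⁻¹ - (z + 1)⁻¹

lemma cauchyDiff_eq {z : ℂ} (h1 : z - 1 ≠ 0) (h2 : z + 1 ≠ 0) :
    cauchyDiff z = 2 * ((z - 1)⁻¹ * (z + 1)⁻¹) := by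
  rw [cauchyDiff, inv_sub_inv h1 h2, div_eq_mul_inv, mul_inv]
  ring

lemma exists_mul_le_norm_sub {c : ℝ} (hc : c < 1) (hc1 : -1 ≤ c) :
    ∃ κ : ℝ, 0 < κ ∧ ∀ z : ℂ, z.re ≤ ‖z‖ * c → κ * (1 + ‖z‖) ≤ ‖z - 1‖ := by
  obtain ⟨κ, h0, h⟩ := exists_mul_le_norm_add (c := -c) (by linarith) (by linarith)
  refine ⟨κ, h0, fun z hz => ?_⟩
  have := h (-z) (by simp only [norm_neg, Complex.neg_re]; linarith) 1 zero_le_one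
  rw [norm_neg, Complex.ofReal_one, neg_add_eq_sub, norm_sub_rev] at this
  rwa [add_comm]

/-- The bound on `|cos θ|` keeps the rays uniformly away from both poles `1` and `-1`; the
difference of the two kernels then decays quadratically, which a single kernel does not. -/
lemma rayDecay_cauchyDiff {α β c : ℝ} (hαβ : α ≤ β) (hc : c < 1)
    (h : ∀ θ ∈ Icc α β, |Real.cos θ| ≤ c) :
    RayDecay α β cauchyDiff ∧
      ∀ θ ∈ Icc α β, ∀ r : ℝ, 0 < r → DifferentiableAt ℂ cauchyDiff (rayPoint θ r) := by
  have hc0 : 0 ≤ c := (abs_nonneg _).trans (h α ⟨le_rfl, hαβ⟩)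
  obtain ⟨κ, h0, hκ⟩ := exists_mul_le_norm_add (c := -c) (by linarith) (by linarith)
  obtain ⟨κ', h0', hκ'⟩ := exists_mul_le_norm_sub hc (by linarith)
  have hp : ∀ θ ∈ Icc α β, ∀ r : ℝ, 0 < r → κ * (1 + r) ≤ ‖rayPoint θ r + 1‖ ∧
      κ' * (1 + r) ≤ ‖rayPoint θ r - 1‖ := by
    intro θ hθ r hr
    have h1 := abs_le.1 (h θ hθ)
    have h2 := hκ (rayPoint θ r) ?_ 1 zero_le_one
    have h3 := hκ' (rayPoint θ r) ?_
    · rw [norm_rayPoint θ hr] at h2 h3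
      rw [add_comm r 1, Complex.ofReal_one] at h2
      exact ⟨h2, h3⟩
    · rw [norm_rayPoint θ hr, re_rayPoint]
      exact mul_le_mul_of_nonneg_left h1.2 hr.le
    · rw [norm_rayPoint θ hr, re_rayPoint]
      exact mul_le_mul_of_nonneg_left h1.1 hr.le
  have hne : ∀ θ ∈ Icc α β, ∀ r : ℝ, 0 < r → rayPoint θ r + 1 ≠ 0 ∧ rayPoint θ r - 1 ≠ 0 := by
    intro θ hθ r hr
    obtain ⟨h1, h2⟩ := hp θ hθ r hr
    exact ⟨norm_pos_iff.1 (lt_of_lt_of_le (by positivity) h1),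
      norm_pos_iff.1 (lt_of_lt_of_le (by positivity) h2)⟩
  refine ⟨⟨2 * (κ'⁻¹ * κ⁻¹), 1, one_pos, ?_⟩, ?_⟩
  · intro θ hθ r hr
    obtain ⟨h1, h2⟩ := hp θ hθ r hr
    obtain ⟨h3, h4⟩ := hne θ hθ r hr
    rw [cauchyDiff_eq h4 h3, norm_mul, norm_mul, norm_inv, norm_inv, Complex.norm_ofNat]
    have e1 := inv_anti₀ (by positivity) h1
    have e2 := inv_anti₀ (by positivity) h2
    calc 2 * (‖rayPoint θ r - 1‖⁻¹ * ‖rayPoint θ r + 1‖⁻¹)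
        ≤ 2 * ((κ' * (1 + r))⁻¹ * (κ * (1 + r))⁻¹) := by gcongr
      _ = 2 * (κ'⁻¹ * κ⁻¹) * ((1 + r)⁻¹ * (1 + r)⁻¹) := by rw [mul_inv, mul_inv]; ring
      _ ≤ _ := mul_le_mul_of_nonneg_left (inv_one_add_sq_le_rayWeight hr) (by positivity)
  · intro θ hθ r hr
    obtain ⟨h3, h4⟩ := hne θ hθ r hr
    have d1 : DifferentiableAt ℂ (fun z : ℂ => (z - 1)⁻¹) (rayPoint θ r) :=
      DifferentiableAt.inv (by fun_prop) h4
    have d2 : DifferentiableAt ℂ (fun z : ℂ => (z + 1)⁻¹) (rayPoint θ r) :=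
      DifferentiableAt.inv (by fun_prop) h3
    exact d1.sub d2

lemma rayIntegral_cauchyDiff_eq {α β c : ℝ} (hαβ : α ≤ β) (hc : c < 1)
    (h : ∀ θ ∈ Icc α β, |Real.cos θ| ≤ c) :
    rayIntegral α cauchyDiff = rayIntegral β cauchyDiff :=
  rayIntegral_eq_of_differentiableAt hαβ (rayDecay_cauchyDiff hαβ hc h).1
    (rayDecay_cauchyDiff hαβ hc h).2

/-- On the imaginary half-axes the integrand is `-2u/(1+r²)`, an arctangent derivative. -/
lemma rayIntegral_cauchyDiff_of_sq {θ : ℝ} {u : ℂ} (hu : Complex.exp (θ * Complex.I) = u)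
    (hu2 : u * u = -1) : rayIntegral θ cauchyDiff = -(u * Real.pi) := by
  have h1 : ∀ r ∈ Ioi (0 : ℝ), Complex.exp (θ * Complex.I) • cauchyDiff (rayPoint θ r) =
      (-2 * u) * (((1 + r ^ 2)⁻¹ : ℝ) : ℂ) := by
    intro r _
    have hprod : ((r : ℂ) * u - 1) * (r * u + 1) = -(((1 + r ^ 2 : ℝ)) : ℂ) := by
      push_cast
      linear_combination (r : ℂ) ^ 2 * hu2
    have hne : (((1 + r ^ 2 : ℝ)) : ℂ) ≠ 0 := by
      exact_mod_cast (by positivity : (1 + r ^ 2 : ℝ) ≠ 0)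
    have hne' : ((r : ℂ) * u - 1) * (r * u + 1) ≠ 0 := by rw [hprod]; exact neg_ne_zero.2 hne
    rw [rayPoint, hu, cauchyDiff_eq (left_ne_zero_of_mul hne') (right_ne_zero_of_mul hne'),
      ← mul_inv, hprod, Complex.ofReal_inv, inv_neg, smul_eq_mul]
    ring
  rw [rayIntegral, setIntegral_congr_fun measurableSet_Ioi h1, integral_const_mul,
    integral_complex_ofReal, integral_Ioi_inv_one_add_sq, Real.arctan_zero]
  push_cast
  ring

lemma abs_cos_lt_one {ω : ℝ} (hω : ω ∈ Ioo 0 Real.pi) : |Real.cos ω| < 1 := by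
  have hpi := Real.pi_pos
  rw [abs_lt]
  constructor
  · rw [← Real.cos_pi]
    exact Real.strictAntiOn_cos ⟨hω.1.le, hω.2.le⟩ ⟨hpi.le, le_rfl⟩ hω.2
  · rw [← Real.cos_zero]
    exact Real.strictAntiOn_cos ⟨le_rfl, hpi.le⟩ ⟨hω.1.le, hω.2.le⟩ hω.1

lemma contourIntegrable_cauchyDiff {ω : ℝ} (hω : ω ∈ Ioo 0 Real.pi) :
    ContourIntegrable ω cauchyDiff := by
  have key : ∀ α, |Real.cos α| = |Real.cos ω| → RayDecay α α cauchyDiff ∧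
      ∀ θ ∈ Icc α α, ∀ r : ℝ, 0 < r → DifferentiableAt ℂ cauchyDiff (rayPoint θ r) :=
    fun α hα => rayDecay_cauchyDiff le_rfl (abs_cos_lt_one hω) fun θ hθ => by
      rw [show θ = α from le_antisymm hθ.2 hθ.1, hα]
  exact contourIntegrable_of_rayDecay (key (-ω) (by rw [Real.cos_neg])).1 (key ω rfl).1
    fun r hr => ⟨((key (-ω) (by rw [Real.cos_neg])).2 _ ⟨le_rfl, le_rfl⟩ r hr).continuousAt,
      ((key ω rfl).2 _ ⟨le_rfl, le_rfl⟩ r hr).continuousAt⟩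

/-- Both rays are rotated to the imaginary axis without crossing `1` or `-1`, where the integral is
explicit. The value `1` is the residue at the pole `1` inside the sector; the pole `-1` lies
outside. -/
lemma contourIntegral_cauchyDiff {ω : ℝ} (hω : ω ∈ Ioo 0 Real.pi) :
    contourIntegral ω cauchyDiff = 1 := by
  have hpi := Real.pi_pos
  have hcos := abs_cos_lt_one hω
  have key : ∀ θ : ℝ, (ω ≤ θ ∧ θ ≤ Real.pi / 2 ∨ Real.pi / 2 ≤ θ ∧ θ ≤ ω) →
      |Real.cos θ| ≤ |Real.cos ω| := by
    rintro θ (⟨h1, h2⟩ | ⟨h1, h2⟩)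
    · rw [abs_of_nonneg (Real.cos_nonneg_of_mem_Icc ⟨by linarith [hω.1], h2⟩),
        abs_of_nonneg (Real.cos_nonneg_of_mem_Icc ⟨by linarith [hω.1], h1.trans h2⟩)]
      exact Real.strictAntiOn_cos.antitoneOn ⟨hω.1.le, hω.2.le⟩
        ⟨by linarith [hω.1], by linarith⟩ h1
    · rw [abs_of_nonpos (Real.cos_nonpos_of_pi_div_two_le_of_le h1 (by linarith [hω.2])),
        abs_of_nonpos (Real.cos_nonpos_of_pi_div_two_le_of_le (h1.trans h2) (by linarith [hω.2]))]
      exact neg_le_neg (Real.strictAntiOn_cos.antitoneOn ⟨by linarith, by linarith [hω.2]⟩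
        ⟨hω.1.le, hω.2.le⟩ h2)
  have e1 : rayIntegral ω cauchyDiff = rayIntegral (Real.pi / 2) cauchyDiff := by
    rcases le_total ω (Real.pi / 2) with h | h
    · exact rayIntegral_cauchyDiff_eq h hcos fun θ hθ => key θ (Or.inl hθ)
    · exact (rayIntegral_cauchyDiff_eq h hcos fun θ hθ => key θ (Or.inr hθ)).symm
  have e2 : rayIntegral (-ω) cauchyDiff = rayIntegral (-(Real.pi / 2)) cauchyDiff := by
    rcases le_total ω (Real.pi / 2) with h | h
    · refine (rayIntegral_cauchyDiff_eq (neg_le_neg h) hcos fun θ hθ => ?_).symm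
      rw [← Real.cos_neg θ]
      exact key (-θ) (Or.inl ⟨by linarith [hθ.2], by linarith [hθ.1]⟩)
    · refine rayIntegral_cauchyDiff_eq (neg_le_neg h) hcos fun θ hθ => ?_
      rw [← Real.cos_neg θ]
      exact key (-θ) (Or.inr ⟨by linarith [hθ.2], by linarith [hθ.1]⟩)
  have hu : Complex.exp (((Real.pi / 2 : ℝ) : ℂ) * Complex.I) = Complex.I := by
    push_cast; exact Complex.exp_pi_div_two_mul_I
  have hu' : Complex.exp (((-(Real.pi / 2) : ℝ) : ℂ) * Complex.I) = -Complex.I := by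
    push_cast; rw [← neg_div]; exact Complex.exp_neg_pi_div_two_mul_I
  rw [contourIntegral, e1, e2, rayIntegral_cauchyDiff_of_sq hu Complex.I_mul_I,
    rayIntegral_cauchyDiff_of_sq hu' (by rw [neg_mul_neg, Complex.I_mul_I]), smul_eq_mul]
  have : (Real.pi : ℂ) ≠ 0 := by exact_mod_cast hpi.ne'
  field_simp
  ring

lemma MemHInf.differentiableAt {φ : ℝ} (hφ : φ ∈ Ioo 0 Real.pi) {f : ℂ → ℂ} (hf : MemHInf φ f)
    {z : ℂ} (hz : z ∈ sector φ) : DifferentiableAt ℂ f z :=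
  hf.1.differentiableAt ((isOpen_sector hφ).mem_nhds hz)

/-! ### Contour integrals of the resolvent -/

variable {X : Type*} [NormedAddCommGroup X] [NormedSpace ℂ X]

lemma sectorContourIntegral_eq (A : X →ₗ.[ℂ] X) (ω : ℝ) (f : ℂ → ℂ) :
    sectorContourIntegral A ω f = contourIntegral ω (fun z => f z • opResolvent A z) := by
  simp only [sectorContourIntegral, contourIntegral, rayIntegral, rayPoint, smul_smul,
    Complex.ofReal_neg, neg_mul]
  congr 3 <;> (ext1 r; rw [mul_comm])

namespace SectorBound

variable {A : X →ₗ.[ℂ] X} {φ' ω φ M : ℝ}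

lemma ray_mem_sector (h : SectorBound A φ' ω φ M) {θ r : ℝ} (hθ : θ ∈ Icc (-ω) ω) (hr : 0 < r) :
    rayPoint θ r ∈ sector φ :=
  rayPoint_mem_sector h.contour_mem.1 h.lt_right h.lt_pi hθ hr

lemma neg_mem_Icc (h : SectorBound A φ' ω φ M) : -ω ∈ Icc (-ω) ω :=
  ⟨le_rfl, by linarith [h.contour_mem.1]⟩

lemma mem_Icc (h : SectorBound A φ' ω φ M) : ω ∈ Icc (-ω) ω :=
  ⟨by linarith [h.contour_mem.1], le_rfl⟩

lemma ray_re_lt (h : SectorBound A φ' ω φ M) {θ r : ℝ} (hθ : θ = -ω ∨ θ = ω) (hr : 0 < r) :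
    (rayPoint θ r).re < ‖rayPoint θ r‖ * Real.cos φ' := by
  rcases hθ with rfl | rfl
  · exact h.rayPoint_re_lt' hr
  · exact h.rayPoint_re_lt ⟨le_rfl, by linarith [h.contour_mem.2]⟩ hr

lemma ray_notMem (h : SectorBound A φ' ω φ M) {θ r : ℝ} (hθ : θ = -ω ∨ θ = ω) (hr : 0 < r) :
    rayPoint θ r ∉ sector φ' :=
  h.notMem_sector_of_re_le (h.ray_re_lt hθ hr).le

lemma angle_mem_Icc (h : SectorBound A φ' ω φ M) {θ : ℝ} (hθ : θ = -ω ∨ θ = ω) :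
    θ ∈ Icc (-ω) ω := by
  rcases hθ with rfl | rfl
  exacts [h.neg_mem_Icc, h.mem_Icc]

lemma contourIntegral_congr {E : Type*} [NormedAddCommGroup E] [NormedSpace ℂ E]
    (h : SectorBound A φ' ω φ M) {g k : ℂ → E}
    (hgk : ∀ z ∈ sector φ, z ∉ sector φ' → g z = k z) :
    contourIntegral ω g = contourIntegral ω k :=
  _root_.contourIntegral_congr fun _ hr =>
    ⟨hgk _ (h.ray_mem_sector h.neg_mem_Icc hr) (h.ray_notMem (Or.inl rfl) hr),
      hgk _ (h.ray_mem_sector h.mem_Icc hr) (h.ray_notMem (Or.inr rfl) hr)⟩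

lemma norm_smul_opResolvent_le (h : SectorBound A φ' ω φ M) {f : ℂ → ℂ} {C s : ℝ}
    (hC0 : 0 ≤ C) (hC : ∀ z ∈ sector φ, ‖f z‖ ≤ C * min (‖z‖ ^ s) (‖z‖ ^ (-s))) {θ r : ℝ}
    (hθ : θ = -ω ∨ θ = ω) (hr : 0 < r) :
    ‖f (rayPoint θ r) • opResolvent A (rayPoint θ r)‖ ≤ C * M * rayWeight s r := by
  have h1 := hC _ (h.ray_mem_sector (h.angle_mem_Icc hθ) hr)
  have h2 := h.norm_opResolvent_le (rayPoint_ne_zero θ hr) (h.ray_notMem hθ hr)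
  rw [norm_rayPoint θ hr] at h1 h2
  rw [norm_smul, rayWeight]
  calc _ ≤ (C * min (r ^ s) (r ^ (-s))) * (M * r⁻¹) :=
        mul_le_mul h1 h2 (norm_nonneg _) (by positivity)
    _ = _ := by ring

lemma continuousAt_smul_opResolvent (h : SectorBound A φ' ω φ M) {f : ℂ → ℂ} (hf : MemHInf φ f)
    {θ r : ℝ} (hθ : θ = -ω ∨ θ = ω) (hr : 0 < r) :
    ContinuousAt (fun z => f z • opResolvent A z) (rayPoint θ r) :=
  (hf.differentiableAt h.outer_mem (h.ray_mem_sector (h.angle_mem_Icc hθ) hr)).continuousAt.smul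
    (h.hasDerivAt_opResolvent (h.ray_re_lt hθ hr)).continuousAt

lemma contourIntegrable_smul_opResolvent (h : SectorBound A φ' ω φ M) {f : ℂ → ℂ}
    (hf : MemHInfZero φ f) : ContourIntegrable ω (fun z => f z • opResolvent A z) := by
  obtain ⟨C, s, hC0, hs, hC⟩ := hf.exists_bound
  refine contourIntegrable_of_rayDecay ⟨C * M, s, hs, fun θ hθ r hr => ?_⟩
    ⟨C * M, s, hs, fun θ hθ r hr => ?_⟩ fun r hr => ⟨?_, ?_⟩
  · exact h.norm_smul_opResolvent_le hC0 hC (Or.inl (le_antisymm hθ.2 hθ.1)) hr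
  · exact h.norm_smul_opResolvent_le hC0 hC (Or.inr (le_antisymm hθ.2 hθ.1)) hr
  · exact h.continuousAt_smul_opResolvent hf.1 (Or.inl rfl) hr
  · exact h.continuousAt_smul_opResolvent hf.1 (Or.inr rfl) hr

lemma sectorContourIntegral_congr (h : SectorBound A φ' ω φ M) {f g : ℂ → ℂ}
    (hfg : ∀ z ∈ sector φ, f z = g z) :
    sectorContourIntegral A ω f = sectorContourIntegral A ω g := by
  rw [sectorContourIntegral_eq, sectorContourIntegral_eq]
  exact h.contourIntegral_congr fun z hz _ => by rw [hfg z hz]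

lemma sectorContourIntegral_add (h : SectorBound A φ' ω φ M) {f g : ℂ → ℂ}
    (hf : MemHInfZero φ f) (hg : MemHInfZero φ g) :
    sectorContourIntegral A ω (fun z => f z + g z) =
      sectorContourIntegral A ω f + sectorContourIntegral A ω g := by
  simp only [sectorContourIntegral_eq, add_smul]
  exact contourIntegral_add (h.contourIntegrable_smul_opResolvent hf)
    (h.contourIntegrable_smul_opResolvent hg)

/-- The constant depends on `f` alone. Since `tA` satisfies the same `SectorBound` as `A`, this is
where uniformity in `t` comes from. -/
lemma norm_sectorContourIntegral_le {f : ℂ → ℂ} (hf : MemHInfZero φ f) :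
    ∃ K : ℝ, 0 ≤ K ∧ ∀ (A : X →ₗ.[ℂ] X) (φ' ω M : ℝ), SectorBound A φ' ω φ M →
      ‖sectorContourIntegral A ω f‖ ≤ K * M := by
  obtain ⟨C, s, hC0, hs, hC⟩ := hf.exists_bound
  set W : ℝ := ∫ r in Ioi (0 : ℝ), rayWeight s r with hW
  have hW0 : 0 ≤ W := setIntegral_nonneg measurableSet_Ioi fun r hr => rayWeight_nonneg s hr
  refine ⟨‖(2 * Real.pi * Complex.I : ℂ)⁻¹‖ * (C * W + C * W), by positivity,
    fun A φ' ω M h => ?_⟩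
  have key : ∀ θ : ℝ, (θ = -ω ∨ θ = ω) →
      ‖rayIntegral θ (fun z => f z • opResolvent A z)‖ ≤ C * W * M := by
    intro θ hθ
    have h1 : IntegrableOn (fun r => C * M * rayWeight s r) (Ioi 0) :=
      (integrableOn_rayWeight hs).const_mul _
    refine (norm_integral_le_of_norm_le h1 ?_).trans_eq ?_
    · filter_upwards [ae_restrict_mem measurableSet_Ioi] with r hr
      rw [norm_smul, Complex.norm_exp_ofReal_mul_I, one_mul]
      exact h.norm_smul_opResolvent_le hC0 hC hθ hr
    · rw [integral_const_mul]; ring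
  rw [sectorContourIntegral_eq, contourIntegral, norm_smul]
  have h2 := norm_sub_le_of_le (key _ (Or.inl rfl)) (key _ (Or.inr rfl))
  rw [← add_mul] at h2
  exact (mul_le_mul_of_nonneg_left h2 (norm_nonneg _)).trans_eq (mul_assoc _ _ _).symm

/-- Substitute `r ↦ tr` on each ray: the Jacobian cancels the factor in `R(tz, tA) = t⁻¹R(z, A)`. -/
lemma sectorContourIntegral_smul {t : ℝ} (ht : 0 < t) (f : ℂ → ℂ) :
    sectorContourIntegral ((t : ℂ) • A) ω f = sectorContourIntegral A ω (fun z => f (t * z)) := by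
  have ht' : (t : ℂ) ≠ 0 := by exact_mod_cast ht.ne'
  have key : ∀ θ : ℝ, rayIntegral θ (fun z => f z • opResolvent ((t : ℂ) • A) z) =
      rayIntegral θ (fun z => f (t * z) • opResolvent A z) := by
    intro θ
    have h1 := integral_comp_mul_left_Ioi (fun r => Complex.exp (θ * Complex.I) •
      f (rayPoint θ r) • opResolvent ((t : ℂ) • A) (rayPoint θ r)) 0 ht
    rw [mul_zero] at h1
    rw [eq_inv_smul_iff₀ ht.ne'] at h1
    simp only [rayIntegral]
    rw [← h1, ← integral_smul]
    refine setIntegral_congr_fun measurableSet_Ioi fun r _ => ?_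
    rw [rayPoint_mul, opResolvent_smul A ht', ← Complex.coe_smul, smul_comm (t : ℂ),
      smul_comm (t : ℂ), smul_smul (t : ℂ), mul_inv_cancel₀ ht', one_smul]
  rw [sectorContourIntegral_eq, sectorContourIntegral_eq, contourIntegral, contourIntegral, key,
    key]

lemma rayDecay_of_mul_norm_le {g : ℂ → ℂ} {α β C s : ℝ} (hs : 0 < s)
    (hg : ∀ θ ∈ Icc α β, ∀ r : ℝ, 0 < r →
      ‖g (rayPoint θ r)‖ ≤ C * (min (r ^ s) (r ^ (-s)) * r⁻¹)) : RayDecay α β g :=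
  ⟨C, s, hs, fun θ hθ r hr => (hg θ hθ r hr).trans_eq (by rw [rayWeight, mul_comm r⁻¹])⟩

lemma rayDecay_mul_inv (h : SectorBound A φ' ω φ M) {f : ℂ → ℂ} (hf : MemHInfZero φ f) {s : ℝ}
    (hs : 0 < s) : RayDecay (-ω) ω (fun z => f z * (1 + s * z)⁻¹) := by
  obtain ⟨C, u, hC0, hu, hC⟩ := hf.exists_bound
  obtain ⟨K, hK0, hK⟩ := exists_norm_inv_one_add_mul_le h.outer_mem
  refine rayDecay_of_mul_norm_le (C := C * (K * s⁻¹)) hu fun θ hθ r hr => ?_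
  have hz := h.ray_mem_sector hθ hr
  have h1 := hC _ hz
  have h2 := hK s hs.le _ hz
  rw [norm_rayPoint θ hr] at h1 h2
  have h3 : (1 + s * r)⁻¹ ≤ s⁻¹ * r⁻¹ := by
    rw [← mul_inv]; exact inv_anti₀ (by positivity) (by linarith)
  rw [norm_mul]
  calc _ ≤ (C * min (r ^ u) (r ^ (-u))) * (K * (s⁻¹ * r⁻¹)) :=
        mul_le_mul h1 (h2.trans (mul_le_mul_of_nonneg_left h3 hK0.le)) (norm_nonneg _)
          (by positivity)
    _ = _ := by ring

lemma contourIntegrable_of_rayDecay (h : SectorBound A φ' ω φ M) {g : ℂ → ℂ}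
    (hd : RayDecay (-ω) ω g) (hg : MemHInf φ g) : ContourIntegrable ω g :=
  _root_.contourIntegrable_of_rayDecay (hd.mono le_rfl h.neg_mem_Icc.2)
    (hd.mono h.mem_Icc.1 le_rfl) fun _ hr =>
      ⟨(hg.differentiableAt h.outer_mem (h.ray_mem_sector h.neg_mem_Icc hr)).continuousAt,
        (hg.differentiableAt h.outer_mem (h.ray_mem_sector h.mem_Icc hr)).continuousAt⟩

lemma contourIntegral_eq_zero (h : SectorBound A φ' ω φ M) {g : ℂ → ℂ}
    (hd : RayDecay (-ω) ω g) (hg : MemHInf φ g) : contourIntegral ω g = 0 :=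
  contourIntegral_eq_zero_of_inside h.contour_mem.1.le hd fun _ hθ _ hr =>
    hg.differentiableAt h.outer_mem (h.ray_mem_sector hθ hr)

/-- The product `R(z,A)(P - Q)` behaves like `z⁻¹(P - Q)` at infinity. Subtracting the kernel with
pole at `1`, inside the sector, gains one power of decay and keeps holomorphy outside. -/
lemma norm_outer_remainder_le (h : SectorBound A φ' ω φ M) :
    ∃ C : ℝ, ∀ θ ∈ Icc ω (2 * Real.pi - ω), ∀ r : ℝ, 0 < r →
      ‖opResolvent A (rayPoint θ r) * (onePlusInv A 1 - onePlusInv A 2) -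
        (rayPoint θ r - 1)⁻¹ • (onePlusInv A 1 - onePlusInv A 2)‖ ≤ C * rayWeight 1 r := by
  have hM := h.bound_nonneg
  set P := onePlusInv A 1 with hP
  set Q := onePlusInv A 2 with hQ
  -- The bounded operator `A(P - Q)`, from `AP = 1 - P` and `AQ = (1 - Q)/2`.
  set D : X →L[ℂ] X := (2 : ℂ)⁻¹ • 1 - P + (2 : ℂ)⁻¹ • Q with hD
  have hcos : Real.cos φ' < 1 := by
    rw [← Real.cos_zero]
    exact Real.strictAntiOn_cos ⟨le_rfl, Real.pi_pos.le⟩ ⟨h.pos.le, h.angle_mem.2.le⟩ h.pos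
  obtain ⟨κ, h0, hκ⟩ := exists_mul_le_norm_sub hcos (Real.neg_one_le_cos φ')
  refine ⟨max ((M + 1) * ‖P * Q‖ + κ⁻¹ * ‖P - Q‖) (M * ‖D‖ + κ⁻¹ * ‖P - Q‖),
    fun θ hθ r hr => ?_⟩
  set z := rayPoint θ r with hz
  have hz0 : z ≠ 0 := rayPoint_ne_zero θ hr
  have hre := h.rayPoint_re_lt hθ hr
  have hzs := h.notMem_sector_of_re_le hre.le
  have hzr : ‖z‖ = r := norm_rayPoint θ hr
  have hR := h.norm_opResolvent_le hz0 hzs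
  have hzR := h.bound z hz0 hzs
  have hz1 := hκ z hre.le
  rw [hzr] at hR hz1
  have hz1ne : z - 1 ≠ 0 := norm_pos_iff.1 (lt_of_lt_of_le (by positivity) hz1)
  have hinv : ‖(z - 1)⁻¹‖ ≤ κ⁻¹ := by
    rw [norm_inv]
    exact inv_anti₀ h0 ((le_mul_of_one_le_right h0.le (by linarith)).trans hz1)
  have hinv' : ‖(z - 1)⁻¹‖ ≤ κ⁻¹ * r⁻¹ := by
    rw [norm_inv, ← mul_inv]
    exact inv_anti₀ (by positivity) ((mul_le_mul_of_nonneg_left (by linarith) h0.le).trans hz1)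
  have eP := h.opResolvent_mul_onePlusInv one_pos hz0 hzs
  have eQ := h.opResolvent_mul_onePlusInv two_pos hz0 hzs
  have ePQ := h.onePlusInv_one_mul_two
  rw [← hP, Complex.ofReal_one, one_mul, one_smul] at eP
  rw [← hQ, Complex.ofReal_ofNat] at eQ
  rw [← hP, ← hQ] at ePQ
  -- Here `P - Q = APQ` and `R(z,A)A = zR(z,A) - 1`, so there is no singularity at the origin.
  have near : opResolvent A z * (P - Q) = (z • opResolvent A z - 1) * (P * Q) := by
    rw [ePQ, mul_sub, sub_mul, mul_sub, mul_smul_comm, smul_mul_assoc, smul_mul_assoc, one_mul]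
    linear_combination (norm := module) eP - eQ
  have far : z • (opResolvent A z * (P - Q)) - (P - Q) = opResolvent A z * D := by
    rw [hD, mul_add, mul_sub, mul_sub, mul_smul_comm, mul_smul_comm, mul_one]
    linear_combination (norm := module) eP - (2 : ℂ)⁻¹ • eQ
  refine le_mul_rayWeight_one hr ?_ ?_ (norm_nonneg _)
  · refine (norm_sub_le _ _).trans (add_le_add ?_ ?_)
    · rw [near]
      refine (norm_mul_le _ _).trans (mul_le_mul_of_nonneg_right ?_ (norm_nonneg _))
      refine (norm_sub_le _ _).trans (add_le_add hzR ?_)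
      exact ContinuousLinearMap.norm_id_le
    · rw [norm_smul]
      exact mul_le_mul_of_nonneg_right hinv (norm_nonneg _)
  · have h1 : opResolvent A z * (P - Q) - (z - 1)⁻¹ • (P - Q) =
        z⁻¹ • (opResolvent A z * D) - (z⁻¹ * (z - 1)⁻¹) • (P - Q) := by
      have e1 : (z - 1)⁻¹ = z⁻¹ + z⁻¹ * (z - 1)⁻¹ := by field_simp; ring
      have e2 : z⁻¹ • (opResolvent A z * D) =
          opResolvent A z * (P - Q) - z⁻¹ • (P - Q) := by
        rw [← far, smul_sub z⁻¹, smul_smul, inv_mul_cancel₀ hz0, one_smul]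
      rw [e2, sub_sub, ← add_smul, ← e1]
    rw [h1, add_mul]
    refine (norm_sub_le _ _).trans (add_le_add ?_ ?_)
    · rw [norm_smul, norm_inv, hzr]
      calc r⁻¹ * ‖opResolvent A z * D‖ ≤ r⁻¹ * (M * r⁻¹ * ‖D‖) := by
            gcongr
            exact (norm_mul_le _ _).trans (mul_le_mul_of_nonneg_right hR (norm_nonneg _))
        _ = _ := by ring
    · rw [norm_smul, norm_mul, norm_inv, hzr]
      calc r⁻¹ * ‖(z - 1)⁻¹‖ * ‖P - Q‖ ≤ r⁻¹ * (κ⁻¹ * r⁻¹) * ‖P - Q‖ := by gcongr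
        _ = _ := by ring

/-! ### Products with resolvents and normalization of the calculus -/

section Complete

variable [CompleteSpace X]

lemma sectorContourIntegral_const_mul (h : SectorBound A φ' ω φ M) {f : ℂ → ℂ}
    (hf : MemHInfZero φ f) (c : ℂ) :
    sectorContourIntegral A ω (fun z => c * f z) = c • sectorContourIntegral A ω f := by
  simp only [sectorContourIntegral_eq, mul_smul]
  have := ContinuousLinearMap.contourIntegral_comp (h.contourIntegrable_smul_opResolvent hf)
    (c • ContinuousLinearMap.id ℂ (X →L[ℂ] X))
  exact this

/-- Multiplicativity of the calculus with respect to resolvents. -/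
theorem sectorContourIntegral_mul_onePlusInv (h : SectorBound A φ' ω φ M) {f : ℂ → ℂ}
    (hf : MemHInfZero φ f) {s : ℝ} (hs : 0 < s) :
    sectorContourIntegral A ω f * onePlusInv A s =
      sectorContourIntegral A ω (fun z => f z * (1 + s * z)⁻¹) := by
  have hf' := hf.mul (memHInf_inv_one_add_mul h.outer_mem hs.le)
  have hd := h.rayDecay_mul_inv hf hs
  have hi := h.contourIntegrable_of_rayDecay hd hf'.1
  set L : (X →L[ℂ] X) →L[ℂ] (X →L[ℂ] X) :=
    (ContinuousLinearMap.mul ℂ (X →L[ℂ] X)).flip (onePlusInv A s) with hL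
  set S : ℂ →L[ℂ] (X →L[ℂ] X) :=
    (ContinuousLinearMap.id ℂ ℂ).smulRight ((s : ℂ) • onePlusInv A s) with hS
  have h1 := ContinuousLinearMap.contourIntegral_comp (h.contourIntegrable_smul_opResolvent hf) L
  have h2 := ContinuousLinearMap.contourIntegral_comp hi S
  -- In `R(z,A)(1+sA)⁻¹ = (1+sz)⁻¹(R(z,A) + s(1+sA)⁻¹)` the second term contributes only a scalar
  -- integral, which vanishes because `f(z)(1+sz)⁻¹` is holomorphic inside the sector.
  rw [h.contourIntegral_eq_zero hd hf'.1, map_zero] at h2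
  have h3 := contourIntegral_add (h.contourIntegrable_smul_opResolvent hf') (hi.clm_comp S)
  rw [h2, add_zero] at h3
  rw [sectorContourIntegral_eq, sectorContourIntegral_eq, ← h3]
  change L _ = _
  rw [← h1]
  refine h.contourIntegral_congr fun z hz hz' => ?_
  have h4 := h.opResolvent_mul_onePlusInv hs hz.1 hz'
  have h5 := one_add_mul_ne_zero h.outer_mem hs.le hz
  have h6 : opResolvent A z * onePlusInv A s = (1 + s * z)⁻¹ • (opResolvent A z +
      (s : ℂ) • onePlusInv A s) := by
    rw [← h4, smul_smul, inv_mul_cancel₀ h5, one_smul]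
  simp only [hL, hS, ContinuousLinearMap.flip_apply, ContinuousLinearMap.mul_apply',
    ContinuousLinearMap.smulRight_apply, ContinuousLinearMap.id_apply]
  rw [smul_mul_assoc, h6]
  module

theorem onePlusInv_mul_sectorContourIntegral (h : SectorBound A φ' ω φ M) {f : ℂ → ℂ}
    (hf : MemHInfZero φ f) {s : ℝ} (hs : 0 < s) :
    onePlusInv A s * sectorContourIntegral A ω f =
      sectorContourIntegral A ω (fun z => f z * (1 + s * z)⁻¹) := by
  rw [← h.sectorContourIntegral_mul_onePlusInv hf hs]
  set L : (X →L[ℂ] X) →L[ℂ] (X →L[ℂ] X) :=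
    (ContinuousLinearMap.mul ℂ (X →L[ℂ] X)).flip (onePlusInv A s) with hL
  set L' : (X →L[ℂ] X) →L[ℂ] (X →L[ℂ] X) :=
    (ContinuousLinearMap.mul ℂ (X →L[ℂ] X)) (onePlusInv A s) with hL'
  have h1 := ContinuousLinearMap.contourIntegral_comp (h.contourIntegrable_smul_opResolvent hf) L
  have h2 := ContinuousLinearMap.contourIntegral_comp (h.contourIntegrable_smul_opResolvent hf) L'
  rw [sectorContourIntegral_eq]
  change L' _ = L _
  rw [← h1, ← h2]
  refine h.contourIntegral_congr fun z hz hz' => ?_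
  have h5 := one_add_mul_ne_zero h.outer_mem hs.le hz
  have h6 : onePlusInv A s * opResolvent A z = opResolvent A z * onePlusInv A s :=
    smul_right_injective _ h5 ((h.onePlusInv_mul_opResolvent hs hz.1 hz').trans
      (h.opResolvent_mul_onePlusInv hs hz.1 hz').symm)
  simp only [hL, hL', ContinuousLinearMap.flip_apply, ContinuousLinearMap.mul_apply']
  rw [smul_mul_assoc, mul_smul_comm, h6]

/-- The calculus reproduces `(1 + A)⁻¹ - (1 + 2A)⁻¹`. -/
theorem sectorContourIntegral_resolventDiff (h : SectorBound A φ' ω φ M) :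
    sectorContourIntegral A ω resolventDiff = onePlusInv A 1 - onePlusInv A 2 := by
  obtain ⟨C, hC⟩ := h.norm_outer_remainder_le
  set P := onePlusInv A 1 with hP
  set Q := onePlusInv A 2 with hQ
  -- On the contour, `resolventDiff z • R(z,A) = H + cauchyDiff z • (P - Q) + j z • Q`. The first
  -- term integrates to zero by closing outside the sector, the last by closing inside, and the
  -- middle one gives `P - Q`.
  set H : ℂ → X →L[ℂ] X := fun z => opResolvent A z * (P - Q) - (z - 1)⁻¹ • (P - Q) with hH
  set j : ℂ → ℂ := fun z => (1 + z)⁻¹ * (1 + 2 * z)⁻¹ with hj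
  have hcos : Real.cos φ' < 1 := by
    rw [← Real.cos_zero]
    exact Real.strictAntiOn_cos ⟨le_rfl, Real.pi_pos.le⟩ ⟨h.pos.le, h.angle_mem.2.le⟩ h.pos
  obtain ⟨κ, h0, hκ⟩ := exists_mul_le_norm_sub hcos (Real.neg_one_le_cos φ')
  have hne : ∀ z : ℂ, z.re < ‖z‖ * Real.cos φ' → z - 1 ≠ 0 := fun z hz =>
    norm_pos_iff.1 (lt_of_lt_of_le (by positivity) (hκ z hz.le))
  have hHd : ∀ z : ℂ, z.re < ‖z‖ * Real.cos φ' → DifferentiableAt ℂ H z := by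
    intro z hz
    have d1 := (h.hasDerivAt_opResolvent hz).differentiableAt
    have d2 : DifferentiableAt ℂ (fun w : ℂ => (w - 1)⁻¹) z :=
      DifferentiableAt.inv (by fun_prop) (hne z hz)
    exact (d1.mul_const _).sub (d2.smul_const _)
  have hdecay : RayDecay ω (2 * Real.pi - ω) H := ⟨C, 1, one_pos, hC⟩
  have hH0 : contourIntegral ω H = 0 :=
    contourIntegral_eq_zero_of_outside h.contour_mem.2.le hdecay fun θ hθ r hr =>
      hHd _ (h.rayPoint_re_lt hθ hr)
  have hper : ∀ r : ℝ, rayPoint (-ω) r = rayPoint (2 * Real.pi - ω) r := by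
    intro r
    rw [rayPoint, rayPoint, show ((2 * Real.pi - ω : ℝ) : ℂ) * Complex.I =
      ((-ω : ℝ) : ℂ) * Complex.I + 2 * Real.pi * Complex.I by push_cast; ring,
      Complex.exp_periodic]
  have hHi : ContourIntegrable ω H := by
    refine _root_.contourIntegrable_of_rayDecay ⟨C, 1, one_pos, fun θ hθ r hr => ?_⟩
      (hdecay.mono le_rfl (by linarith [h.contour_mem.2])) fun r hr =>
      ⟨(hHd _ (h.ray_re_lt (Or.inl rfl) hr)).continuousAt,
        (hHd _ (h.ray_re_lt (Or.inr rfl) hr)).continuousAt⟩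
    rw [show θ = -ω from le_antisymm hθ.2 hθ.1, hper]
    exact hC _ ⟨by linarith [h.contour_mem.2], le_rfl⟩ r hr
  have hjm : MemHInf φ j := by
    have h1 := memHInf_inv_one_add_mul h.outer_mem zero_le_one
    have h2 := memHInf_inv_one_add_mul h.outer_mem zero_le_two
    simpa [hj] using h1.mul h2
  have hjd : RayDecay (-ω) ω j := by
    obtain ⟨K, hK0, hK⟩ := exists_norm_inv_one_add_mul_le h.outer_mem
    refine ⟨K * K, 1, one_pos, fun θ hθ r hr => ?_⟩
    have hz := h.ray_mem_sector hθ hr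
    have e1 := hK 1 zero_le_one _ hz
    have e2 := hK 2 zero_le_two _ hz
    rw [Complex.ofReal_one, one_mul, one_mul, norm_rayPoint θ hr] at e1
    rw [Complex.ofReal_ofNat, norm_rayPoint θ hr] at e2
    have e3 : (1 + 2 * r)⁻¹ ≤ (1 + r)⁻¹ := inv_anti₀ (by positivity) (by linarith)
    simp only [hj]
    rw [norm_mul]
    calc _ ≤ K * (1 + r)⁻¹ * (K * (1 + r)⁻¹) :=
          mul_le_mul e1 (e2.trans (mul_le_mul_of_nonneg_left e3 hK0.le)) (norm_nonneg _)
            (by positivity)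
      _ = K * K * ((1 + r)⁻¹ * (1 + r)⁻¹) := by ring
      _ ≤ _ := mul_le_mul_of_nonneg_left (inv_one_add_sq_le_rayWeight hr) (by positivity)
  have hji := h.contourIntegrable_of_rayDecay hjd hjm
  have hj0 := h.contourIntegral_eq_zero hjd hjm
  have hki := contourIntegrable_cauchyDiff h.contour_mem
  have hk1 := contourIntegral_cauchyDiff h.contour_mem
  set S₁ : ℂ →L[ℂ] (X →L[ℂ] X) := (ContinuousLinearMap.id ℂ ℂ).smulRight (P - Q) with hS₁
  set S₂ : ℂ →L[ℂ] (X →L[ℂ] X) := (ContinuousLinearMap.id ℂ ℂ).smulRight Q with hS₂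
  have e1 := contourIntegral_add (hHi.add (hki.clm_comp S₁)) (hji.clm_comp S₂)
  rw [contourIntegral_add hHi (hki.clm_comp S₁),
    ContinuousLinearMap.contourIntegral_comp hki S₁,
    ContinuousLinearMap.contourIntegral_comp hji S₂, hH0, hj0, hk1, map_zero, zero_add,
    add_zero] at e1
  have e2 : S₁ 1 = P - Q := by simp [hS₁]
  rw [← e2, ← e1, sectorContourIntegral_eq]
  refine h.contourIntegral_congr fun z hz hz' => ?_
  have eP := h.opResolvent_mul_onePlusInv one_pos hz.1 hz'
  have eQ := h.opResolvent_mul_onePlusInv two_pos hz.1 hz'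
  have n1 := one_add_mul_ne_zero h.outer_mem zero_le_one hz
  have n2 := one_add_mul_ne_zero h.outer_mem zero_le_two hz
  rw [Complex.ofReal_one, one_mul] at n1
  rw [Complex.ofReal_ofNat] at n2
  rw [← hP, Complex.ofReal_one, one_mul, one_smul] at eP
  rw [← hQ, Complex.ofReal_ofNat] at eQ
  have eP' : opResolvent A z * P = (1 + z)⁻¹ • (opResolvent A z + P) := by
    rw [← eP, smul_smul, inv_mul_cancel₀ n1, one_smul]
  have eQ' : opResolvent A z * Q = (1 + 2 * z)⁻¹ • (opResolvent A z + (2 : ℂ) • Q) := by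
    rw [← eQ, smul_smul, inv_mul_cancel₀ n2, one_smul]
  have ej : j z = 2 * (1 + 2 * z)⁻¹ - (1 + z)⁻¹ := by
    simp only [hj]
    rw [← mul_inv, eq_sub_iff_add_eq, ← div_eq_mul_inv, inv_eq_one_div, inv_eq_one_div,
      div_add_div _ _ (mul_ne_zero n1 n2) n1, div_eq_div_iff (mul_ne_zero (mul_ne_zero n1 n2) n1) n2]
    ring
  simp only [hH, hS₁, hS₂, ContinuousLinearMap.smulRight_apply, ContinuousLinearMap.id_apply]
  rw [mul_sub, eP', eQ', ej, resolventDiff, cauchyDiff, add_comm z 1]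
  module

end Complete

end SectorBound

end Calculus

/-! ### A reproducing formula -/

section Reproducing

open Filter Topology

/-- Integrate in the first variable first: by scaling that integral does not depend on `r`, and the
remaining weight is integrable. -/
lemma integrable_prod_rayWeight {u : ℝ} (hu : 0 < u) :
    Integrable (fun p : ℝ × ℝ => rayWeight u p.2 * (p.2 * rayWeight 1 (p.1 * p.2)))
      ((volume.restrict (Ioi (0 : ℝ))).prod (volume.restrict (Ioi (0 : ℝ)))) := by
  have hmeas : ∀ v : ℝ, Measurable (rayWeight v) := fun v => by unfold rayWeight; fun_prop
  have hm : Measurable (fun p : ℝ × ℝ => rayWeight u p.2 * (p.2 * rayWeight 1 (p.1 * p.2))) :=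
    ((hmeas u).comp measurable_snd).mul (measurable_snd.mul ((hmeas 1).comp (by fun_prop)))
  rw [integrable_prod_iff' hm.aestronglyMeasurable]
  constructor
  · filter_upwards [ae_restrict_mem measurableSet_Ioi] with r hr
    have h1 := (integrableOn_Ioi_comp_mul_right_iff (rayWeight 1) 0 hr).2
      (by rw [zero_mul]; exact integrableOn_rayWeight one_pos)
    exact (h1.const_mul r).const_mul _
  · set W : ℝ := ∫ r in Ioi (0 : ℝ), rayWeight 1 r
    refine ((integrableOn_rayWeight hu).mul_const W).congr ?_
    filter_upwards [ae_restrict_mem measurableSet_Ioi] with r hr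
    have h1 : ∀ s ∈ Ioi (0 : ℝ), ‖rayWeight u r * (r * rayWeight 1 (s * r))‖ =
        rayWeight u r * (r * rayWeight 1 (s * r)) := fun s hs =>
      Real.norm_of_nonneg (mul_nonneg (rayWeight_nonneg u hr)
        (mul_nonneg (le_of_lt hr) (rayWeight_nonneg 1 (mul_pos hs hr))))
    rw [setIntegral_congr_fun measurableSet_Ioi h1, integral_const_mul, integral_const_mul,
      integral_comp_mul_right_Ioi (rayWeight 1) 0 hr, zero_mul, smul_eq_mul,
      mul_inv_cancel_left₀ (ne_of_gt hr)]

lemma MemHInf.congr {φ : ℝ} {f g : ℂ → ℂ} (hf : MemHInf φ f)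
    (h : ∀ z ∈ sector φ, g z = f z) : MemHInf φ g := by
  obtain ⟨hd, D, hD⟩ := hf
  exact ⟨hd.congr h, D, fun z hz => (congrArg _ (h z hz)).trans_le (hD z hz)⟩

lemma MemHInfZero.congr {φ : ℝ} {f g : ℂ → ℂ} (hf : MemHInfZero φ f)
    (h : ∀ z ∈ sector φ, g z = f z) : MemHInfZero φ g := by
  refine ⟨hf.1.congr h, ?_⟩
  obtain ⟨-, D, u, hu, hD⟩ := hf
  exact ⟨D, u, hu, fun z hz => (congrArg _ (h z hz)).trans_le (hD z hz)⟩

/-- The function `f₀ + l (1 + z)⁻¹ - l`. -/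
def eFun (f₀ : ℂ → ℂ) (l z : ℂ) : ℂ := f₀ z + l * (1 + z)⁻¹ - l

lemma memHInf_eFun {φ : ℝ} (hφ : φ ∈ Ioo 0 Real.pi) {f₀ : ℂ → ℂ} (hf : MemHInfZero φ f₀) (l : ℂ) :
    MemHInf φ (eFun f₀ l) := by
  have h1 := (memHInf_inv_one_add_mul hφ zero_le_one).mul (memHInf_const φ l)
  have h2 := (hf.1.add h1).add (memHInf_const φ (-l))
  have e : eFun f₀ l = fun z => f₀ z + (1 + ((1 : ℝ) : ℂ) * z)⁻¹ * l + -l := by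
    funext z; simp [eFun, mul_comm, sub_eq_add_neg]
  rwa [e]

/-- The function `(1 + z)^{-k-2} f(z)`. -/
def weighted (f : ℂ → ℂ) (k : ℕ) (z : ℂ) : ℂ := (1 + z)⁻¹ ^ (k + 2) * f z

lemma memHInf_inv_pow {φ s : ℝ} (hφ : φ ∈ Ioo 0 Real.pi) (hs : 0 ≤ s) (n : ℕ) :
    MemHInf φ (fun z => (1 + (s : ℂ) * z)⁻¹ ^ n) := by
  induction n with
  | zero => simpa using memHInf_const φ 1
  | succ n ih => simpa only [pow_succ] using ih.mul (memHInf_inv_one_add_mul hφ hs)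

lemma memHInf_weighted {φ : ℝ} (hφ : φ ∈ Ioo 0 Real.pi) {f : ℂ → ℂ} (hf : MemHInf φ f) (k : ℕ) :
    MemHInf φ (weighted f k) := by
  have h1 := (memHInf_inv_pow hφ zero_le_one (k + 2)).mul hf
  have e : weighted f k = fun z => (1 + ((1 : ℝ) : ℂ) * z)⁻¹ ^ (k + 2) * f z := by
    funext z; simp [weighted]
  rwa [e]

/-- Two of the `k + 2` factors give the decay `min(1, r⁻²)`; the others are bounded. -/
lemma exists_norm_weighted_le {φ : ℝ} (hφ : φ ∈ Ioo 0 Real.pi) {f : ℂ → ℂ} (hf : MemHInf φ f)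
    (k : ℕ) : ∃ C : ℝ, 0 ≤ C ∧ ∀ z ∈ sector φ, ‖weighted f k z‖ ≤ C * rayWeight 1 ‖z‖ := by
  obtain ⟨K, hK0, hK⟩ := exists_norm_inv_one_add_mul_le hφ
  obtain ⟨-, D, hD⟩ := hf
  have hD0 : 0 ≤ D := (norm_nonneg _).trans (hD 1 (by simpa using ofReal_mem_sector hφ one_pos))
  refine ⟨K ^ (k + 2) * D, by positivity, fun z hz => ?_⟩
  have hz0 : 0 < ‖z‖ := norm_pos_iff.2 hz.1
  have e1 := hK 1 zero_le_one z hz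
  rw [Complex.ofReal_one, one_mul, one_mul] at e1
  rw [weighted, norm_mul, norm_pow]
  have hle : (1 + ‖z‖)⁻¹ ≤ 1 := inv_le_one_of_one_le₀ (by linarith)
  calc _ ≤ (K * (1 + ‖z‖)⁻¹) ^ (k + 2) * D := by
        gcongr
        exact hD z hz
    _ = K ^ (k + 2) * D * ((1 + ‖z‖)⁻¹ ^ k * ((1 + ‖z‖)⁻¹ * (1 + ‖z‖)⁻¹)) := by
        rw [mul_pow, pow_add (1 + ‖z‖)⁻¹]; ring
    _ ≤ K ^ (k + 2) * D * (1 * rayWeight 1 ‖z‖) := by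
        refine mul_le_mul_of_nonneg_left ?_ (by positivity)
        exact mul_le_mul (pow_le_one₀ (by positivity) hle) (inv_one_add_sq_le_rayWeight hz0)
          (by positivity) zero_le_one
    _ = _ := by rw [one_mul]

/-! ### Fubini's theorem and the reproducing formula -/

variable {X : Type*} [NormedAddCommGroup X] [NormedSpace ℂ X]

lemma onePlusInv_smul (A : X →ₗ.[ℂ] X) (s t : ℝ) :
    onePlusInv ((t : ℂ) • A) s = onePlusInv A (s * t) := by
  rw [onePlusInv, onePlusInv, smul_smul, Complex.ofReal_mul]

/-- The operator `f₀(A) + l (1 + A)⁻¹ - l`. -/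
def eCalc (A : X →ₗ.[ℂ] X) (ω : ℝ) (f₀ : ℂ → ℂ) (l : ℂ) : X →L[ℂ] X :=
  sectorContourIntegral A ω f₀ + l • onePlusInv A 1 - l • 1

/-- The operator `sA (1 + sA)^{-k-2}`. -/
def bump (A : X →ₗ.[ℂ] X) (k : ℕ) (s : ℝ) : X →L[ℂ] X :=
  (1 - onePlusInv A s) * onePlusInv A s ^ (k + 1)

namespace SectorBound

variable {A : X →ₗ.[ℂ] X} {φ' ω φ M : ℝ}

lemma rayDecay_of_le (h : SectorBound A φ' ω φ M) {g : ℂ → ℂ} {C : ℝ}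
    (hC : ∀ z ∈ sector φ, ‖g z‖ ≤ C * rayWeight 1 ‖z‖) : RayDecay (-ω) ω g :=
  ⟨C, 1, one_pos, fun θ hθ r hr => by
    simpa [norm_rayPoint θ hr] using hC _ (h.ray_mem_sector hθ hr)⟩

/-- By Cauchy's theorem both boundary rays give the value on the positive half-axis, so one scalar
can be taken out of the whole contour integral. -/
lemma rayIntegral_eq_zero_angle (h : SectorBound A φ' ω φ M) {g : ℂ → ℂ} {C : ℝ}
    (hg : MemHInf φ g) (hC : ∀ z ∈ sector φ, ‖g z‖ ≤ C * rayWeight 1 ‖z‖) {θ : ℝ}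
    (hθ : θ = -ω ∨ θ = ω) : rayIntegral θ g = rayIntegral 0 g := by
  have hd := h.rayDecay_of_le hC
  have hω := h.contour_mem.1
  rcases hθ with rfl | rfl
  · exact rayIntegral_eq_of_differentiableAt (by linarith) (hd.mono le_rfl hω.le)
      fun θ hθ r hr => hg.differentiableAt h.outer_mem
        (h.ray_mem_sector ⟨hθ.1, by linarith [hθ.2]⟩ hr)
  · exact (rayIntegral_eq_of_differentiableAt hω.le (hd.mono (by linarith) le_rfl)
      fun θ hθ r hr => hg.differentiableAt h.outer_mem
        (h.ray_mem_sector ⟨by linarith [hθ.1], hθ.2⟩ hr)).symm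

/-- The measure `z ds` is invariant under the substitution `u = sr`, so the result does not depend
on the point of the ray. -/
lemma integral_ray_mul (θ : ℝ) (g : ℂ → ℂ) {r : ℝ} (hr : 0 < r) :
    ∫ s in Ioi (0 : ℝ), rayPoint θ r * g (s * rayPoint θ r) = rayIntegral θ g := by
  have h1 := integral_comp_mul_right_Ioi
    (fun u => Complex.exp (θ * Complex.I) • g (rayPoint θ u)) 0 hr
  rw [zero_mul, eq_inv_smul_iff₀ hr.ne', ← integral_smul] at h1
  rw [rayIntegral, ← h1]
  refine setIntegral_congr_fun measurableSet_Ioi fun s _ => ?_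
  rw [rayPoint_mul, ← Complex.coe_smul, smul_smul, smul_eq_mul, ← rayPoint]

lemma bump_commute (h : SectorBound A φ' ω φ M) {s t : ℝ} (hs : 0 < s) (ht : 0 < t) (k : ℕ) :
    Commute (onePlusInv A t) (bump A k s) := by
  have h1 : Commute (onePlusInv A t) (onePlusInv A s) := h.onePlusInv_commute ht hs
  exact ((Commute.one_right _).sub_right h1).mul_right (h1.pow_right _)

section Complete

variable [CompleteSpace X]

/-- After exchanging the integrals, the inner one in `s` is a constant independent of `z`. The decay
of `F` makes the double integral absolutely convergent. -/
lemma ray_fubini (h : SectorBound A φ' ω φ M) {F g : ℂ → ℂ} (hF : MemHInfZero φ F)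
    (hg : MemHInf φ g) {C : ℝ} (hC0 : 0 ≤ C)
    (hC : ∀ z ∈ sector φ, ‖g z‖ ≤ C * rayWeight 1 ‖z‖) {θ : ℝ} (hθ : θ = -ω ∨ θ = ω) :
    IntegrableOn (fun s : ℝ => rayIntegral θ
      (fun z => (z * g (s * z)) • F z • opResolvent A z)) (Ioi 0) ∧
    ∫ s in Ioi (0 : ℝ), rayIntegral θ (fun z => (z * g (s * z)) • F z • opResolvent A z) =
      rayIntegral 0 g • rayIntegral θ (fun z => F z • opResolvent A z) := by
  obtain ⟨D, u, hD0, hu, hD⟩ := hF.exists_bound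
  set H : ℝ × ℝ → X →L[ℂ] X := fun p => Complex.exp (θ * Complex.I) •
    (rayPoint θ p.2 * g (p.1 * rayPoint θ p.2)) •
      F (rayPoint θ p.2) • opResolvent A (rayPoint θ p.2) with hH
  have hθ' := h.angle_mem_Icc hθ
  have hint : Integrable H
      ((volume.restrict (Ioi (0 : ℝ))).prod (volume.restrict (Ioi (0 : ℝ)))) := by
    refine ((integrable_prod_rayWeight hu).const_mul (C * (D * M))).mono' ?_ ?_
    · rw [Measure.prod_restrict]
      refine ContinuousOn.aestronglyMeasurable ?_ (measurableSet_Ioi.prod measurableSet_Ioi)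
      rintro ⟨s, r⟩ ⟨hs, hr⟩
      have hz := h.ray_mem_sector hθ' hr
      have c1 : ContinuousAt (fun p : ℝ × ℝ => rayPoint θ p.2) (s, r) :=
        ((continuous_rayPoint θ).comp continuous_snd).continuousAt
      have c2 : ContinuousAt (fun p : ℝ × ℝ => (p.1 : ℂ) * rayPoint θ p.2) (s, r) :=
        (Complex.continuous_ofReal.comp continuous_fst).continuousAt.mul c1
      have c3 : ContinuousAt (fun p : ℝ × ℝ => g ((p.1 : ℂ) * rayPoint θ p.2)) (s, r) :=
        ContinuousAt.comp (g := g) (hg.differentiableAt h.outer_mem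
          (real_mul_mem_sector h.outer_mem hs hz)).continuousAt c2
      have c4 : ContinuousAt (fun p : ℝ × ℝ =>
          F (rayPoint θ p.2) • opResolvent A (rayPoint θ p.2)) (s, r) :=
        ContinuousAt.comp (g := fun z => F z • opResolvent A z)
          (h.continuousAt_smul_opResolvent hF.1 hθ hr) c1
      have c5 := (c1.mul c3).smul c4
      exact (c5.const_smul (Complex.exp (θ * Complex.I))).continuousWithinAt
    · rw [Measure.prod_restrict]
      filter_upwards [ae_restrict_mem (measurableSet_Ioi.prod measurableSet_Ioi)]
      rintro ⟨s, r⟩ ⟨hs, hr⟩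
      have hs : 0 < s := hs
      have hr : 0 < r := hr
      have hz := h.ray_mem_sector hθ' hr
      have e1 := hC _ (real_mul_mem_sector h.outer_mem hs hz)
      rw [norm_mul, Complex.norm_real, Real.norm_of_nonneg hs.le, norm_rayPoint θ hr] at e1
      have e2 := h.norm_smul_opResolvent_le hD0 hD hθ hr
      have e0 := rayWeight_nonneg 1 (mul_pos hs hr)
      simp only [hH]
      rw [norm_smul, Complex.norm_exp_ofReal_mul_I, one_mul, norm_smul, norm_mul,
        norm_rayPoint θ hr]
      calc _ ≤ r * (C * rayWeight 1 (s * r)) * (D * M * rayWeight u r) := by gcongr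
        _ = _ := by ring
  have hswap := integral_integral_swap (f := fun s r => H (s, r)) hint
  refine ⟨hint.integral_prod_left, hswap.trans ?_⟩
  have hinner : ∀ r ∈ Ioi (0 : ℝ), ∫ s in Ioi (0 : ℝ), H (s, r) =
      rayIntegral 0 g • (Complex.exp (θ * Complex.I) •
        F (rayPoint θ r) • opResolvent A (rayPoint θ r)) := by
    intro r hr
    rw [← h.rayIntegral_eq_zero_angle hg hC hθ, ← integral_ray_mul θ g hr]
    refine Eq.trans ?_ (integral_smul_const (E := X →L[ℂ] X)
      (fun s : ℝ => rayPoint θ r * g (s * rayPoint θ r)) _)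
    refine setIntegral_congr_fun measurableSet_Ioi fun s _ => ?_
    simp only [hH]
    rw [smul_comm]
  rw [setIntegral_congr_fun measurableSet_Ioi hinner, integral_smul]
  rfl

lemma contour_fubini (h : SectorBound A φ' ω φ M) {F g : ℂ → ℂ} (hF : MemHInfZero φ F)
    (hg : MemHInf φ g) {C : ℝ} (hC0 : 0 ≤ C)
    (hC : ∀ z ∈ sector φ, ‖g z‖ ≤ C * rayWeight 1 ‖z‖) :
    IntegrableOn (fun s : ℝ => sectorContourIntegral A ω (fun z => z * g (s * z) * F z)) (Ioi 0) ∧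
    ∫ s in Ioi (0 : ℝ), sectorContourIntegral A ω (fun z => z * g (s * z) * F z) =
      rayIntegral 0 g • sectorContourIntegral A ω F := by
  obtain ⟨i1, e1⟩ := h.ray_fubini hF hg hC0 hC (Or.inl rfl)
  obtain ⟨i2, e2⟩ := h.ray_fubini hF hg hC0 hC (Or.inr rfl)
  have e : ∀ s : ℝ, sectorContourIntegral A ω (fun z => z * g (s * z) * F z) =
      (2 * Real.pi * Complex.I : ℂ)⁻¹ •
        (rayIntegral (-ω) (fun z => (z * g (s * z)) • F z • opResolvent A z) -
          rayIntegral ω (fun z => (z * g (s * z)) • F z • opResolvent A z)) := fun s => by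
    simp only [sectorContourIntegral_eq, contourIntegral, smul_smul]
  simp only [e]
  refine ⟨(i1.sub i2).smul (2 * Real.pi * Complex.I : ℂ)⁻¹, ?_⟩
  rw [integral_smul, integral_sub i1 i2, e1, e2, ← smul_sub, smul_comm,
    sectorContourIntegral_eq, contourIntegral]

/-- The constant and resolvent parts of the calculus have no contour integral of their own.
Multiplied by `(1+A)⁻¹ - (1+2A)⁻¹`, which has one, they acquire it, and products with resolvents
suffice. -/
lemma resolventDiff_mul_eCalc (h : SectorBound A φ' ω φ M) {f₀ : ℂ → ℂ} (hf : MemHInfZero φ f₀)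
    (l : ℂ) {s : ℝ} (hs : 0 < s) :
    (onePlusInv A 1 - onePlusInv A 2) * eCalc ((s : ℂ) • A) ω f₀ l =
      sectorContourIntegral A ω (fun z => resolventDiff z * eFun f₀ l (s * z)) := by
  have hF := memHInfZero_resolventDiff h.outer_mem
  have hfs := hf.comp_mul h.outer_mem hs
  have m1 := hfs.mul (memHInf_inv_one_add_mul h.outer_mem zero_le_one)
  have m2 := hfs.mul (memHInf_inv_one_add_mul h.outer_mem zero_le_two)
  have m3 := hF.mul (memHInf_inv_one_add_mul h.outer_mem hs.le)
  have e1 : (onePlusInv A 1 - onePlusInv A 2) * sectorContourIntegral ((s : ℂ) • A) ω f₀ =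
      sectorContourIntegral A ω (fun z => f₀ (s * z) * (1 + ((1 : ℝ) : ℂ) * z)⁻¹) +
        (-1 : ℂ) • sectorContourIntegral A ω
          (fun z => f₀ (s * z) * (1 + ((2 : ℝ) : ℂ) * z)⁻¹) := by
    rw [sectorContourIntegral_smul hs, sub_mul,
      h.onePlusInv_mul_sectorContourIntegral hfs one_pos,
      h.onePlusInv_mul_sectorContourIntegral hfs two_pos, neg_one_smul, sub_eq_add_neg]
  have e2 : (onePlusInv A 1 - onePlusInv A 2) * onePlusInv A s =
      sectorContourIntegral A ω (fun z => resolventDiff z * (1 + s * z)⁻¹) := by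
    rw [← h.sectorContourIntegral_resolventDiff, h.sectorContourIntegral_mul_onePlusInv hF hs]
  rw [eCalc, mul_sub, mul_add, e1, onePlusInv_smul, one_mul, mul_smul_comm, mul_smul_comm, e2,
    mul_one, ← h.sectorContourIntegral_resolventDiff, sub_eq_add_neg, ← neg_smul,
    ← h.sectorContourIntegral_const_mul m2, ← h.sectorContourIntegral_const_mul m3,
    ← h.sectorContourIntegral_const_mul hF, ← h.sectorContourIntegral_add m1 (m2.const_mul _),
    ← h.sectorContourIntegral_add (m1.add (m2.const_mul _)) (m3.const_mul _),
    ← h.sectorContourIntegral_add ((m1.add (m2.const_mul _)).add (m3.const_mul _))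
      (hF.const_mul _)]
  refine h.sectorContourIntegral_congr fun z _ => ?_
  simp only [eFun, resolventDiff, Complex.ofReal_one, one_mul, Complex.ofReal_ofNat]
  ring

lemma onePlusInv_pow_mul (h : SectorBound A φ' ω φ M) {f : ℂ → ℂ} (hf : MemHInfZero φ f) {s : ℝ}
    (hs : 0 < s) (n : ℕ) : onePlusInv A s ^ n * sectorContourIntegral A ω f =
      sectorContourIntegral A ω (fun z => f z * (1 + s * z)⁻¹ ^ n) := by
  induction n with
  | zero => simp
  | succ n ih =>
    rw [pow_succ', mul_assoc, ih,
      h.onePlusInv_mul_sectorContourIntegral (hf.mul (memHInf_inv_pow h.outer_mem hs.le n)) hs]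
    simp only [mul_assoc, pow_succ]

lemma bump_mul (h : SectorBound A φ' ω φ M) {f : ℂ → ℂ} (hf : MemHInfZero φ f) {s : ℝ}
    (hs : 0 < s) (k : ℕ) : bump A k s * sectorContourIntegral A ω f =
      sectorContourIntegral A ω (fun z => f z * (s * z * (1 + s * z)⁻¹ ^ (k + 2))) := by
  have m1 := hf.mul (memHInf_inv_pow h.outer_mem hs.le (k + 1))
  have m2 := m1.mul (memHInf_inv_one_add_mul h.outer_mem hs.le)
  rw [bump, mul_assoc, h.onePlusInv_pow_mul hf hs, sub_mul, one_mul,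
    h.onePlusInv_mul_sectorContourIntegral m1 hs, sub_eq_add_neg, ← neg_one_smul ℂ,
    ← h.sectorContourIntegral_const_mul m2, ← h.sectorContourIntegral_add m1 (m2.const_mul _)]
  refine h.sectorContourIntegral_congr fun z hz => ?_
  have hne := one_add_mul_ne_zero h.outer_mem hs.le hz
  -- This is the scalar form of `1 - (1+sA)⁻¹ = sA(1+sA)⁻¹`, the first factor of `bump`.
  have e1 : (s : ℂ) * z * (1 + s * z)⁻¹ = 1 - (1 + s * z)⁻¹ := by
    field_simp
    ring
  rw [pow_succ _ (k + 1), mul_comm ((1 + (s : ℂ) * z)⁻¹ ^ (k + 1)), ← mul_assoc (s * z : ℂ), e1]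
  ring

/-- The reproducing formula for operators. -/
theorem integral_bump_mul_eCalc (h : SectorBound A φ' ω φ M) {f₀ : ℂ → ℂ}
    (hf : MemHInfZero φ f₀) (l : ℂ) (k : ℕ) :
    IntegrableOn (fun s : ℝ => ((s⁻¹ : ℝ) : ℂ) • ((onePlusInv A 1 - onePlusInv A 2) *
      (bump A k s * eCalc ((s : ℂ) • A) ω f₀ l))) (Ioi 0) ∧
    ∫ s in Ioi (0 : ℝ), ((s⁻¹ : ℝ) : ℂ) • ((onePlusInv A 1 - onePlusInv A 2) *
      (bump A k s * eCalc ((s : ℂ) • A) ω f₀ l)) =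
      rayIntegral 0 (weighted (eFun f₀ l) k) • (onePlusInv A 1 - onePlusInv A 2) := by
  have hF := memHInfZero_resolventDiff h.outer_mem
  have hE := memHInf_eFun h.outer_mem hf l
  have hg := memHInf_weighted h.outer_mem hE k
  obtain ⟨C, hC0, hC⟩ := exists_norm_weighted_le h.outer_mem hE k
  have key : ∀ s ∈ Ioi (0 : ℝ), sectorContourIntegral A ω
      (fun z => z * weighted (eFun f₀ l) k (s * z) * resolventDiff z) =
      ((s⁻¹ : ℝ) : ℂ) • ((onePlusInv A 1 - onePlusInv A 2) *
        (bump A k s * eCalc ((s : ℂ) • A) ω f₀ l)) := by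
    intro s hs
    have hs : 0 < s := hs
    have hs' : (s : ℂ) ≠ 0 := by exact_mod_cast hs.ne'
    have m1 := hF.mul (hE.comp_mul h.outer_mem hs)
    have e1 : (onePlusInv A 1 - onePlusInv A 2) * bump A k s =
        bump A k s * (onePlusInv A 1 - onePlusInv A 2) :=
      ((h.bump_commute hs one_pos k).sub_left (h.bump_commute hs two_pos k)).eq
    -- The unbounded factor `z` is absorbed by one resolvent factor, since `sz(1+sz)⁻¹ = 1 -
    -- (1+sz)⁻¹` is bounded.
    have m2 : MemHInfZero φ (fun z => z * weighted (eFun f₀ l) k (s * z) * resolventDiff z) := by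
      have h1 := (memHInf_inv_pow h.outer_mem hs.le (k + 1)).mul
        ((memHInf_const φ 1).add ((memHInf_const φ (-1)).mul
          (memHInf_inv_one_add_mul h.outer_mem hs.le)))
      have h2 := (m1.mul h1).const_mul (s : ℂ)⁻¹
      have h3 : ∀ z ∈ sector φ, z * weighted (eFun f₀ l) k (s * z) * resolventDiff z =
          (s : ℂ)⁻¹ * (resolventDiff z * eFun f₀ l (s * z) *
            ((1 + (s : ℂ) * z)⁻¹ ^ (k + 1) * (1 + -1 * (1 + (s : ℂ) * z)⁻¹))) := by
        intro z hz
        have hne := one_add_mul_ne_zero h.outer_mem hs.le hz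
        have e2 : 1 + -1 * (1 + (s : ℂ) * z)⁻¹ = s * z * (1 + (s : ℂ) * z)⁻¹ := by
          field_simp
          ring
        rw [e2, weighted, pow_succ _ (k + 1)]
        field_simp
      exact h2.congr h3
    rw [← mul_assoc, e1, mul_assoc, h.resolventDiff_mul_eCalc hf l hs, h.bump_mul m1 hs,
      Complex.ofReal_inv, eq_inv_smul_iff₀ hs', ← h.sectorContourIntegral_const_mul m2]
    refine h.sectorContourIntegral_congr fun z _ => ?_
    rw [weighted]
    ring
  obtain ⟨i, e⟩ := h.contour_fubini hF hg hC0 hC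
  rw [h.sectorContourIntegral_resolventDiff, setIntegral_congr_fun measurableSet_Ioi key] at e
  exact ⟨(integrableOn_congr_fun key measurableSet_Ioi).1 i, e⟩

/-- The reproducing formula for vectors with an absolutely convergent orbit integral. -/
theorem smul_sub_onePlusInv_eq (h : SectorBound A φ' ω φ M) {f₀ : ℂ → ℂ}
    (hf : MemHInfZero φ f₀) (l : ℂ) (k : ℕ) {x : X}
    (hx : IntegrableOn (fun s : ℝ => ((s⁻¹ : ℝ) : ℂ) • ((1 - onePlusInv A 1) * bump A k s)
      (eCalc ((s : ℂ) • A) ω f₀ l x)) (Ioi 0)) :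
    rayIntegral 0 (weighted (eFun f₀ l) k) • (x - onePlusInv A 1 x) =
      ∫ s in Ioi (0 : ℝ), ((s⁻¹ : ℝ) : ℂ) • ((1 - onePlusInv A 1) * bump A k s)
        (eCalc ((s : ℂ) • A) ω f₀ l x) := by
  obtain ⟨i, e⟩ := h.integral_bump_mul_eCalc hf l k
  -- The operator formula carries the factor `(1+2A)⁻¹(1 - (1+A)⁻¹)`; only its injective part can be
  -- removed, as `1 - (1+A)⁻¹` kills the kernel of `A`.
  apply h.onePlusInv_injective two_pos
  have h1 : onePlusInv A 2 * (1 - onePlusInv A 1) = onePlusInv A 1 - onePlusInv A 2 := by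
    rw [mul_sub, mul_one, h.onePlusInv_commute two_pos one_pos, h.onePlusInv_one_mul_two]
    module
  have h2 : ∀ y, onePlusInv A 2 (y - onePlusInv A 1 y) =
      (onePlusInv A 1 - onePlusInv A 2) y := fun y => by
    rw [← h1]; simp
  have h3 := congrArg (fun T : X →L[ℂ] X => T x) e
  have h4 := (ContinuousLinearMap.apply ℂ X x).integral_comp_comm i
  have h5 := (onePlusInv A 2).integral_comp_comm hx
  rw [map_smul, h2, ← h5]
  change _ = (rayIntegral 0 (weighted (eFun f₀ l) k)) •
    (onePlusInv A 1 - onePlusInv A 2) x at h3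
  rw [← h3]
  refine h4.symm.trans ?_
  refine setIntegral_congr_fun measurableSet_Ioi fun s _ => ?_
  simp only [map_smul, ContinuousLinearMap.apply_apply]
  congr 1
  rw [← h1]
  simp

end Complete

/-- The bound by a constant multiplies the norms of the factors. The decay `1/s` comes from moving
`A` from one resolvent to the other: `(1 - (1+A)⁻¹)(1+sA)⁻¹ = s⁻¹(1+A)⁻¹(1 - (1+sA)⁻¹)`. -/
lemma norm_mul_bump_le (h : SectorBound A φ' ω φ M) {s : ℝ} (hs : 0 < s) (k : ℕ) :
    ‖(1 - onePlusInv A 1) * bump A k s‖ ≤ (1 + M) ^ 2 * M ^ (k + 1) * min 1 s⁻¹ := by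
  have hM := h.bound_nonneg
  have b1 : ∀ t : ℝ, 0 < t → ‖1 - onePlusInv A t‖ ≤ 1 + M := fun t ht =>
    norm_sub_le_of_le ContinuousLinearMap.norm_id_le (h.norm_onePlusInv_le ht)
  have b2 : ∀ n : ℕ, ∀ T : X →L[ℂ] X, ‖T * onePlusInv A s ^ n‖ ≤ ‖T‖ * M ^ n := by
    intro n
    induction n with
    | zero => intro T; simp
    | succ n ih =>
      intro T
      rw [pow_succ, ← mul_assoc, pow_succ, ← mul_assoc]
      exact (norm_mul_le _ _).trans
        (mul_le_mul (ih T) (h.norm_onePlusInv_le hs) (norm_nonneg _) (by positivity))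
  rw [mul_min_of_nonneg _ _ (by positivity), mul_one]
  refine le_min ?_ ?_
  · rw [bump, ← mul_assoc]
    refine (b2 _ _).trans (mul_le_mul_of_nonneg_right ?_ (by positivity))
    rw [sq]
    exact (norm_mul_le _ _).trans (mul_le_mul (b1 1 one_pos) (b1 s hs) (norm_nonneg _)
      (by linarith))
  · have hc := h.onePlusInv_commute one_pos hs
    have hid := h.onePlusInv_identity one_pos hs
    have hs' : (s : ℂ) ≠ 0 := by exact_mod_cast hs.ne'
    have e1 : (1 - onePlusInv A 1) * onePlusInv A s =
        (s : ℂ)⁻¹ • (onePlusInv A 1 * (1 - onePlusInv A s)) := by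
      rw [eq_inv_smul_iff₀ hs', sub_mul, one_mul, mul_sub, mul_one]
      rw [Complex.ofReal_one, one_smul, one_smul] at hid
      rw [smul_sub, hid]
    have hc' : Commute (onePlusInv A s) (1 - onePlusInv A s) :=
      (Commute.one_right _).sub_right (Commute.refl _)
    have e2 : (1 - onePlusInv A 1) * bump A k s =
        ((s : ℂ)⁻¹ • (onePlusInv A 1 * (1 - onePlusInv A s) * (1 - onePlusInv A s))) *
          onePlusInv A s ^ k := by
      rw [bump, pow_succ', ← mul_assoc, ← mul_assoc, mul_assoc (1 - onePlusInv A 1), ← hc'.eq,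
        ← mul_assoc, e1, smul_mul_assoc]
    rw [e2]
    refine (b2 _ _).trans ?_
    rw [norm_smul, norm_inv, Complex.norm_real, Real.norm_of_nonneg hs.le]
    have e3 : ‖onePlusInv A 1 * (1 - onePlusInv A s) * (1 - onePlusInv A s)‖ ≤
        M * (1 + M) * (1 + M) :=
      (norm_mul_le _ _).trans (mul_le_mul ((norm_mul_le _ _).trans
        (mul_le_mul (h.norm_onePlusInv_le one_pos) (b1 s hs) (norm_nonneg _) hM)) (b1 s hs)
          (norm_nonneg _) (by positivity))
    calc _ ≤ s⁻¹ * (M * (1 + M) * (1 + M)) * M ^ k := by gcongr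
      _ = _ := by ring

end SectorBound

end Reproducing

/-! ### Nonvanishing of moments -/

section Moments

open Filter Topology

/-- A holomorphic function on a sector that vanishes on the positive half-axis is zero. -/
lemma eqOn_zero_sector_of_ofReal {φ : ℝ} (hφ : φ ∈ Ioo 0 Real.pi) {f : ℂ → ℂ}
    (hf : DifferentiableOn ℂ f (sector φ)) (h0 : ∀ r : ℝ, 0 < r → f r = 0) :
    ∀ z ∈ sector φ, f z = 0 := by
  -- In logarithmic coordinates the sector is a strip, convex and hence connected, where the
  -- identity theorem applies.
  set U : Set ℂ := {w | w.im ∈ Ioo (-φ) φ} with hU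
  have hUo : IsOpen U := isOpen_Ioo.preimage Complex.continuous_im
  have hUc : Convex ℝ U := (convex_Ioo (-φ) φ).linear_preimage Complex.imLm
  have hexp : ∀ w ∈ U, Complex.exp w ∈ sector φ := by
    intro w hw
    refine ⟨Complex.exp_ne_zero w, ?_⟩
    rw [← Complex.log_im, Complex.log_exp (by linarith [hw.1, hφ.2]) (by linarith [hw.2, hφ.2])]
    exact abs_lt.2 hw
  have hg : DifferentiableOn ℂ (fun w => f (Complex.exp w)) U :=
    hf.comp Complex.differentiable_exp.differentiableOn hexp
  have hmem : (0 : ℂ) ∈ U := by simpa [hU] using hφ.1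
  have hfreq : ∃ᶠ w in 𝓝[≠] (0 : ℂ), f (Complex.exp w) = 0 := by
    have hu : Tendsto (fun n : ℕ => ((1 / ((n : ℝ) + 1) : ℝ) : ℂ)) atTop (𝓝[≠] 0) := by
      refine tendsto_nhdsWithin_iff.2 ⟨?_, Eventually.of_forall fun n => ?_⟩
      · have := (Complex.continuous_ofReal.tendsto 0).comp
          (tendsto_one_div_add_atTop_nhds_zero_nat (𝕜 := ℝ))
        rw [Complex.ofReal_zero] at this
        exact this
      · have : (1 / ((n : ℝ) + 1) : ℝ) ≠ 0 := by positivity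
        exact Complex.ofReal_ne_zero.2 this
    refine hu.frequently (Frequently.of_forall fun n => ?_)
    rw [← Complex.ofReal_exp]
    exact h0 _ (Real.exp_pos _)
  have hz := (hg.analyticOnNhd hUo).eqOn_zero_of_preconnected_of_frequently_eq_zero
    hUc.isPreconnected hmem hfreq
  intro z hz'
  have h1 : Complex.log z ∈ U := by
    have := abs_lt.1 hz'.2
    simpa [hU, Complex.log_im] using this
  have h2 := hz h1
  simpa [Complex.exp_log hz'.1] using h2

lemma integrableOn_inv_one_add_sq : IntegrableOn (fun s : ℝ => (1 + s)⁻¹ ^ 2) (Ioi 0) := by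
  refine (integrableOn_rayWeight one_pos).mono' (by fun_prop) ?_
  filter_upwards [ae_restrict_mem measurableSet_Ioi] with s hs
  have hs : 0 < s := hs
  rw [Real.norm_of_nonneg (by positivity), sq]
  exact inv_one_add_sq_le_rayWeight hs

/-- A bounded continuous function on the half-line whose moments with respect to
`(1 + s)^{-2} ds` in the variable `(1 + s)⁻¹` all vanish is zero. -/
lemma eq_zero_of_moments {q : ℝ → ℂ} (hc : ContinuousOn q (Ioi 0)) {D : ℝ}
    (hD : ∀ s ∈ Ioi (0 : ℝ), ‖q s‖ ≤ D)
    (hm : ∀ k : ℕ, ∫ s in Ioi (0 : ℝ), ((((1 + s)⁻¹ ^ (k + 2) : ℝ)) : ℂ) * q s = 0) :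
    ∀ s ∈ Ioi (0 : ℝ), q s = 0 := by
  have hD0 : 0 ≤ D := (norm_nonneg _).trans (hD 1 (mem_Ioi.2 one_pos))
  have hu : ∀ s ∈ Ioi (0 : ℝ), (1 + s)⁻¹ ∈ Icc (0 : ℝ) 1 := fun s hs =>
    ⟨by have : 0 < s := hs; positivity, inv_le_one_of_one_le₀ (by linarith [show 0 < s from hs])⟩
  have hcu : ContinuousOn (fun s : ℝ => (1 + s)⁻¹) (Ioi 0) :=
    ContinuousOn.inv₀ (by fun_prop) fun s hs => by have : 0 < s := hs; positivity
  have hint : ∀ v : ℝ → ℝ, ContinuousOn v (Icc 0 1) →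
      IntegrableOn (fun s : ℝ => (((1 + s)⁻¹ ^ 2 * v (1 + s)⁻¹ : ℝ) : ℂ) * q s) (Ioi 0) := by
    intro v hv
    obtain ⟨B, hB⟩ := isCompact_Icc.exists_bound_of_continuousOn hv
    refine (integrableOn_inv_one_add_sq.mul_const (B * D)).mono' ?_ ?_
    · refine ContinuousOn.aestronglyMeasurable ?_ measurableSet_Ioi
      exact (Complex.continuous_ofReal.comp_continuousOn
        ((hcu.pow 2).mul (hv.comp hcu hu))).mul hc
    · filter_upwards [ae_restrict_mem measurableSet_Ioi] with s hs
      rw [norm_mul, Complex.norm_real, norm_mul, mul_assoc]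
      have h1 := hB _ (hu s hs)
      have hB0 : 0 ≤ B := (norm_nonneg _).trans h1
      have h2 : ‖(1 + s)⁻¹ ^ 2‖ = (1 + s)⁻¹ ^ 2 := Real.norm_of_nonneg (by positivity)
      rw [h2]
      exact mul_le_mul_of_nonneg_left (mul_le_mul h1 (hD s hs) (norm_nonneg _) hB0) (by positivity)
  -- The hypotheses are the moments of the variable `(1+s)⁻¹ ∈ [0,1]` against `(1+s)⁻² q(s) ds`, so
  -- all polynomials in that variable are annihilated.
  have hpoly : ∀ p : Polynomial ℝ,
      ∫ s in Ioi (0 : ℝ), (((1 + s)⁻¹ ^ 2 * p.eval (1 + s)⁻¹ : ℝ) : ℂ) * q s = 0 := by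
    intro p
    induction p using Polynomial.induction_on' with
    | add p r hp hr =>
      have e : ∀ s : ℝ, (((1 + s)⁻¹ ^ 2 * (p + r).eval (1 + s)⁻¹ : ℝ) : ℂ) * q s =
          (((1 + s)⁻¹ ^ 2 * p.eval (1 + s)⁻¹ : ℝ) : ℂ) * q s +
          (((1 + s)⁻¹ ^ 2 * r.eval (1 + s)⁻¹ : ℝ) : ℂ) * q s := fun s => by
        rw [Polynomial.eval_add]; push_cast; ring
      simp only [e]
      rw [integral_add (hint _ p.continuous.continuousOn) (hint _ r.continuous.continuousOn), hp,
        hr, add_zero]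
    | monomial k a =>
      have e : ∀ s : ℝ, (((1 + s)⁻¹ ^ 2 * (Polynomial.monomial k a).eval (1 + s)⁻¹ : ℝ) : ℂ) * q s =
          (a : ℂ) * (((((1 + s)⁻¹ ^ (k + 2) : ℝ)) : ℂ) * q s) := fun s => by
        rw [Polynomial.eval_monomial]; push_cast; ring
      simp only [e]
      rw [integral_const_mul, hm k, mul_zero]
  have hcont : ∀ v : ℝ → ℝ, ContinuousOn v (Icc 0 1) →
      ∫ s in Ioi (0 : ℝ), (((1 + s)⁻¹ ^ 2 * v (1 + s)⁻¹ : ℝ) : ℂ) * q s = 0 := by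
    intro v hv
    set W : ℝ := ∫ s in Ioi (0 : ℝ), (1 + s)⁻¹ ^ 2 with hW
    have hW0 : 0 ≤ W := integral_nonneg fun s => by positivity
    rw [← norm_le_zero_iff]
    refine le_of_forall_pos_le_add fun ε hε => ?_
    rw [zero_add]
    -- The error is at most `W * D` times the uniform distance; the `+ 1` avoids division by zero.
    obtain ⟨p, hp⟩ := exists_polynomial_near_of_continuousOn 0 1 v hv (ε / (W * D + 1))
      (by positivity)
    have e : ∫ s in Ioi (0 : ℝ), (((1 + s)⁻¹ ^ 2 * v (1 + s)⁻¹ : ℝ) : ℂ) * q s =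
        ∫ s in Ioi (0 : ℝ), ((((1 + s)⁻¹ ^ 2 * v (1 + s)⁻¹ : ℝ) : ℂ) * q s -
          (((1 + s)⁻¹ ^ 2 * p.eval (1 + s)⁻¹ : ℝ) : ℂ) * q s) := by
      rw [integral_sub (hint v hv) (hint _ p.continuous.continuousOn), hpoly p, sub_zero]
    rw [e]
    refine (norm_integral_le_of_norm_le
      (integrableOn_inv_one_add_sq.mul_const (ε / (W * D + 1) * D)) ?_).trans ?_
    · filter_upwards [ae_restrict_mem measurableSet_Ioi] with s hs
      rw [← sub_mul, ← Complex.ofReal_sub, ← mul_sub, norm_mul, Complex.norm_real, norm_mul,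
        mul_assoc]
      have h2 : ‖(1 + s)⁻¹ ^ 2‖ = (1 + s)⁻¹ ^ 2 := Real.norm_of_nonneg (by positivity)
      rw [h2]
      refine mul_le_mul_of_nonneg_left (mul_le_mul ?_ (hD s hs) (norm_nonneg _) (by positivity))
        (by positivity)
      rw [Real.norm_eq_abs, abs_sub_comm]
      exact (hp _ (hu s hs)).le
    · rw [integral_mul_const, ← hW, mul_left_comm, div_mul_eq_mul_div, div_le_iff₀ (by positivity)]
      nlinarith
  have hae : ∀ᵐ s : ℝ, s ∈ Ioi (0 : ℝ) → q s = 0 := by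
    refine isOpen_Ioi.ae_eq_zero_of_integral_contDiff_smul_eq_zero
      (hc.locallyIntegrableOn measurableSet_Ioi) fun g hg _ hgs => ?_
    -- Chosen so that `(1+s)⁻² v((1+s)⁻¹) = g(s)`. Compact support of `g` makes `v` vanish near `0`,
    -- and at `0` itself the convention `0⁻¹ = 0` gives the value `0`.
    set v : ℝ → ℝ := fun u => (u⁻¹) ^ 2 * g (u⁻¹ - 1) with hv
    have hg0 : ∀ s : ℝ, s ∉ Ioi (0 : ℝ) → g s = 0 := fun s hs =>
      image_eq_zero_of_notMem_tsupport fun hmem => hs (hgs hmem)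
    have hvc : ContinuousOn v (Icc 0 1) := by
      intro u hu'
      rcases hu'.1.eq_or_lt with rfl | hpos
      · obtain ⟨R, hR, hRg⟩ := HasCompactSupport.exists_pos_le_norm ‹HasCompactSupport g›
        have hev : v =ᶠ[𝓝[Icc 0 1] 0] fun _ => 0 := by
          have h1 : ∀ᶠ u : ℝ in 𝓝[Icc 0 1] 0, u < (R + 1)⁻¹ :=
            nhdsWithin_le_nhds (Iio_mem_nhds (by positivity))
          filter_upwards [h1, self_mem_nhdsWithin] with u h2 h3
          rcases h3.1.eq_or_lt with rfl | h4
          · simp [hv]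
          · have h5 : R + 1 < u⁻¹ := by
              rw [lt_inv_comm₀ (by positivity) h4]; exact h2
            simp only [hv]
            rw [hRg _ (by rw [Real.norm_of_nonneg (by linarith)]; linarith), mul_zero]
        exact (continuousWithinAt_const (b := (0 : ℝ))).congr_of_eventuallyEq hev (by simp [hv])
      · have h1 : ContinuousAt (fun u : ℝ => u⁻¹) u := continuousAt_inv₀ hpos.ne'
        exact ((h1.pow 2).mul (hg.continuous.continuousAt.comp
          (h1.sub continuousAt_const))).continuousWithinAt
    rw [← setIntegral_eq_integral_of_forall_compl_eq_zero (s := Ioi (0 : ℝ))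
      fun s hs => by rw [hg0 s hs, zero_smul], ← hcont v hvc]
    refine setIntegral_congr_fun measurableSet_Ioi fun s hs => ?_
    have hs : 0 < s := hs
    have h1 : (1 + s)⁻¹ ^ 2 * v (1 + s)⁻¹ = g s := by
      simp only [hv]
      rw [inv_inv, add_sub_cancel_left, ← mul_assoc, ← mul_pow,
        inv_mul_cancel₀ (by positivity), one_pow, one_mul]
    simp only [h1]
    rw [Complex.real_smul]
  have h := Measure.eqOn_open_of_ae_eq (μ := volume) (f := q) (g := fun _ => 0)
    ((ae_restrict_iff' measurableSet_Ioi).2 hae) isOpen_Ioi hc continuousOn_const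
  exact h

/-- Some moment of a nonzero bounded holomorphic function on a sector does not vanish. -/
theorem exists_rayIntegral_weighted_ne_zero {φ : ℝ} (hφ : φ ∈ Ioo 0 Real.pi) {f : ℂ → ℂ}
    (hf : MemHInf φ f) (h0 : ∃ z ∈ sector φ, f z ≠ 0) :
    ∃ k : ℕ, rayIntegral 0 (weighted f k) ≠ 0 := by
  by_contra! hcon
  obtain ⟨z, hz, hfz⟩ := h0
  obtain ⟨hd, D, hD⟩ := hf
  have hc : ContinuousOn (fun s : ℝ => f s) (Ioi 0) :=
    hd.continuousOn.comp Complex.continuous_ofReal.continuousOn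
      fun s hs => ofReal_mem_sector hφ hs
  refine hfz (eqOn_zero_sector_of_ofReal hφ hd (fun r hr => ?_) z hz)
  refine eq_zero_of_moments hc (fun s hs => hD _ (ofReal_mem_sector hφ hs)) (fun k => ?_) r hr
  rw [← hcon k, rayIntegral]
  refine setIntegral_congr_fun measurableSet_Ioi fun s _ => ?_
  simp [rayPoint_zero_left, weighted]

end Moments

/-! ### Estimates for the orbits and the K-functional -/

section Estimates

open Filter Topology

variable {X : Type*} [NormedAddCommGroup X] [NormedSpace ℂ X]

lemma eCalc_smul_smul (A : X →ₗ.[ℂ] X) (ω : ℝ) (f₀ : ℂ → ℂ) (l : ℂ) (s t : ℝ) :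
    eCalc ((s : ℂ) • (t : ℂ) • A) ω f₀ l = eCalc (((s * t : ℝ) : ℂ) • A) ω f₀ l := by
  rw [smul_smul, Complex.ofReal_mul]

lemma onePlusInv_one_smul (A : X →ₗ.[ℂ] X) (t : ℝ) :
    onePlusInv ((t : ℂ) • A) 1 = onePlusInv A t := by
  rw [onePlusInv_smul, one_mul]

/-! #### The K-functional -/

lemma kFunctional_bddBelow (A : X →ₗ.[ℂ] X) {t : ℝ} (ht : 0 ≤ t) (x : X) :
    0 ∈ lowerBounds {r : ℝ | ∃ (a : X) (b : A.domain), a + (b : X) = x ∧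
      r = ‖a‖ + t * (‖(b : X)‖ + ‖A b‖)} := by
  rintro r ⟨a, b, -, rfl⟩
  positivity

lemma kFunctional_nonempty (A : X →ₗ.[ℂ] X) (t : ℝ) (x : X) :
    {r : ℝ | ∃ (a : X) (b : A.domain), a + (b : X) = x ∧
      r = ‖a‖ + t * (‖(b : X)‖ + ‖A b‖)}.Nonempty :=
  ⟨_, x, 0, by simp, rfl⟩

lemma kFunctional_nonneg (A : X →ₗ.[ℂ] X) {t : ℝ} (ht : 0 ≤ t) (x : X) :
    0 ≤ kFunctional A t x :=
  le_csInf (kFunctional_nonempty A t x) (kFunctional_bddBelow A ht x)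

lemma kFunctional_le (A : X →ₗ.[ℂ] X) {t : ℝ} (ht : 0 ≤ t) {x a : X} (b : A.domain)
    (hab : a + (b : X) = x) : kFunctional A t x ≤ ‖a‖ + t * (‖(b : X)‖ + ‖A b‖) :=
  csInf_le ⟨0, kFunctional_bddBelow A ht x⟩ ⟨a, b, hab, rfl⟩

lemma le_kFunctional (A : X →ₗ.[ℂ] X) {t m : ℝ} {x : X}
    (h : ∀ (a : X) (b : A.domain), a + (b : X) = x → m ≤ ‖a‖ + t * (‖(b : X)‖ + ‖A b‖)) :
    m ≤ kFunctional A t x :=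
  le_csInf (kFunctional_nonempty A t x) (by rintro r ⟨a, b, hab, rfl⟩; exact h a b hab)

/-- Monotonicity supplies the measurability of the K-functional. -/
lemma kFunctional_monotoneOn (A : X →ₗ.[ℂ] X) (x : X) :
    MonotoneOn (fun t => kFunctional A t x) (Ioi 0) := by
  intro s hs t _ hst
  refine le_kFunctional A fun a b hab => (kFunctional_le A (le_of_lt hs) b hab).trans ?_
  gcongr

lemma kFunctional_le_norm (A : X →ₗ.[ℂ] X) {t : ℝ} (ht : 0 ≤ t) (x : X) :
    kFunctional A t x ≤ ‖x‖ := by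
  simpa using kFunctional_le A ht (x := x) (a := x) 0 (by simp)

/-- Since `Φ` contains `min(1, 1/t)`, this is what bounds `‖x‖` by the K-norm. -/
lemma min_mul_norm_le_kFunctional (A : X →ₗ.[ℂ] X) {t : ℝ} (ht : 0 ≤ t) (x : X) :
    min 1 t * ‖x‖ ≤ kFunctional A t x := by
  refine le_kFunctional A fun a b hab => ?_
  rw [← hab]
  calc min 1 t * ‖a + (b : X)‖ ≤ min 1 t * (‖a‖ + ‖(b : X)‖) :=
        mul_le_mul_of_nonneg_left (norm_add_le _ _) (le_min zero_le_one ht)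
    _ = min 1 t * ‖a‖ + min 1 t * ‖(b : X)‖ := mul_add _ _ _
    _ ≤ 1 * ‖a‖ + t * (‖(b : X)‖ + ‖A b‖) := by
        refine add_le_add (mul_le_mul_of_nonneg_right (min_le_left _ _) (norm_nonneg _)) ?_
        exact mul_le_mul (min_le_right _ _) (le_add_of_nonneg_right (norm_nonneg _))
          (norm_nonneg _) ht
    _ = _ := by rw [one_mul]

namespace SectorBound

variable {A : X →ₗ.[ℂ] X} {φ' ω φ M : ℝ}

/-- For `t ≤ 1` split off `b = (1+tA)⁻¹x`: then `tAb = x - b`, which accounts for the factor `2`.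
For `t ≥ 1` the trivial splitting `b = 0` suffices. -/
lemma inv_mul_kFunctional_le (h : SectorBound A φ' ω φ M) {t : ℝ} (ht : 0 < t) (x : X) :
    t⁻¹ * kFunctional A t x ≤
      2 * (t⁻¹ * ‖x - onePlusInv A t x‖) + (M + 1) * (min 1 t⁻¹ * ‖x‖) := by
  have hM := h.bound_nonneg
  rcases le_total t 1 with h1 | h1
  · obtain ⟨hd, hx⟩ := h.exists_onePlusInv_add ht x
    have e1 : t * ‖A ⟨onePlusInv A t x, hd⟩‖ = ‖x - onePlusInv A t x‖ := by
      nth_rewrite 2 [← hx]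
      rw [add_sub_cancel_left, norm_smul, Complex.norm_real, Real.norm_of_nonneg ht.le]
    have e2 := kFunctional_le A ht.le (x := x) (a := x - onePlusInv A t x)
      ⟨onePlusInv A t x, hd⟩ (by simp)
    rw [mul_add, e1] at e2
    have e3 : ‖onePlusInv A t x‖ ≤ M * ‖x‖ :=
      (onePlusInv A t).le_of_opNorm_le (h.norm_onePlusInv_le ht) x
    rw [min_eq_left (one_le_inv_iff₀.2 ⟨ht, h1⟩), one_mul]
    calc t⁻¹ * kFunctional A t x
        ≤ t⁻¹ * (‖x - onePlusInv A t x‖ + (t * (M * ‖x‖) + ‖x - onePlusInv A t x‖)) := by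
          refine mul_le_mul_of_nonneg_left (e2.trans ?_) (by positivity)
          gcongr
      _ = 2 * (t⁻¹ * ‖x - onePlusInv A t x‖) + M * ‖x‖ := by field_simp; ring
      _ ≤ _ := by nlinarith [norm_nonneg x]
  · rw [min_eq_right (inv_le_one_of_one_le₀ h1)]
    have e1 := mul_le_mul_of_nonneg_left (kFunctional_le_norm A ht.le x) (inv_nonneg.2 ht.le)
    have e2 : 0 ≤ t⁻¹ * ‖x - onePlusInv A t x‖ := by positivity
    have e3 : 0 ≤ t⁻¹ * ‖x‖ := by positivity
    nlinarith

/-! #### Continuity in the scaling parameter -/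

lemma re_lt_of_pos_mul (h : SectorBound A φ' ω φ M) {s : ℝ} (hs : 0 < s) {z : ℂ}
    (hz : z.re < ‖z‖ * Real.cos φ') :
    ((s : ℂ) * z).re < ‖(s : ℂ) * z‖ * Real.cos φ' := by
  have := h.pos
  rw [norm_mul, Complex.norm_real, Real.norm_of_nonneg hs.le, Complex.re_ofReal_mul, mul_assoc]
  exact mul_lt_mul_of_pos_left hz hs

lemma neg_one_re_lt (h : SectorBound A φ' ω φ M) :
    (-1 : ℂ).re < ‖(-1 : ℂ)‖ * Real.cos φ' := by
  have := (abs_lt.1 (abs_cos_lt_one h.angle_mem)).1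
  simpa using this

lemma continuousOn_opResolvent_smul (h : SectorBound A φ' ω φ M) {z : ℂ}
    (hz : z.re < ‖z‖ * Real.cos φ') :
    ContinuousOn (fun s : ℝ => opResolvent ((s : ℂ) • A) z) (Ioi 0) := by
  have e : ∀ s ∈ Ioi (0 : ℝ), opResolvent ((s : ℂ) • A) z =
      (s : ℂ)⁻¹ • opResolvent A (((s⁻¹ : ℝ) : ℂ) * z) := by
    intro s hs
    have hs' : (s : ℂ) ≠ 0 := by exact_mod_cast ne_of_gt hs
    rw [← opResolvent_smul A hs', Complex.ofReal_inv, mul_inv_cancel_left₀ hs']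
  refine ContinuousOn.congr ?_ e
  intro s hs
  have hs0 : 0 < s := hs
  have hs' : (s : ℂ) ≠ 0 := by exact_mod_cast hs0.ne'
  have c0 : ContinuousAt (fun s : ℝ => (s : ℂ)⁻¹) s :=
    Complex.continuous_ofReal.continuousAt.inv₀ hs'
  have c1 : ContinuousAt (fun s : ℝ => ((s⁻¹ : ℝ) : ℂ) * z) s := by
    simp only [Complex.ofReal_inv]
    exact c0.mul continuousAt_const
  have c2 : ContinuousAt (fun s : ℝ => opResolvent A (((s⁻¹ : ℝ) : ℂ) * z)) s :=
    ContinuousAt.comp (g := opResolvent A)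
      (h.hasDerivAt_opResolvent (h.re_lt_of_pos_mul (inv_pos.2 hs0) hz)).continuousAt c1
  exact (c0.smul c2).continuousWithinAt

lemma continuousOn_onePlusInv (h : SectorBound A φ' ω φ M) :
    ContinuousOn (onePlusInv A) (Ioi 0) :=
  (h.continuousOn_opResolvent_smul h.neg_one_re_lt).neg

/-- Dominated convergence, with a majorant independent of `s` because all `sA` share the bound `M`.
Continuity gives measurability of the orbits. -/
lemma continuousOn_sectorContourIntegral_smul (h : SectorBound A φ' ω φ M) {f : ℂ → ℂ}
    (hf : MemHInfZero φ f) :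
    ContinuousOn (fun s : ℝ => sectorContourIntegral ((s : ℂ) • A) ω f) (Ioi 0) := by
  obtain ⟨D, u, hD0, hu, hD⟩ := hf.exists_bound
  have key : ∀ θ : ℝ, (θ = -ω ∨ θ = ω) → ContinuousOn (fun s : ℝ =>
      rayIntegral θ (fun z => f z • opResolvent ((s : ℂ) • A) z)) (Ioi 0) := by
    intro θ hθ
    refine continuousOn_of_dominated (bound := fun r => D * M * rayWeight u r) ?_ ?_
      ((integrableOn_rayWeight hu).const_mul _) ?_
    · intro s hs
      refine ContinuousOn.aestronglyMeasurable (fun r hr => ?_) measurableSet_Ioi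
      have c1 := ContinuousAt.comp (x := r)
        ((h.smul hs).continuousAt_smul_opResolvent hf.1 hθ hr) (continuous_rayPoint θ).continuousAt
      exact (c1.const_smul (Complex.exp (θ * Complex.I))).continuousWithinAt
    · intro s hs
      filter_upwards [ae_restrict_mem measurableSet_Ioi] with r hr
      rw [norm_smul, Complex.norm_exp_ofReal_mul_I, one_mul]
      exact (h.smul hs).norm_smul_opResolvent_le hD0 hD hθ hr
    · filter_upwards [ae_restrict_mem measurableSet_Ioi] with r hr
      exact ((h.continuousOn_opResolvent_smul (h.ray_re_lt hθ hr)).const_smul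
        (f (rayPoint θ r))).const_smul (Complex.exp (θ * Complex.I))
  simp only [sectorContourIntegral_eq, contourIntegral]
  exact ((key _ (Or.inl rfl)).sub (key _ (Or.inr rfl))).const_smul
    (2 * Real.pi * Complex.I : ℂ)⁻¹

lemma continuousOn_eCalc (h : SectorBound A φ' ω φ M) {f₀ : ℂ → ℂ} (hf : MemHInfZero φ f₀)
    (l : ℂ) : ContinuousOn (fun s : ℝ => eCalc ((s : ℂ) • A) ω f₀ l) (Ioi 0) := by
  simp only [eCalc, onePlusInv_one_smul]
  exact ((h.continuousOn_sectorContourIntegral_smul hf).add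
    (h.continuousOn_onePlusInv.const_smul l)).sub continuousOn_const

lemma continuousOn_bump (h : SectorBound A φ' ω φ M) (k : ℕ) :
    ContinuousOn (bump A k) (Ioi 0) :=
  (continuousOn_const.sub h.continuousOn_onePlusInv).mul (h.continuousOn_onePlusInv.pow (k + 1))

/-! #### Orbits -/

lemma exists_norm_eCalc_le {f₀ : ℂ → ℂ} (hf : MemHInfZero φ f₀) (l : ℂ) :
    ∃ K : ℝ, 0 ≤ K ∧ ∀ (A : X →ₗ.[ℂ] X) (φ' ω M : ℝ), SectorBound A φ' ω φ M →
      ‖eCalc A ω f₀ l‖ ≤ K * (M + 1) := by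
  obtain ⟨K, hK0, hK⟩ := norm_sectorContourIntegral_le (X := X) hf
  refine ⟨K + ‖l‖, by positivity, fun A φ' ω M h => ?_⟩
  have hM := h.bound_nonneg
  have h1 : ‖l • onePlusInv A 1‖ ≤ ‖l‖ * M := by
    rw [norm_smul]
    exact mul_le_mul_of_nonneg_left (h.norm_onePlusInv_le one_pos) (norm_nonneg _)
  have h2 : ‖l • (1 : X →L[ℂ] X)‖ ≤ ‖l‖ * 1 := by
    rw [norm_smul]
    exact mul_le_mul_of_nonneg_left ContinuousLinearMap.norm_id_le (norm_nonneg _)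
  have h3 := norm_sub_le_of_le (norm_add_le_of_le (hK A φ' ω M h) h1) h2
  refine h3.trans ?_
  nlinarith

/-! ### Comparison of orbits with the K-functional and with resolvent differences -/

section Complete

variable [CompleteSpace X]

/-- If `z⁻¹ (f₀ + l (1 + z)⁻¹ - l) = χ₀ + m (1 + z)⁻¹`, then the operators of the two functions
differ by the factor `A`. -/
lemma eCalc_mul_onePlusInv_two (h : SectorBound A φ' ω φ M) {f₀ χ₀ : ℂ → ℂ}
    (hf : MemHInfZero φ f₀) (hχ : MemHInfZero φ χ₀) {l m : ℂ}
    (hfχ : ∀ z ∈ sector φ, z⁻¹ * eFun f₀ l z = χ₀ z + m * (1 + z)⁻¹) :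
    eCalc A ω f₀ l * onePlusInv A 2 =
      (sectorContourIntegral A ω χ₀ + m • onePlusInv A 1) *
        ((2 : ℂ)⁻¹ • (1 - onePlusInv A 2)) := by
  have hF := memHInfZero_resolventDiff h.outer_mem
  have m1 := hf.mul (memHInf_inv_one_add_mul h.outer_mem zero_le_two)
  have m2 := hχ.mul (memHInf_inv_one_add_mul h.outer_mem zero_le_two)
  have e1 := h.sectorContourIntegral_mul_onePlusInv hf two_pos
  have e2 := h.sectorContourIntegral_mul_onePlusInv hχ two_pos
  have e3 := h.sectorContourIntegral_resolventDiff
  have e4 := h.onePlusInv_one_mul_two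
  have e5 : sectorContourIntegral A ω (fun z => f₀ z * (1 + ((2 : ℝ) : ℂ) * z)⁻¹) =
      (2 : ℂ)⁻¹ • sectorContourIntegral A ω χ₀ +
        (-(2 : ℂ)⁻¹) • sectorContourIntegral A ω (fun z => χ₀ z * (1 + ((2 : ℝ) : ℂ) * z)⁻¹) +
        (m + l) • sectorContourIntegral A ω resolventDiff := by
    rw [← h.sectorContourIntegral_const_mul hχ, ← h.sectorContourIntegral_const_mul m2,
      ← h.sectorContourIntegral_const_mul hF,
      ← h.sectorContourIntegral_add (hχ.const_mul _) (m2.const_mul _),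
      ← h.sectorContourIntegral_add ((hχ.const_mul _).add (m2.const_mul _)) (hF.const_mul _)]
    refine h.sectorContourIntegral_congr fun z hz => ?_
    have n1 := one_add_mul_ne_zero h.outer_mem zero_le_one hz
    have n2 := one_add_mul_ne_zero h.outer_mem zero_le_two hz
    rw [Complex.ofReal_one, one_mul] at n1
    have e6 := hfχ z hz
    rw [inv_mul_eq_iff_eq_mul₀ hz.1, eFun] at e6
    -- The relation `ψ = zχ` with the constants collected: `z(1+z)⁻¹` is bounded, and multiplied by
    -- `(1+2z)⁻¹` it becomes `resolventDiff`, whose operator is known.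
    have e7 : f₀ z = z * χ₀ z + (m + l) * (z * (1 + z)⁻¹) := by
      have e8 : z * (1 + z)⁻¹ = 1 - (1 + z)⁻¹ := by field_simp; ring
      rw [e8]
      linear_combination e6 + m * e8
    have e9 : z * (1 + ((2 : ℝ) : ℂ) * z)⁻¹ =
        (2 : ℂ)⁻¹ - (2 : ℂ)⁻¹ * (1 + ((2 : ℝ) : ℂ) * z)⁻¹ := by
      rw [Complex.ofReal_ofNat] at n2 ⊢
      linear_combination (2 : ℂ)⁻¹ * mul_inv_cancel₀ n2
    rw [resolventDiff_eq h.outer_mem hz, e7]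
    rw [Complex.ofReal_ofNat] at e9 ⊢
    linear_combination χ₀ z * e9
  rw [eCalc, sub_mul, add_mul, smul_mul_assoc, smul_mul_assoc, one_mul, e1, e4, e5, add_mul,
    mul_smul_comm, mul_smul_comm, mul_sub, mul_sub, smul_mul_assoc, smul_mul_assoc, e4, e2, e3,
    mul_one, mul_one]
  module

/-- Every `b ∈ D(A)` is `(1+2A)⁻¹` of `b + 2Ab`, and `(1 - (1+2A)⁻¹)(b + 2Ab) = 2Ab`; evaluate the
preceding identity there. -/
lemma eCalc_apply_domain (h : SectorBound A φ' ω φ M) {f₀ χ₀ : ℂ → ℂ}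
    (hf : MemHInfZero φ f₀) (hχ : MemHInfZero φ χ₀) {l m : ℂ}
    (hfχ : ∀ z ∈ sector φ, z⁻¹ * eFun f₀ l z = χ₀ z + m * (1 + z)⁻¹) (b : A.domain) :
    eCalc A ω f₀ l b = (sectorContourIntegral A ω χ₀ + m • onePlusInv A 1) (A b) := by
  have h1 := h.onePlusInv_apply_add two_pos b
  have h2 := congrArg (fun T : X →L[ℂ] X => T ((b : X) + ((2 : ℝ) : ℂ) • A b))
    (h.eCalc_mul_onePlusInv_two hf hχ hfχ)
  change eCalc A ω f₀ l (onePlusInv A 2 ((b : X) + ((2 : ℝ) : ℂ) • A b)) =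
    (sectorContourIntegral A ω χ₀ + m • onePlusInv A 1) ((2 : ℂ)⁻¹ •
      (((b : X) + ((2 : ℝ) : ℂ) • A b) - onePlusInv A 2 ((b : X) + ((2 : ℝ) : ℂ) • A b))) at h2
  rw [h1] at h2
  rw [h2]
  congr 1
  rw [add_sub_cancel_left, smul_smul, Complex.ofReal_ofNat, inv_mul_cancel₀ two_ne_zero, one_smul]

/-- Orbits are dominated by the K-functional. -/
theorem exists_norm_eCalc_smul_le (h : SectorBound A φ' ω φ M) {f₀ χ₀ : ℂ → ℂ}
    (hf : MemHInfZero φ f₀) (hχ : MemHInfZero φ χ₀) {l m : ℂ}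
    (hfχ : ∀ z ∈ sector φ, z⁻¹ * eFun f₀ l z = χ₀ z + m * (1 + z)⁻¹) :
    ∃ C : ℝ, 0 < C ∧ ∀ t : ℝ, 0 < t → ∀ x : X,
      ‖eCalc ((t : ℂ) • A) ω f₀ l x‖ ≤ C * kFunctional A t x := by
  obtain ⟨K, hK0, hK⟩ := exists_norm_eCalc_le (X := X) hf l
  obtain ⟨K', hK0', hK'⟩ := norm_sectorContourIntegral_le (X := X) hχ
  have hM := h.bound_nonneg
  -- The summand `1` makes `C` positive even when the other terms vanish.
  set C : ℝ := K * (M + 1) + (K' * M + ‖m‖ * M) + 1 with hC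
  have hCpos : 0 < C := by positivity
  refine ⟨C, hCpos, fun t ht x => ?_⟩
  have ht' := h.smul ht
  rw [← div_le_iff₀' hCpos]
  refine le_kFunctional A fun a b hab => ?_
  rw [div_le_iff₀' hCpos, ← hab, map_add]
  have e1 : ‖eCalc ((t : ℂ) • A) ω f₀ l a‖ ≤ K * (M + 1) * ‖a‖ :=
    ContinuousLinearMap.le_of_opNorm_le _ (hK _ _ _ _ ht') a
  have e2 : ‖eCalc ((t : ℂ) • A) ω f₀ l b‖ ≤ (K' * M + ‖m‖ * M) * (t * ‖A b‖) := by
    have e3 := ht'.eCalc_apply_domain hf hχ hfχ b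
    rw [LinearPMap.smul_apply] at e3
    rw [e3]
    have e4 : ‖sectorContourIntegral ((t : ℂ) • A) ω χ₀ + m • onePlusInv ((t : ℂ) • A) 1‖ ≤
        K' * M + ‖m‖ * M := by
      refine norm_add_le_of_le (hK' _ _ _ _ ht') ?_
      rw [norm_smul]
      exact mul_le_mul_of_nonneg_left (ht'.norm_onePlusInv_le one_pos) (norm_nonneg _)
    refine (ContinuousLinearMap.le_of_opNorm_le _ e4 _).trans_eq ?_
    rw [norm_smul, Complex.norm_real, Real.norm_of_nonneg ht.le]
  have n1 : 0 ≤ K * (M + 1) := by positivity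
  have n2 : 0 ≤ K' * M + ‖m‖ * M := by positivity
  have e5 : K * (M + 1) * ‖a‖ ≤ C * ‖a‖ :=
    mul_le_mul_of_nonneg_right (by rw [hC]; linarith) (norm_nonneg _)
  have e6 : (K' * M + ‖m‖ * M) * (t * ‖A b‖) ≤ C * (t * (‖(b : X)‖ + ‖A b‖)) :=
    mul_le_mul (by rw [hC]; linarith)
      (mul_le_mul_of_nonneg_left (le_add_of_nonneg_left (norm_nonneg _)) ht.le)
      (by positivity) hCpos.le
  rw [mul_add]
  exact norm_add_le_of_le (e1.trans e5) (e2.trans e6)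

/-- The case `t = 1`; the other values of `t` follow by applying it to `tA`. -/
lemma norm_sub_onePlusInv_one_le (h : SectorBound A φ' ω φ M) {f₀ : ℂ → ℂ}
    (hf : MemHInfZero φ f₀) (l : ℂ) (k : ℕ) {x : X}
    (hx : IntegrableOn (fun s : ℝ => min 1 s⁻¹ * (s⁻¹ * ‖eCalc ((s : ℂ) • A) ω f₀ l x‖))
      (Ioi 0)) :
    ‖rayIntegral 0 (weighted (eFun f₀ l) k)‖ * ‖x - onePlusInv A 1 x‖ ≤
      (1 + M) ^ 2 * M ^ (k + 1) *
        ∫ s in Ioi (0 : ℝ), min 1 s⁻¹ * (s⁻¹ * ‖eCalc ((s : ℂ) • A) ω f₀ l x‖) := by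
  have hM := h.bound_nonneg
  have hbd : ∀ s ∈ Ioi (0 : ℝ), ‖((s⁻¹ : ℝ) : ℂ) • ((1 - onePlusInv A 1) * bump A k s)
      (eCalc ((s : ℂ) • A) ω f₀ l x)‖ ≤ (1 + M) ^ 2 * M ^ (k + 1) *
        (min 1 s⁻¹ * (s⁻¹ * ‖eCalc ((s : ℂ) • A) ω f₀ l x‖)) := by
    intro s hs
    have hs0 : 0 < s := hs
    rw [norm_smul, Complex.norm_real, Real.norm_of_nonneg (inv_nonneg.2 hs0.le)]
    have h1 := ContinuousLinearMap.le_of_opNorm_le _ (h.norm_mul_bump_le hs0 k)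
      (eCalc ((s : ℂ) • A) ω f₀ l x)
    calc _ ≤ s⁻¹ * ((1 + M) ^ 2 * M ^ (k + 1) * min 1 s⁻¹ *
          ‖eCalc ((s : ℂ) • A) ω f₀ l x‖) := mul_le_mul_of_nonneg_left h1 (by positivity)
      _ = _ := by ring
  have hint : IntegrableOn (fun s : ℝ => ((s⁻¹ : ℝ) : ℂ) • ((1 - onePlusInv A 1) * bump A k s)
      (eCalc ((s : ℂ) • A) ω f₀ l x)) (Ioi 0) := by
    refine (hx.const_mul ((1 + M) ^ 2 * M ^ (k + 1))).mono' ?_ ?_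
    · refine ContinuousOn.aestronglyMeasurable ?_ measurableSet_Ioi
      have c1 : ContinuousOn (fun s : ℝ => ((s⁻¹ : ℝ) : ℂ)) (Ioi 0) :=
        Complex.continuous_ofReal.comp_continuousOn
          (continuousOn_id.inv₀ fun s hs => ne_of_gt hs)
      have c2 := continuousOn_const (c := (1 - onePlusInv A 1)).mul (h.continuousOn_bump k)
      have c3 := (h.continuousOn_eCalc hf l).clm_apply (continuousOn_const (c := x))
      exact c1.smul (c2.clm_apply c3)
    · filter_upwards [ae_restrict_mem measurableSet_Ioi] with s hs using hbd s hs
  rw [← norm_smul, h.smul_sub_onePlusInv_eq hf l k hint, ← integral_const_mul]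
  refine norm_integral_le_of_norm_le (hx.const_mul _) ?_
  filter_upwards [ae_restrict_mem measurableSet_Ioi] with s hs using hbd s hs

/-- The function `x - (1 + tA)⁻¹ x` is controlled by the Calderón operator of the orbit. -/
theorem norm_sub_onePlusInv_le (h : SectorBound A φ' ω φ M) {f₀ : ℂ → ℂ}
    (hf : MemHInfZero φ f₀) (l : ℂ) (k : ℕ) {x : X} {t : ℝ} (ht : 0 < t)
    (h1 : IntegrableOn (fun s : ℝ => s⁻¹ * ‖eCalc ((s : ℂ) • A) ω f₀ l x‖) (Ioc 0 t))
    (h2 : IntegrableOn (fun s : ℝ => s⁻¹ * (s⁻¹ * ‖eCalc ((s : ℂ) • A) ω f₀ l x‖)) (Ioi t)) :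
    ‖rayIntegral 0 (weighted (eFun f₀ l) k)‖ * ‖x - onePlusInv A t x‖ ≤
      (1 + M) ^ 2 * M ^ (k + 1) *
        ((∫ s in Ioc 0 t, s⁻¹ * ‖eCalc ((s : ℂ) • A) ω f₀ l x‖) +
          t * ∫ s in Ioi t, s⁻¹ * (s⁻¹ * ‖eCalc ((s : ℂ) • A) ω f₀ l x‖)) := by
  set f : ℝ → ℝ := fun s => s⁻¹ * ‖eCalc ((s : ℂ) • A) ω f₀ l x‖ with hfdef
  -- The kernel `min(1, t/s)` splits at `s = t` into the two halves of the Calderón operator,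
  -- multiplied by `t`.
  set G : ℝ → ℝ := fun s => min 1 (t * s⁻¹) * f s with hG
  have g1 : ∀ s ∈ Ioc 0 t, G s = f s := fun s hs => by
    simp only [hG]
    rw [min_eq_left, one_mul]
    rw [← div_eq_mul_inv, one_le_div hs.1]
    exact hs.2
  have g2 : ∀ s ∈ Ioi t, G s = t * (s⁻¹ * f s) := fun s hs => by
    simp only [hG]
    rw [min_eq_right, mul_assoc]
    rw [← div_eq_mul_inv, div_le_one (ht.trans hs)]
    exact le_of_lt hs
  have i1 : IntegrableOn G (Ioc 0 t) := (integrableOn_congr_fun g1 measurableSet_Ioc).2 h1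
  have i2 : IntegrableOn G (Ioi t) :=
    (integrableOn_congr_fun g2 measurableSet_Ioi).2 (h2.const_mul t)
  have i3 : IntegrableOn G (Ioi 0) := by
    rw [← Ioc_union_Ioi_eq_Ioi ht.le]; exact i1.union i2
  have e1 : ∫ s in Ioi (0 : ℝ), G s = (∫ s in Ioc 0 t, f s) + t * ∫ s in Ioi t, s⁻¹ * f s := by
    rw [← Ioc_union_Ioi_eq_Ioi ht.le, setIntegral_union Ioc_disjoint_Ioi_same measurableSet_Ioi
      i1 i2, setIntegral_congr_fun measurableSet_Ioc g1, setIntegral_congr_fun measurableSet_Ioi g2,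
      integral_const_mul]
  have g3 : ∀ s ∈ Ioi (0 : ℝ), min 1 s⁻¹ *
      (s⁻¹ * ‖eCalc ((s : ℂ) • (t : ℂ) • A) ω f₀ l x‖) = t * G (t * s) := by
    intro s hs
    have hs0 : 0 < s := hs
    simp only [hG, hfdef]
    rw [eCalc_smul_smul, mul_comm s t, mul_inv, mul_inv_cancel_left₀ ht.ne']
    field_simp
  have i4 : IntegrableOn (fun s => t * G (t * s)) (Ioi 0) := by
    have := (integrableOn_Ioi_comp_mul_left_iff G 0 ht).2 (by rwa [mul_zero])
    exact this.const_mul t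
  have e2 : ∫ s in Ioi (0 : ℝ), t * G (t * s) = ∫ s in Ioi (0 : ℝ), G s := by
    rw [integral_const_mul, integral_comp_mul_left_Ioi G 0 ht, mul_zero, smul_eq_mul,
      mul_inv_cancel_left₀ ht.ne']
  have key := (h.smul ht).norm_sub_onePlusInv_one_le hf l k (x := x)
    ((integrableOn_congr_fun g3 measurableSet_Ioi).2 i4)
  rwa [setIntegral_congr_fun measurableSet_Ioi g3, e2, e1, onePlusInv_one_smul] at key

end Complete

end SectorBound

end Estimates

/-! ### Banach function spaces -/

namespace BanachFunctionSpace

variable {Φ : BanachFunctionSpace}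

lemma Mem.aestronglyMeasurable {f : ℝ → ℂ} (hf : Φ.Mem f) :
    AEStronglyMeasurable f (volume.restrict (Ioi (0 : ℝ))) := by
  obtain ⟨g, hg⟩ := hf
  exact (AEEqFun.aestronglyMeasurable _).congr hg

lemma norm_eq_nrm {f : ℝ → ℂ} (g : Φ.carrier)
    (hg : ((g : ℝ →ₘ[volume.restrict (Ioi (0 : ℝ))] ℂ) : ℝ → ℂ) =ᵐ[volume.restrict (Ioi (0 : ℝ))]
      f) : Φ.norm f = Φ.nrm g := by
  have h : Φ.Mem f := ⟨g, hg⟩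
  rw [BanachFunctionSpace.norm, dif_pos h]
  congr 1
  exact Subtype.ext (AEEqFun.ext (h.choose_spec.trans hg.symm))

lemma norm_nonneg (Φ : BanachFunctionSpace) (f : ℝ → ℂ) : 0 ≤ Φ.norm f := by
  rw [BanachFunctionSpace.norm]
  split_ifs
  · exact apply_nonneg _ _
  · exact le_rfl

lemma mem_congr_ae {f g : ℝ → ℂ} (h : f =ᵐ[volume.restrict (Ioi (0 : ℝ))] g) :
    Φ.Mem f ↔ Φ.Mem g :=
  ⟨fun ⟨u, hu⟩ => ⟨u, hu.trans h⟩, fun ⟨u, hu⟩ => ⟨u, hu.trans h.symm⟩⟩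

lemma norm_congr_ae {f g : ℝ → ℂ} (h : f =ᵐ[volume.restrict (Ioi (0 : ℝ))] g) :
    Φ.norm f = Φ.norm g := by
  by_cases hf : Φ.Mem f
  · obtain ⟨u, hu⟩ := hf
    rw [norm_eq_nrm u hu, norm_eq_nrm u (hu.trans h)]
  · have hg : ¬Φ.Mem g := by rwa [← mem_congr_ae h]
    rw [BanachFunctionSpace.norm, BanachFunctionSpace.norm, dif_neg hf, dif_neg hg]

/-- A function has a modulus in `Φ` of the same or smaller norm. -/
lemma Mem.exists_abs {g : ℝ → ℂ} (hg : Φ.Mem g) {a : ℝ} (ha : 0 ≤ a) : ∃ u : Φ.carrier,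
    ((u : ℝ →ₘ[volume.restrict (Ioi (0 : ℝ))] ℂ) : ℝ → ℂ) =ᵐ[volume.restrict (Ioi (0 : ℝ))]
      (fun t => ((a * ‖g t‖ : ℝ) : ℂ)) ∧ Φ.nrm u ≤ a * Φ.norm g := by
  obtain ⟨v, hv⟩ := id hg
  have hm : AEStronglyMeasurable (fun t => ((a * ‖g t‖ : ℝ) : ℂ))
      (volume.restrict (Ioi (0 : ℝ))) :=
    Complex.continuous_ofReal.comp_aestronglyMeasurable
      (hg.aestronglyMeasurable.norm.const_mul a)
  obtain ⟨hu, hle⟩ := Φ.ideal (AEEqFun.mk _ hm) ((a : ℂ) • v) (by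
    have h1 := AEEqFun.coeFn_smul (a : ℂ) (v : ℝ →ₘ[volume.restrict (Ioi (0 : ℝ))] ℂ)
    filter_upwards [AEEqFun.coeFn_mk _ hm, h1, hv] with t h2 h3 h4
    rw [h2, Submodule.coe_smul, h3, Pi.smul_apply, h4, norm_smul, Complex.norm_real,
      Complex.norm_real, norm_mul, norm_norm])
  refine ⟨⟨_, hu⟩, AEEqFun.coeFn_mk _ hm, hle.trans_eq ?_⟩
  rw [map_smul_eq_mul, Complex.norm_real, Real.norm_of_nonneg ha, norm_eq_nrm v hv]

/-- Moduli of members lie in the space, so the ideal property and the triangle inequality apply to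
`a|g₁| + b|g₂|`. -/
lemma mem_of_le_add {f g₁ g₂ : ℝ → ℂ} (h₁ : Φ.Mem g₁) (h₂ : Φ.Mem g₂)
    (hf : AEStronglyMeasurable f (volume.restrict (Ioi (0 : ℝ)))) {a b : ℝ} (ha : 0 ≤ a)
    (hb : 0 ≤ b) (h : ∀ t ∈ Ioi (0 : ℝ), ‖f t‖ ≤ a * ‖g₁ t‖ + b * ‖g₂ t‖) :
    Φ.Mem f ∧ Φ.norm f ≤ a * Φ.norm g₁ + b * Φ.norm g₂ := by
  obtain ⟨u, hu, hun⟩ := h₁.exists_abs ha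
  obtain ⟨v, hv, hvn⟩ := h₂.exists_abs hb
  obtain ⟨hw, hle⟩ := Φ.ideal (AEEqFun.mk _ hf) (u + v) (by
    have h1 := AEEqFun.coeFn_add (u : ℝ →ₘ[volume.restrict (Ioi (0 : ℝ))] ℂ) v
    filter_upwards [AEEqFun.coeFn_mk _ hf, h1, hu, hv, ae_restrict_mem measurableSet_Ioi]
      with t e1 e2 e3 e4 ht
    rw [e1, Submodule.coe_add, e2, Pi.add_apply, e3, e4, ← Complex.ofReal_add, Complex.norm_real,
      Real.norm_of_nonneg (by positivity)]
    exact h t ht)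
  refine ⟨⟨⟨_, hw⟩, AEEqFun.coeFn_mk _ hf⟩, ?_⟩
  rw [norm_eq_nrm ⟨_, hw⟩ (AEEqFun.coeFn_mk _ hf)]
  exact hle.trans ((map_add_le_add _ _ _).trans (add_le_add hun hvn))

lemma mem_of_le {f g : ℝ → ℂ} (hg : Φ.Mem g)
    (hf : AEStronglyMeasurable f (volume.restrict (Ioi (0 : ℝ)))) {a : ℝ} (ha : 0 ≤ a)
    (h : ∀ t ∈ Ioi (0 : ℝ), ‖f t‖ ≤ a * ‖g t‖) : Φ.Mem f ∧ Φ.norm f ≤ a * Φ.norm g := by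
  simpa using mem_of_le_add hg hg hf ha le_rfl (b := 0) (by simpa using h)

lemma norm_pos_of_ne_zero {f : ℝ → ℂ} (hf : Φ.Mem f) (h : ∀ t ∈ Ioi (0 : ℝ), f t ≠ 0) :
    0 < Φ.norm f := by
  obtain ⟨u, hu⟩ := hf
  refine lt_of_le_of_ne (norm_nonneg Φ f) fun h0 => ?_
  rw [norm_eq_nrm u hu] at h0
  have h1 := Φ.eq_zero_of_nrm u h0.symm
  rw [h1] at hu
  have h2 : ∀ᵐ _t ∂(volume.restrict (Ioi (0 : ℝ))), False := by
    filter_upwards [hu, AEEqFun.coeFn_zero (μ := volume.restrict (Ioi (0 : ℝ))) (β := ℂ),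
      ae_restrict_mem measurableSet_Ioi] with t e1 e2 ht
    rw [Submodule.coe_zero, e2] at e1
    exact h t ht e1.symm
  have h3 : volume.restrict (Ioi (0 : ℝ)) ≠ 0 := by simp
  have := ae_neBot.2 h3
  exact h2.exists.choose_spec

end BanachFunctionSpace

/-! ### The Calderón operator on nonnegative functions -/

section Calderon

lemma hardy_add_ofReal (f : ℝ → ℝ) (t : ℝ) :
    hardyP (fun s => (f s : ℂ)) t + hardyQ (fun s => (f s : ℂ)) t =
      ((t⁻¹ * (∫ s in Ioc 0 t, f s) + ∫ s in Ioi t, s⁻¹ * f s : ℝ) : ℂ) := by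
  have h1 : ∫ s in Ioc 0 t, (f s : ℂ) = ((∫ s in Ioc 0 t, f s : ℝ) : ℂ) := integral_complex_ofReal
  have h2 : ∫ s in Ioi t, ((s⁻¹ : ℝ) : ℂ) * (f s : ℂ) =
      ((∫ s in Ioi t, s⁻¹ * f s : ℝ) : ℂ) := by
    rw [← integral_complex_ofReal]
    simp only [Complex.ofReal_mul]
  rw [hardyP, hardyQ, h1, h2, Complex.ofReal_add, Complex.ofReal_mul]

/-- The Calderón operator has kernel `min(1/t, 1/s)`, and `min(1, 1/t) · min(1, 1/s) ≤ min(1/t,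
1/s)`. Its value at `1` is thereby controlled by a norm in `Φ`. -/
lemma min_mul_hardy_one_le {f : ℝ → ℝ} (hf : ∀ s ∈ Ioi (0 : ℝ), 0 ≤ f s)
    (h1 : ∀ t : ℝ, 0 < t → IntegrableOn f (Ioc 0 t))
    (h2 : ∀ t : ℝ, 0 < t → IntegrableOn (fun s => s⁻¹ * f s) (Ioi t)) {t : ℝ} (ht : 0 < t) :
    min 1 t⁻¹ * ((∫ s in Ioc 0 1, f s) + ∫ s in Ioi (1 : ℝ), s⁻¹ * f s) ≤
      t⁻¹ * (∫ s in Ioc 0 t, f s) + ∫ s in Ioi t, s⁻¹ * f s := by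
  have key : ∀ t : ℝ, 0 < t → ∫ s in Ioi (0 : ℝ), min t⁻¹ s⁻¹ * f s =
      t⁻¹ * (∫ s in Ioc 0 t, f s) + ∫ s in Ioi t, s⁻¹ * f s := by
    intro t ht
    have e1 : ∀ s ∈ Ioc 0 t, min t⁻¹ s⁻¹ * f s = t⁻¹ * f s := fun s hs => by
      rw [min_eq_left (inv_anti₀ hs.1 hs.2)]
    have e2 : ∀ s ∈ Ioi t, min t⁻¹ s⁻¹ * f s = s⁻¹ * f s := fun s hs => by
      rw [min_eq_right (inv_anti₀ ht (le_of_lt hs))]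
    rw [← Ioc_union_Ioi_eq_Ioi ht.le, setIntegral_union Ioc_disjoint_Ioi_same measurableSet_Ioi
      ((integrableOn_congr_fun e1 measurableSet_Ioc).2 ((h1 t ht).const_mul _))
      ((integrableOn_congr_fun e2 measurableSet_Ioi).2 (h2 t ht)),
      setIntegral_congr_fun measurableSet_Ioc e1, setIntegral_congr_fun measurableSet_Ioi e2,
      integral_const_mul]
  have hint : ∀ t : ℝ, 0 < t → IntegrableOn (fun s => min t⁻¹ s⁻¹ * f s) (Ioi 0) := by
    intro t ht
    have e1 : ∀ s ∈ Ioc 0 t, min t⁻¹ s⁻¹ * f s = t⁻¹ * f s := fun s hs => by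
      rw [min_eq_left (inv_anti₀ hs.1 hs.2)]
    have e2 : ∀ s ∈ Ioi t, min t⁻¹ s⁻¹ * f s = s⁻¹ * f s := fun s hs => by
      rw [min_eq_right (inv_anti₀ ht (le_of_lt hs))]
    rw [← Ioc_union_Ioi_eq_Ioi ht.le]
    exact ((integrableOn_congr_fun e1 measurableSet_Ioc).2 ((h1 t ht).const_mul _)).union
      ((integrableOn_congr_fun e2 measurableSet_Ioi).2 (h2 t ht))
  have k1 := key 1 one_pos
  have i1 := hint 1 one_pos
  simp only [inv_one, one_mul] at k1 i1
  rw [← k1, ← key t ht, ← integral_const_mul]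
  refine setIntegral_mono_on (i1.const_mul _) (hint t ht) measurableSet_Ioi fun s hs => ?_
  rw [← mul_assoc]
  refine mul_le_mul_of_nonneg_right ?_ (hf s hs)
  have hs0 : 0 < s := hs
  have a1 : min 1 t⁻¹ ≤ 1 := min_le_left _ _
  have a2 : min 1 t⁻¹ ≤ t⁻¹ := min_le_right _ _
  have b1 : min 1 s⁻¹ ≤ 1 := min_le_left _ _
  have b2 : min 1 s⁻¹ ≤ s⁻¹ := min_le_right _ _
  have a0 : 0 ≤ min 1 t⁻¹ := by positivity
  have b0 : 0 ≤ min 1 s⁻¹ := by positivity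
  refine le_min ?_ ?_
  · exact (mul_le_of_le_one_right a0 b1).trans a2
  · exact (mul_le_of_le_one_left b0 a1).trans b2

end Calderon

/-! ### Representation of the primary calculus -/

section Representation

open Filter Topology

lemma MemHInfZero.tendsto_atTop {φ : ℝ} (hφ : φ ∈ Ioo 0 Real.pi) {f : ℂ → ℂ}
    (hf : MemHInfZero φ f) : Tendsto (fun r : ℝ => f r) atTop (𝓝 0) := by
  obtain ⟨C, s, hC0, hs, hC⟩ := hf.exists_bound
  have h1 : Tendsto (fun r : ℝ => C * r ^ (-s)) atTop (𝓝 (C * 0)) :=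
    (tendsto_rpow_neg_atTop hs).const_mul C
  rw [mul_zero] at h1
  refine squeeze_zero_norm' ?_ h1
  filter_upwards [eventually_gt_atTop 0] with r hr
  have h2 := hC _ (ofReal_mem_sector hφ hr)
  rw [Complex.norm_real, Real.norm_of_nonneg hr.le] at h2
  exact h2.trans (mul_le_mul_of_nonneg_left (min_le_right _ _) hC0)

lemma MemHInfZero.tendsto_zero {φ : ℝ} (hφ : φ ∈ Ioo 0 Real.pi) {f : ℂ → ℂ}
    (hf : MemHInfZero φ f) : Tendsto (fun r : ℝ => f r) (𝓝[>] 0) (𝓝 0) := by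
  obtain ⟨C, s, hC0, hs, hC⟩ := hf.exists_bound
  have h1 : Tendsto (fun r : ℝ => C * r ^ s) (𝓝[>] 0) (𝓝 (C * 0 ^ s)) :=
    ((Real.continuousAt_rpow_const 0 s (Or.inr hs.le)).tendsto.const_mul C).mono_left
      nhdsWithin_le_nhds
  rw [Real.zero_rpow hs.ne', mul_zero] at h1
  refine squeeze_zero_norm' ?_ h1
  filter_upwards [self_mem_nhdsWithin] with r hr
  have hr : 0 < r := hr
  have h2 := hC _ (ofReal_mem_sector hφ hr)
  rw [Complex.norm_real, Real.norm_of_nonneg hr.le] at h2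
  exact h2.trans (mul_le_mul_of_nonneg_left (min_le_left _ _) hC0)

lemma IsEDecomposition.tendsto_atTop {φ : ℝ} (hφ : φ ∈ Ioo 0 Real.pi) {f f₀ : ℂ → ℂ} {l m : ℂ}
    (h : IsEDecomposition φ f f₀ l m) : Tendsto (fun r : ℝ => f r) atTop (𝓝 m) := by
  have h1 : Tendsto (fun r : ℝ => (1 + (r : ℂ))⁻¹) atTop (𝓝 0) := by
    have h2 : Tendsto (fun r : ℝ => ((1 + r)⁻¹ : ℝ)) atTop (𝓝 0) :=
      tendsto_inv_atTop_zero.comp (tendsto_atTop_add_const_left _ _ tendsto_id)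
    have h3 := (Complex.continuous_ofReal.tendsto 0).comp h2
    simpa [Function.comp_def] using h3
  have h4 := ((h.1.tendsto_atTop hφ).add (h1.const_mul l)).add_const m
  rw [mul_zero, zero_add, zero_add] at h4
  refine h4.congr' ?_
  filter_upwards [eventually_gt_atTop 0] with r hr
  exact (h.2 _ (ofReal_mem_sector hφ hr)).symm

lemma IsEDecomposition.tendsto_zero {φ : ℝ} (hφ : φ ∈ Ioo 0 Real.pi) {f f₀ : ℂ → ℂ} {l m : ℂ}
    (h : IsEDecomposition φ f f₀ l m) : Tendsto (fun r : ℝ => f r) (𝓝[>] 0) (𝓝 (l + m)) := by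
  have h1 : Tendsto (fun r : ℝ => (1 + (r : ℂ))⁻¹) (𝓝[>] 0) (𝓝 1) := by
    have h2 : ContinuousAt (fun r : ℝ => (1 + (r : ℂ))⁻¹) 0 :=
      ContinuousAt.inv₀ (by fun_prop) (by simp)
    have h3 := h2.tendsto.mono_left (nhdsWithin_le_nhds (s := Ioi 0))
    simpa using h3
  have h4 := ((h.1.tendsto_zero hφ).add (h1.const_mul l)).add_const m
  rw [mul_one, zero_add] at h4
  refine h4.congr' ?_
  filter_upwards [self_mem_nhdsWithin] with r hr
  exact (h.2 _ (ofReal_mem_sector hφ hr)).symm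

/-- If `f` and `z⁻¹ f` are in `𝓔(S_φ)`, then `f` vanishes at `0` and `z⁻¹ f` at infinity. -/
lemma IsEDecomposition.coeff_eq {φ : ℝ} (hφ : φ ∈ Ioo 0 Real.pi) {f f₀ χ₀ : ℂ → ℂ}
    {l m l' m' : ℂ} (h : IsEDecomposition φ f f₀ l m)
    (h' : IsEDecomposition φ (fun z => z⁻¹ * f z) χ₀ l' m') : m = -l ∧ m' = 0 := by
  constructor
  -- Near the origin `f = z · (z⁻¹f)`, where the second factor has a finite limit; comparison with
  -- the limit `l + m` of `f` gives the first relation.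
  · have h1 : Tendsto (fun r : ℝ => (r : ℂ) * ((r : ℂ)⁻¹ * f r)) (𝓝[>] 0) (𝓝 (0 * (l' + m'))) := by
      refine Tendsto.mul ?_ (h'.tendsto_zero hφ)
      exact (Complex.continuous_ofReal.tendsto' 0 0 Complex.ofReal_zero).mono_left
        nhdsWithin_le_nhds
    have h2 : Tendsto (fun r : ℝ => f r) (𝓝[>] 0) (𝓝 (0 * (l' + m'))) := by
      refine h1.congr' ?_
      filter_upwards [self_mem_nhdsWithin] with r hr
      have : (r : ℂ) ≠ 0 := by exact_mod_cast ne_of_gt hr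
      rw [mul_inv_cancel_left₀ this]
    have h3 := tendsto_nhds_unique (h.tendsto_zero hφ) h2
    rw [zero_mul] at h3
    exact eq_neg_of_add_eq_zero_right h3
  · have h1 : Tendsto (fun r : ℝ => (r : ℂ)⁻¹) atTop (𝓝 0) := by
      have h3 := (Complex.continuous_ofReal.tendsto 0).comp (tendsto_inv_atTop_zero (𝕜 := ℝ))
      simpa [Function.comp_def] using h3
    have h2 := h1.mul (h.tendsto_atTop hφ)
    rw [zero_mul] at h2
    exact tendsto_nhds_unique (h'.tendsto_atTop hφ) h2

variable {X : Type*} [NormedAddCommGroup X] [NormedSpace ℂ X]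

/-- The relation between the constants holds for every decomposition, in particular for the one
selected by choice in `primaryCalculus`; taking `f₀` and `l` from that one avoids comparing
decompositions. The selection depends on `ψ` only, so it serves all `t`. -/
lemma exists_eCalc_representation (A : X →ₗ.[ℂ] X) {φ : ℝ} (hφ : φ ∈ Ioo 0 Real.pi) {ψ : ℂ → ℂ}
    (hψ : MemE φ ψ) (hψ' : MemE φ (fun z => z⁻¹ * ψ z)) :
    ∃ (f₀ χ₀ : ℂ → ℂ) (l m : ℂ), MemHInfZero φ f₀ ∧ MemHInfZero φ χ₀ ∧
      (∀ z ∈ sector φ, ψ z = eFun f₀ l z) ∧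
      (∀ z ∈ sector φ, z⁻¹ * eFun f₀ l z = χ₀ z + m * (1 + z)⁻¹) ∧
      ∀ t : ℝ, 0 < t → primaryCalculus ((t : ℂ) • A) φ ψ =
        eCalc ((t : ℂ) • A) ((sectorialityAngle A + φ) / 2) f₀ l := by
  have hex : ∃ p : (ℂ → ℂ) × ℂ × ℂ, IsEDecomposition φ ψ p.1 p.2.1 p.2.2 := by
    obtain ⟨f₀, l, m, h⟩ := hψ
    exact ⟨(f₀, l, m), h⟩
  obtain ⟨χ₀, l', m', h'⟩ := hψ'
  have h := hex.choose_spec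
  obtain ⟨hm, hm'⟩ := h.coeff_eq hφ h'
  have e1 : ∀ z ∈ sector φ, ψ z = eFun hex.choose.1 hex.choose.2.1 z := fun z hz => by
    rw [h.2 z hz, hm, eFun, sub_eq_add_neg]
  refine ⟨hex.choose.1, χ₀, hex.choose.2.1, l', h.1, h'.1, e1, fun z hz => ?_, fun t ht => ?_⟩
  · have h1 := h'.2 z hz
    rw [hm', add_zero] at h1
    rw [← e1 z hz, ← h1]
  · rw [primaryCalculus, dif_pos hex, hm, hInfZeroCalculus, sectorialityAngle_smul A ht, eCalc,
      onePlusInv, Complex.ofReal_one, one_smul, neg_smul, ← sub_eq_add_neg]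
    rfl

end Representation

/-! ### Interpolation spaces and orbits -/

section Main

variable {X : Type*} [NormedAddCommGroup X] [NormedSpace ℂ X]

/-- The function `s ↦ s⁻¹ |f(sA) x|` for `f = f₀ + l (1 + z)⁻¹ - l`. -/
def orbit (A : X →ₗ.[ℂ] X) (ω : ℝ) (f₀ : ℂ → ℂ) (l : ℂ) (x : X) (s : ℝ) : ℝ :=
  s⁻¹ * ‖eCalc ((s : ℂ) • A) ω f₀ l x‖

/-- The Calderón operator on real functions. -/
def calderon (f : ℝ → ℝ) (t : ℝ) : ℝ :=
  t⁻¹ * (∫ s in Ioc 0 t, f s) + ∫ s in Ioi t, s⁻¹ * f s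

/-- The function `t ↦ t⁻¹ K(t, x)`. -/
def kOrbit (A : X →ₗ.[ℂ] X) (x : X) (t : ℝ) : ℝ := t⁻¹ * kFunctional A t x

lemma orbit_nonneg (A : X →ₗ.[ℂ] X) (ω : ℝ) (f₀ : ℂ → ℂ) (l : ℂ) (x : X) {s : ℝ}
    (hs : s ∈ Ioi (0 : ℝ)) : 0 ≤ orbit A ω f₀ l x s :=
  mul_nonneg (inv_nonneg.2 (le_of_lt hs)) (norm_nonneg _)

lemma kOrbit_nonneg (A : X →ₗ.[ℂ] X) (x : X) {t : ℝ} (ht : t ∈ Ioi (0 : ℝ)) :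
    0 ≤ kOrbit A x t :=
  mul_nonneg (inv_nonneg.2 (le_of_lt ht)) (kFunctional_nonneg A (le_of_lt ht) x)

lemma calderon_nonneg {f : ℝ → ℝ} (hf : ∀ s ∈ Ioi (0 : ℝ), 0 ≤ f s) {t : ℝ} (ht : 0 < t) :
    0 ≤ calderon f t := by
  have h1 : 0 ≤ ∫ s in Ioc 0 t, f s := setIntegral_nonneg measurableSet_Ioc fun s hs => hf s hs.1
  have h2 : 0 ≤ ∫ s in Ioi t, s⁻¹ * f s := setIntegral_nonneg measurableSet_Ioi fun s hs =>
    mul_nonneg (inv_nonneg.2 (ht.trans hs).le) (hf s (ht.trans hs))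
  exact add_nonneg (mul_nonneg (inv_nonneg.2 ht.le) h1) h2

lemma aestronglyMeasurable_kOrbit (A : X →ₗ.[ℂ] X) (x : X) :
    AEStronglyMeasurable (fun t => (kOrbit A x t : ℂ)) (volume.restrict (Ioi (0 : ℝ))) := by
  have h1 := (aemeasurable_restrict_of_monotoneOn (μ := volume) measurableSet_Ioi
    (kFunctional_monotoneOn A x)).aestronglyMeasurable
  exact Complex.continuous_ofReal.comp_aestronglyMeasurable
    (measurable_inv.aestronglyMeasurable.mul h1)

namespace SectorBound

variable {A : X →ₗ.[ℂ] X} {φ' ω φ M : ℝ}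

lemma aestronglyMeasurable_orbit (h : SectorBound A φ' ω φ M) {f₀ : ℂ → ℂ}
    (hf : MemHInfZero φ f₀) (l : ℂ) (x : X) :
    AEStronglyMeasurable (fun t => (orbit A ω f₀ l x t : ℂ)) (volume.restrict (Ioi (0 : ℝ))) := by
  have h1 := (((h.continuousOn_eCalc hf l).clm_apply
    (continuousOn_const (c := x))).norm).aestronglyMeasurable (μ := volume) measurableSet_Ioi
  exact Complex.continuous_ofReal.comp_aestronglyMeasurable
    (measurable_inv.aestronglyMeasurable.mul h1)

end SectorBound

/-! ### Lower bounds for the K-norm and for invertible operators -/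

section Bounds

open BanachFunctionSpace

variable {A : X →ₗ.[ℂ] X} {φ' ω φ M : ℝ} {Φ : BanachFunctionSpace}

lemma norm_min_pos (hΦ : Φ.Mem (fun t => ((min 1 t⁻¹ : ℝ) : ℂ))) :
    0 < Φ.norm (fun t => ((min 1 t⁻¹ : ℝ) : ℂ)) :=
  norm_pos_of_ne_zero hΦ fun _ ht =>
    Complex.ofReal_ne_zero.2 (lt_min one_pos (inv_pos.2 ht)).ne'

/-- The function `min(1, 1/t)` is dominated by `‖x‖⁻¹ t⁻¹K(t,x)`; take norms in `Φ`. -/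
lemma norm_mul_norm_min_le (hΦ : Φ.Mem (fun t => ((min 1 t⁻¹ : ℝ) : ℂ))) {x : X}
    (hx : Φ.Mem (fun t => (kOrbit A x t : ℂ))) :
    ‖x‖ * Φ.norm (fun t => ((min 1 t⁻¹ : ℝ) : ℂ)) ≤ Φ.norm (fun t => (kOrbit A x t : ℂ)) := by
  rcases eq_or_ne x 0 with rfl | hx0
  · rw [_root_.norm_zero, zero_mul]
    exact BanachFunctionSpace.norm_nonneg Φ _
  have hxp : 0 < ‖x‖ := norm_pos_iff.2 hx0
  have h1 := (mem_of_le hx hΦ.aestronglyMeasurable (inv_nonneg.2 hxp.le) fun t ht => by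
    have ht' : 0 < t := ht
    have h2 := min_mul_norm_le_kFunctional A ht'.le x
    rw [Complex.norm_real, Complex.norm_real, Real.norm_of_nonneg (by positivity),
      Real.norm_of_nonneg (kOrbit_nonneg A x ht), le_inv_mul_iff₀ hxp, kOrbit,
      le_inv_mul_iff₀ ht']
    refine le_trans (le_of_eq ?_) h2
    rw [mul_left_comm, mul_min_of_nonneg _ _ ht'.le, mul_one, mul_inv_cancel₀ ht'.ne', min_comm,
      mul_comm]).2
  rwa [le_inv_mul_iff₀ hxp] at h1

/-- Invertibility bounds `y = (1+A)⁻¹x` by `Ay = x - y`, and `x` is the sum of the two. -/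
lemma exists_norm_le_norm_sub (h : SectorBound A φ' ω φ M) (hA : OpInvertible A) :
    ∃ C : ℝ, 0 < C ∧ ∀ x : X, ‖x‖ ≤ C * ‖x - onePlusInv A 1 x‖ := by
  obtain ⟨R, -, hR⟩ := hA
  refine ⟨1 + ‖R‖, by positivity, fun x => ?_⟩
  obtain ⟨hd, hx⟩ := h.exists_onePlusInv_add one_pos x
  have h1 := hR ⟨_, hd⟩
  have h2 : A ⟨_, hd⟩ = x - onePlusInv A 1 x := by
    rw [Complex.ofReal_one, one_smul] at hx
    exact eq_sub_of_add_eq' hx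
  rw [h2, zero_smul, zero_sub, map_neg] at h1
  have h3 : x = (x - onePlusInv A 1 x) + onePlusInv A 1 x := by abel
  calc ‖x‖ ≤ ‖x - onePlusInv A 1 x‖ + ‖onePlusInv A 1 x‖ := by
        nth_rewrite 1 [h3]; exact norm_add_le _ _
    _ ≤ ‖x - onePlusInv A 1 x‖ + ‖R‖ * ‖x - onePlusInv A 1 x‖ := by
        gcongr
        change ‖((⟨_, hd⟩ : A.domain) : X)‖ ≤ _
        rw [← h1, norm_neg]
        exact R.le_opNorm _
    _ = (1 + ‖R‖) * ‖x - onePlusInv A 1 x‖ := by ring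

end Bounds

variable [CompleteSpace X]

namespace SectorBound

variable {A : X →ₗ.[ℂ] X} {φ' ω φ M : ℝ}

lemma exists_inv_mul_norm_sub_le (h : SectorBound A φ' ω φ M) {f₀ : ℂ → ℂ}
    (hf : MemHInfZero φ f₀) (l : ℂ) (h0 : ∃ z ∈ sector φ, eFun f₀ l z ≠ 0) :
    ∃ D : ℝ, 0 < D ∧ ∀ (x : X) (t : ℝ), 0 < t → IntegrableOn (orbit A ω f₀ l x) (Ioc 0 t) →
      IntegrableOn (fun s => s⁻¹ * orbit A ω f₀ l x s) (Ioi t) →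
      t⁻¹ * ‖x - onePlusInv A t x‖ ≤ D * calderon (orbit A ω f₀ l x) t := by
  obtain ⟨k, hk⟩ := exists_rayIntegral_weighted_ne_zero h.outer_mem (memHInf_eFun h.outer_mem hf l)
    h0
  have hc : 0 < ‖rayIntegral 0 (weighted (eFun f₀ l) k)‖ := norm_pos_iff.2 hk
  set c := ‖rayIntegral 0 (weighted (eFun f₀ l) k)‖
  set L := (1 + M) ^ 2 * M ^ (k + 1)
  have hL : 0 ≤ L := by have := h.bound_nonneg; positivity
  -- The `+ 1` keeps the constant positive, since `M` is only known to be nonnegative.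
  refine ⟨(L + 1) / c, by positivity, fun x t ht h1 h2 => ?_⟩
  have h3 := h.norm_sub_onePlusInv_le hf l k ht h1 h2
  have h4 := calderon_nonneg (fun s hs => orbit_nonneg A ω f₀ l x hs) ht
  have h5 : c * ‖x - onePlusInv A t x‖ ≤ t * (L * calderon (orbit A ω f₀ l x) t) := by
    refine h3.trans_eq ?_
    have h6 : ∀ a b : ℝ, L * (a + t * b) = t * (L * (t⁻¹ * a + b)) := fun a b => by field_simp
    exact h6 _ _
  rw [inv_mul_le_iff₀ ht, div_mul_eq_mul_div, mul_div_assoc', le_div_iff₀' hc]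
  refine h5.trans (mul_le_mul_of_nonneg_left ?_ ht.le)
  exact mul_le_mul_of_nonneg_right (by linarith) h4

end SectorBound

namespace BanachFunctionSpace

variable {Φ : BanachFunctionSpace}

/-- The Calderón operator on the nonnegative functions of a space on which it is bounded. -/
lemma exists_calderon_bound (hΦ : CalderonBounded Φ) : ∃ C : ℝ, 0 < C ∧ ∀ f : ℝ → ℝ,
    Φ.Mem (fun t => (f t : ℂ)) → (∀ t : ℝ, 0 < t → IntegrableOn f (Ioc 0 t)) ∧
      (∀ t : ℝ, 0 < t → IntegrableOn (fun s => s⁻¹ * f s) (Ioi t)) ∧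
      Φ.Mem (fun t => (calderon f t : ℂ)) ∧
      Φ.norm (fun t => (calderon f t : ℂ)) ≤ C * Φ.norm (fun t => (f t : ℂ)) := by
  obtain ⟨C, hC⟩ := hΦ
  refine ⟨max C 1, lt_max_of_lt_right one_pos, fun f hf => ?_⟩
  obtain ⟨h1, h2, h3, h4⟩ := hC _ hf
  have e : (fun t => hardyP (fun s => (f s : ℂ)) t + hardyQ (fun s => (f s : ℂ)) t) =
      fun t => (calderon f t : ℂ) := funext fun t => hardy_add_ofReal f t
  rw [e] at h3 h4
  refine ⟨fun t ht => (h1 t ht).re, fun t ht => ?_, h3,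
    h4.trans (mul_le_mul_of_nonneg_right (le_max_left _ _) (norm_nonneg Φ _))⟩
  have h5 := (h2 t ht).re
  simpa [IntegrableOn, ← Complex.ofReal_mul] using h5

end BanachFunctionSpace

/-! ### Comparison of norms in the function space -/

section Equivalence

open BanachFunctionSpace

variable {A : X →ₗ.[ℂ] X} {φ' ω φ M : ℝ} {Φ : BanachFunctionSpace} {f₀ χ₀ : ℂ → ℂ} {l m : ℂ}

lemma exists_orbit_le_kOrbit (h : SectorBound A φ' ω φ M) (hf : MemHInfZero φ f₀)
    (hχ : MemHInfZero φ χ₀)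
    (hfχ : ∀ z ∈ sector φ, z⁻¹ * eFun f₀ l z = χ₀ z + m * (1 + z)⁻¹) :
    ∃ C : ℝ, 0 < C ∧ ∀ x : X, Φ.Mem (fun t => (kOrbit A x t : ℂ)) →
      Φ.Mem (fun t => (orbit A ω f₀ l x t : ℂ)) ∧
      Φ.norm (fun t => (orbit A ω f₀ l x t : ℂ)) ≤ C * Φ.norm (fun t => (kOrbit A x t : ℂ)) := by
  obtain ⟨C, hC0, hC⟩ := h.exists_norm_eCalc_smul_le hf hχ hfχ
  refine ⟨C, hC0, fun x hx => mem_of_le hx (h.aestronglyMeasurable_orbit hf l x) hC0.le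
    fun t ht => ?_⟩
  rw [Complex.norm_real, Complex.norm_real, Real.norm_of_nonneg (orbit_nonneg A ω f₀ l x ht),
    Real.norm_of_nonneg (kOrbit_nonneg A x ht), orbit, kOrbit, mul_left_comm]
  exact mul_le_mul_of_nonneg_left (hC t ht x) (inv_nonneg.2 (le_of_lt ht))

/-- Pointwise, `t⁻¹K(t,x) ≤ 2D · (P+Q)(orbit)(t) + (M+1)‖x‖ min(1, 1/t)`; both functions on the
right lie in `Φ` by hypothesis. -/
lemma exists_kOrbit_le_orbit (hΦ : MemLPQ Φ) (h : SectorBound A φ' ω φ M)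
    (hf : MemHInfZero φ f₀) (h0 : ∃ z ∈ sector φ, eFun f₀ l z ≠ 0) :
    ∃ C : ℝ, 0 < C ∧ ∀ x : X, Φ.Mem (fun t => (orbit A ω f₀ l x t : ℂ)) →
      Φ.Mem (fun t => (kOrbit A x t : ℂ)) ∧ Φ.norm (fun t => (kOrbit A x t : ℂ)) ≤
        C * (‖x‖ + Φ.norm (fun t => (orbit A ω f₀ l x t : ℂ))) := by
  obtain ⟨hmin, hcal⟩ := hΦ
  obtain ⟨D, hD0, hD⟩ := h.exists_inv_mul_norm_sub_le hf l h0
  obtain ⟨C, hC0, hC⟩ := exists_calderon_bound hcal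
  have hM := h.bound_nonneg
  have hm0 := norm_min_pos hmin
  set μ := Φ.norm (fun t => ((min 1 t⁻¹ : ℝ) : ℂ))
  refine ⟨2 * D * C + (M + 1) * μ, by positivity, fun x hx => ?_⟩
  obtain ⟨h1, h2, h3, h4⟩ := hC _ hx
  have h5 := mem_of_le_add h3 hmin (aestronglyMeasurable_kOrbit A x)
    (a := 2 * D) (b := (M + 1) * ‖x‖) (by positivity) (by positivity) fun t ht => by
      have ht' : 0 < t := ht
      rw [Complex.norm_real, Complex.norm_real, Complex.norm_real,
        Real.norm_of_nonneg (kOrbit_nonneg A x ht), Real.norm_of_nonneg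
          (calderon_nonneg (fun s hs => orbit_nonneg A ω f₀ l x hs) ht'),
        Real.norm_of_nonneg (by positivity)]
      have h6 := h.inv_mul_kFunctional_le ht' x
      have h7 := hD x t ht' (h1 t ht') (h2 t ht')
      rw [kOrbit]
      linarith
  refine ⟨h5.1, h5.2.trans ?_⟩
  set N := Φ.norm (fun t => (orbit A ω f₀ l x t : ℂ))
  have hN : 0 ≤ N := BanachFunctionSpace.norm_nonneg Φ _
  have h6 : 2 * D * Φ.norm (fun t => (calderon (orbit A ω f₀ l x) t : ℂ)) ≤ 2 * D * (C * N) :=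
    mul_le_mul_of_nonneg_left h4 (by positivity)
  have h7 : 0 ≤ 2 * D * C * ‖x‖ := by positivity
  have h8 : 0 ≤ (M + 1) * μ * N := by positivity
  linarith

/-- For invertible `A`, `‖x‖` is bounded by the Calderón operator of the orbit at `t = 1`. That
value times `min(1, 1/t)` is below the Calderón operator at every `t`, which turns the pointwise
bound into one by the norm. -/
lemma exists_norm_le_orbit (hΦ : MemLPQ Φ) (h : SectorBound A φ' ω φ M)
    (hf : MemHInfZero φ f₀) (h0 : ∃ z ∈ sector φ, eFun f₀ l z ≠ 0) (hA : OpInvertible A) :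
    ∃ C : ℝ, 0 < C ∧ ∀ x : X, Φ.Mem (fun t => (orbit A ω f₀ l x t : ℂ)) →
      ‖x‖ ≤ C * Φ.norm (fun t => (orbit A ω f₀ l x t : ℂ)) := by
  obtain ⟨hmin, hcal⟩ := hΦ
  obtain ⟨D, hD0, hD⟩ := h.exists_inv_mul_norm_sub_le hf l h0
  obtain ⟨C, hC0, hC⟩ := exists_calderon_bound hcal
  obtain ⟨B, hB0, hB⟩ := exists_norm_le_norm_sub h hA
  have hm0 := norm_min_pos hmin
  set μ := Φ.norm (fun t => ((min 1 t⁻¹ : ℝ) : ℂ)) with hμ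
  refine ⟨B * D * (C / μ), by positivity, fun x hx => ?_⟩
  obtain ⟨h1, h2, h3, h4⟩ := hC _ hx
  have hnn : ∀ s ∈ Ioi (0 : ℝ), 0 ≤ orbit A ω f₀ l x s := fun s hs => orbit_nonneg A ω f₀ l x hs
  have hd0 := calderon_nonneg hnn one_pos
  have hle : calderon (orbit A ω f₀ l x) 1 * μ ≤
      Φ.norm (fun t => (calderon (orbit A ω f₀ l x) t : ℂ)) := by
    rcases hd0.eq_or_lt with hd | hd
    · rw [← hd, zero_mul]
      exact BanachFunctionSpace.norm_nonneg Φ _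
    have h5 := (mem_of_le h3 hmin.aestronglyMeasurable (inv_nonneg.2 hd0) fun t ht => by
      have ht' : 0 < t := ht
      rw [Complex.norm_real, Complex.norm_real, Real.norm_of_nonneg (by positivity),
        Real.norm_of_nonneg (calderon_nonneg hnn ht'), le_inv_mul_iff₀ hd, mul_comm]
      have h6 := min_mul_hardy_one_le hnn h1 h2 ht'
      simpa only [calderon, inv_one, one_mul] using h6).2
    rwa [le_inv_mul_iff₀ hd] at h5
  have h6 := hD x 1 one_pos (h1 1 one_pos) (h2 1 one_pos)
  rw [inv_one, one_mul] at h6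
  have h7 := le_div_iff₀ hm0 |>.2 (hle.trans h4)
  calc ‖x‖ ≤ B * ‖x - onePlusInv A 1 x‖ := hB x
    _ ≤ B * (D * (C * Φ.norm (fun t => (orbit A ω f₀ l x t : ℂ)) / μ)) :=
        mul_le_mul_of_nonneg_left (h6.trans (mul_le_mul_of_nonneg_left h7 hD0.le)) hB0.le
    _ = _ := by ring

end Equivalence

end Main

end

/-! ### The equivalence theorem -/

theorem theorem3p4 {X : Type*} [NormedAddCommGroup X] [NormedSpace ℂ X] [CompleteSpace X]
    (A : X →ₗ.[ℂ] X) (hA : IsSectorial A)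
    (φ : ℝ) (hφ : φ ∈ Set.Ioo (sectorialityAngle A) Real.pi)
    (ψ : ℂ → ℂ) (hψ : DifferentiableOn ℂ ψ (sector φ)) (hψ0 : ∃ z ∈ sector φ, ψ z ≠ 0)
    (hψE : MemE φ ψ) (hψE' : MemE φ (fun z => z⁻¹ * ψ z))
    (Φ : BanachFunctionSpace) (hΦ : MemLPQ Φ) :
    interpSpace A Φ = {x : X | Φ.Mem (orbitFun A φ ψ x)} ∧
    EquivalentOn (interpSpace A Φ) (interpNorm A Φ)
      (fun x => ‖x‖ + Φ.norm (orbitFun A φ ψ x)) ∧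
    (OpInvertible A →
      EquivalentOn (interpSpace A Φ) (interpNorm A Φ)
        (fun x => Φ.norm (orbitFun A φ ψ x))) := by
  obtain ⟨φ', M, h⟩ := hA.exists_sectorBound hφ
  obtain ⟨f₀, χ₀, l, m, hf, hχ, he, hfχ, hcalc⟩ :=
    exists_eCalc_representation A h.outer_mem hψE hψE'
  have h0 : ∃ z ∈ sector φ, eFun f₀ l z ≠ 0 := by
    obtain ⟨z, hz, hne⟩ := hψ0
    exact ⟨z, hz, he z hz ▸ hne⟩
  have horb : ∀ x : X, orbitFun A φ ψ x =ᵐ[volume.restrict (Ioi (0 : ℝ))]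
      fun t => (orbit A ((sectorialityAngle A + φ) / 2) f₀ l x t : ℂ) := fun x => by
    filter_upwards [ae_restrict_mem measurableSet_Ioi] with t ht
    rw [orbitFun, hcalc t ht, norm_smul, Complex.norm_real,
      Real.norm_of_nonneg (inv_nonneg.2 (le_of_lt ht)), orbit]
  have hmem := fun x => BanachFunctionSpace.mem_congr_ae (Φ := Φ) (horb x)
  have hnorm := fun x => BanachFunctionSpace.norm_congr_ae (Φ := Φ) (horb x)
  obtain ⟨C₁, hC₁, H₁⟩ := exists_orbit_le_kOrbit (Φ := Φ) h hf hχ hfχ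
  obtain ⟨C₂, hC₂, H₂⟩ := exists_kOrbit_le_orbit hΦ h hf h0
  have hμ := norm_min_pos hΦ.1
  set μ := Φ.norm (fun t => ((min 1 t⁻¹ : ℝ) : ℂ))
  -- In the lower constant `μ⁻¹` pays for `‖x‖` through `min(1, 1/t)`, and `C₁` pays for the orbit.
  refine ⟨?_, ⟨(μ⁻¹ + C₁)⁻¹, C₂, by positivity, hC₂, fun x hx => ?_⟩, fun hinv => ?_⟩
  · ext x
    exact ⟨fun hx => (hmem x).2 (H₁ x hx).1, fun hx => (H₂ x ((hmem x).1 hx)).1⟩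
  · obtain ⟨h1, h2⟩ := H₁ x hx
    simp only [hnorm]
    refine ⟨?_, ?_⟩
    · rw [inv_mul_le_iff₀ (by positivity), add_mul]
      refine add_le_add ?_ h2
      rw [le_inv_mul_iff₀ hμ, mul_comm]
      exact norm_mul_norm_min_le hΦ.1 hx
    · exact (H₂ x h1).2
  · obtain ⟨C₃, hC₃, H₃⟩ := exists_norm_le_orbit hΦ h hf h0 hinv
    -- The upper bound is the general one with `‖x‖` absorbed into the orbit norm at the cost `C₃`.
    refine ⟨C₁⁻¹, C₂ * (C₃ + 1), by positivity, by positivity, fun x hx => ?_⟩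
    obtain ⟨h1, h2⟩ := H₁ x hx
    simp only [hnorm]
    refine ⟨?_, ?_⟩
    · rw [inv_mul_le_iff₀ hC₁]
      exact h2
    · rw [mul_assoc]
      refine (H₂ x h1).2.trans (mul_le_mul_of_nonneg_left ?_ hC₂.le)
      rw [add_mul, one_mul]
      exact add_le_add (H₃ x h1) le_rfl
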